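/- Let $\widehat g(\xi)=(2\pi)^{-1/2}\int_{\mathbb R}g(x)e^{-ix\xi}\,dx$, $\|g\|_{H^2}=\|(1-\partial_x^2)g\|_{L^2(\mathbb R)}$ and $\langle t\rangle=\sqrt{1+t^2}$. There exist absolute constants $C>0$ and $\overline\varepsilon>0$ such that the following holds. Let $0\le\varepsilon_0\le\overline\varepsilon$, $\varepsilon_1=\varepsilon_0^{1/5}$ and $0<T\le\infty$. Let $u\in C([0,T);H^2(\mathbb R))$ be a real-valued solution (in the sense of distributions in $x$) of $$u_t=\partial_x^5u-u^4u_x,\qquad u(x,0)=u_0(x),$$ whose initial datum satisfies $\|u_0\|_{H^2}+\|xu_0\|_{L^2}\le\varepsilon_0$, and let $f(t)=e^{-t\partial_x^5}u(t)$ be its profile. Assume the a priori bound $$\sup_{1\le t<T}\Big(\|u(t)\|_{H^2}+t^{-1/10}\|xf(t)\|_{L^2}+\|\widehat f(t,\cdot)\|_{L^\infty}\Big)\le\varepsilon_1 .$$ Then for all $t\in[0,T)$ $$\|u(t)\|_{H^2}\le C\varepsilon_0\qquad\text{and}\qquad \|xf(t)\|_{L^2}\le C(\varepsilon_0+\varepsilon_1^5)\langle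 t\rangle^{1/10}.$$ -/

import Mathlib

open MeasureTheory Filter FourierTransform
open scoped ENNReal SchwartzMap Topology

noncomputable section

namespace FifthKdV

/-- The Hilbert space `L²(ℝ)` of complex-valued functions. -/
abbrev L2 : Type := Lp ℂ 2 (volume : Measure ℝ)

/-- The Fourier transform of `g ∈ L²(ℝ)` in the normalization
`ĝ(ξ) = (2π)^(-1/2) ∫ g(x) e^{-ixξ} dx`. Mathlib's `𝓕` on `L²` is the unitary extension of
`g ↦ ∫ g(x) e^{-2πixη} dx`, hence the rescaling. -/
def hat (g : L2) (ξ : ℝ) : ℂ :=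
  ((Real.sqrt (2 * Real.pi))⁻¹ : ℝ) * (𝓕 g : L2) (ξ / (2 * Real.pi))

/-- `‖g‖_{H²} = ‖(1 - ∂ₓ²) g‖_{L²} = ‖(1 + ξ²) ĝ‖_{L²}`, equal to `∞` when `g ∉ H²(ℝ)`. -/
def h2Norm (g : L2) : ℝ≥0∞ :=
  eLpNorm (fun ξ : ℝ => ((1 + ξ ^ 2 : ℝ) : ℂ) * hat g ξ) 2 volume

/-- `‖x g‖_{L²}`, equal to `∞` when `x g ∉ L²(ℝ)`. -/
def weightedNorm (g : L2) : ℝ≥0∞ :=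
  eLpNorm (fun x : ℝ => (x : ℂ) * g x) 2 volume

/-- `‖ĝ‖_{L^∞}` (essential supremum), equal to `∞` when `ĝ` is unbounded. -/
def hatSupNorm (g : L2) : ℝ≥0∞ :=
  eLpNorm (hat g) ∞ volume

/-- The symbol of `e^{-t∂ₓ⁵}`, which is `e^{-t(iξ)⁵} = e^{-itξ⁵}`, in the variable `η = ξ/(2π)`. -/
def symbol (t η : ℝ) : ℂ :=
  Complex.exp (-(Complex.I * ((t * (2 * Real.pi * η) ^ 5 : ℝ) : ℂ)))

theorem norm_symbol (t η : ℝ) : ‖symbol t η‖ = 1 := by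
  have h : -(Complex.I * ((t * (2 * Real.pi * η) ^ 5 : ℝ) : ℂ))
      = ((-(t * (2 * Real.pi * η) ^ 5) : ℝ) : ℂ) * Complex.I := by
    push_cast
    ring
  rw [symbol, h, Complex.norm_exp_ofReal_mul_I]

theorem continuous_symbol (t : ℝ) : Continuous (symbol t) := by
  unfold symbol
  fun_prop

theorem memLp_symbol_mul (t : ℝ) (g : L2) :
    MemLp (fun η : ℝ => symbol t η * (g : ℝ → ℂ) η) 2 volume := by
  refine (Lp.memLp g).of_le
    ((continuous_symbol t).aestronglyMeasurable.mul (Lp.aestronglyMeasurable g)) ?_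
  filter_upwards with η
  rw [norm_mul, norm_symbol, one_mul]

/-- The linear propagator `e^{-t∂ₓ⁵}` on `L²(ℝ)`. -/
def backwardFlow (t : ℝ) (g : L2) : L2 :=
  𝓕⁻ ((memLp_symbol_mul t (𝓕 g)).toLp _)

/-- The profile `f(t) = e^{-t∂ₓ⁵} u(t)`. -/
def profile (u : ℝ → L2) (t : ℝ) : L2 :=
  backwardFlow t (u t)

/-- The time interval `[0, T)`, where `T = ∞` is allowed. -/
def lifespan (T : EReal) : Set ℝ :=
  {t : ℝ | 0 ≤ t ∧ (t : EReal) < T}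

/-- `u` is a real-valued solution in `C([0, T); H²(ℝ))` of the Cauchy problem
`u_t = ∂ₓ⁵ u - u⁴ u_x`, `u(0) = u₀`. The equation is understood in the sense of (tempered)
distributions in `x`, with `u⁴ u_x = ∂ₓ (u⁵ / 5)`. -/
structure IsSolution (T : EReal) (u₀ : L2) (u : ℝ → L2) : Prop where
  real : ∀ t ∈ lifespan T, ∀ᵐ x : ℝ, (u t x).im = 0
  mem_h2 : ∀ t ∈ lifespan T, h2Norm (u t) < ∞
  continuous_h2 : ∀ t ∈ lifespan T,
    Tendsto (fun s => h2Norm (u s - u t)) (𝓝[lifespan T] t) (𝓝 0)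
  equation : ∀ φ : 𝓢(ℝ, ℂ), ∀ t ∈ lifespan T,
    HasDerivWithinAt (fun s : ℝ => ∫ x : ℝ, u s x * φ x)
      (-(∫ x : ℝ, u t x * iteratedDeriv 5 φ x) + (1 / 5) * ∫ x : ℝ, (u t x) ^ 5 * deriv φ x)
      (lifespan T) t
  initial : u 0 = u₀

/-- The norm `‖u‖_X = sup_{t ≥ 1} (‖u(t)‖_{H²} + t^{-1/10} ‖x f(t)‖_{L²} + ‖f̂(t)‖_{L^∞})`, where
the supremum is over the times `t ≥ 1` in `[0, T)`. -/
def xNorm (T : EReal) (u : ℝ → L2) : ℝ≥0∞ :=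
  ⨆ t ∈ {t : ℝ | t ∈ lifespan T ∧ 1 ≤ t},
    (h2Norm (u t) + ENNReal.ofReal (t ^ (-(1 / 10) : ℝ)) * weightedNorm (profile u t)
      + hatSupNorm (profile u t))

end FifthKdV

end

/-! ### Pairings of `L²` functions with Schwartz functions -/

noncomputable section

namespace FifthKdV

open scoped ComplexConjugate

/-! The `H²` bound comes from two conserved quantities, the mass `‖u‖²` and the energy `½‖u_xx‖² -
(1/30)∫u⁶`. Since `∫u⁶ ≤ ‖u‖⁵‖u_xx‖`, small data stay small (`Evol.mass`, `Evol.energy`,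
`Evol.norm_snd_le`). A solution that is only `H²` in space is not differentiable in time with values
in `L²`, but its profile is, because the linear term cancels and `u⁴u_x` lies in `L²`
(`Evol.hasDerivWithinAt_gprof`). Every time derivative is therefore taken on the profile. For the
energy, the quadratic part is regularized by `(1 - e²∂ₓ²)⁻¹` and the potential part by a sharp
frequency cutoff. The two rates of change are uniformly bounded and their sum tends to zero, so
dominated convergence in time gives conservation.

The weighted bound rests on the scaling `u ↦ c u(c⁵t, cx)` of the equation. With `S = 1 + x∂ₓ +
5t∂ₜ` its generator, formally `e^{t∂ₓ⁵}(x f) = x u + 5t∂ₓ⁴u = ∂ₓ⁻¹ S u + t u⁵`, so it suffices to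
bound `∂ₓ⁻¹ S u` and `t‖u⁵‖` in `L²`. As `S u` is not available at this regularity, the finite
difference `u_c - u`, with `u_c = c u(c⁵t, cx)`, is used instead. It has a primitive `D` in `L²`,
initially of size `(1 - c)‖x u₀‖` up to a power of `c` (`exists_scaling_primitive`), and `D_t = ∂ₓ⁵D
- (1/5) q D_x` with `q` the quotient of `u_c⁵ - u⁵` by `u_c - u`. Hence `‖D‖²` grows at the rate of
the sup norm of `q_x`, of order `B⁴/(1+t)` with `B` a small multiple of `ε₁`. Smallness makes the
exponent of growth of `‖D‖` at most `1/10` (`Evol.norm_scaling_difference_le`). Dividing by `1 - c`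
and letting `c → 1` against test functions gives the bound for the generator
(`norm_integral_mul_deriv_le_of_scaling`), hence for `x f` (`Evol.weightedNorm_profile_le`).

Both the size of `q_x` and the bound on `t‖u⁵‖` need dispersive decay: for `t ≥ 1`, `|u| ≲ ε₁
t^{-1/5} ⟨x/t^{1/5}⟩^{-3/8}` and `|u_x| ≲ ε₁ t^{-2/5}`. This follows from the a priori bounds on
`f̂` in `L^∞` and on `∂_ξ f̂` in `L²`. The oscillating factor is integrated by parts with one
explicit approximate antiderivative that stays regular at the stationary points
(`StatScale.hasDerivAt_oscPrim`, `norm_cts_le_of_profile`). For `t ≤ 1` the `H²` bound and Sobolev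
embedding replace dispersion. -/

theorem integrable_mul_of_L2 (p q : L2) : Integrable (fun x => p x * q x) :=
  (Lp.memLp p).integrable_mul (Lp.memLp q)

theorem integrable_mul_schwartz (p : L2) (φ : 𝓢(ℝ, ℂ)) : Integrable (fun x => p x * φ x) :=
  (Lp.memLp p).integrable_mul (φ.memLp 2)

theorem locallyIntegrable_L2 (p : L2) : LocallyIntegrable p volume :=
  (Lp.memLp p).locallyIntegrable (by norm_num)

theorem integral_fourier_mul (p : L2) (χ : 𝓢(ℝ, ℂ)) :
    ∫ η, (𝓕 p : L2) η * χ η = ∫ x, p x * (𝓕 χ : 𝓢(ℝ, ℂ)) x := by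
  have h := congrArg (fun T : 𝓢'(ℝ, ℂ) => T χ) (Lp.fourier_toTemperedDistribution_eq p)
  simp only [TemperedDistribution.fourier_apply, Lp.toTemperedDistribution_apply,
    smul_eq_mul] at h
  simpa only [mul_comm] using h.symm

theorem integral_fourierInv_mul (p : L2) (χ : 𝓢(ℝ, ℂ)) :
    ∫ η, (𝓕⁻ p : L2) η * χ η = ∫ x, p x * (𝓕⁻ χ : 𝓢(ℝ, ℂ)) x := by
  have h := integral_fourier_mul (𝓕⁻ p) (𝓕⁻ χ)
  rw [FourierTransform.fourier_fourierInv_eq, FourierTransform.fourier_fourierInv_eq] at h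
  exact h.symm

/-- Smooth compactly supported functions are Schwartz, and they already separate locally integrable
functions. Local integrability is all that is asked, so the lemma also covers products `freq η * k
η` not yet known to be in `L²`. -/
theorem ae_eq_of_forall_schwartz {f g : ℝ → ℂ} (hf : LocallyIntegrable f volume)
    (hg : LocallyIntegrable g volume)
    (h : ∀ φ : 𝓢(ℝ, ℂ), ∫ x, f x * φ x = ∫ x, g x * φ x) : f =ᵐ[volume] g := by
  refine ae_eq_of_integral_contDiff_smul_eq hf hg fun χ hχ hc => ?_
  have h1 : HasCompactSupport fun x => (χ x : ℂ) := hc.comp_left (g := Complex.ofReal) (by simp)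
  have h2 : ContDiff ℝ (⊤ : ℕ∞) fun x => (χ x : ℂ) := Complex.ofRealCLM.contDiff.comp hχ
  have := h (h1.toSchwartzMap h2)
  simp only [Complex.real_smul, mul_comm ((χ _ : ℝ) : ℂ)]
  exact this

theorem L2_ext_schwartz {p q : L2} (h : ∀ φ : 𝓢(ℝ, ℂ), ∫ x, p x * φ x = ∫ x, q x * φ x) :
    p = q :=
  Lp.ext (ae_eq_of_forall_schwartz (locallyIntegrable_L2 p) (locallyIntegrable_L2 q) h)

theorem norm_star_L2 (p : L2) : ‖star p‖ = ‖p‖ := by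
  rw [Lp.norm_def, Lp.norm_def]
  congr 1
  refine eLpNorm_congr_norm_ae ?_
  filter_upwards [Lp.coeFn_star p] with x hx
  simp [hx]

theorem inner_star_left (p q : L2) : inner ℂ (star p) q = ∫ x, p x * q x := by
  rw [L2.inner_def]
  refine integral_congr_ae ?_
  filter_upwards [Lp.coeFn_star p] with x hx
  simp [hx, RCLike.inner_apply, mul_comm]

theorem inner_eq_integral (p q : L2) : inner ℂ p q = ∫ x, conj (p x) * q x := by
  rw [L2.inner_def]
  refine integral_congr_ae (.of_forall fun x => ?_)
  simp [RCLike.inner_apply, mul_comm]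

theorem norm_integral_mul_le (p q : L2) : ‖∫ x, p x * q x‖ ≤ ‖p‖ * ‖q‖ := by
  rw [← inner_star_left, ← norm_star_L2 p]
  exact norm_inner_le_norm _ _

theorem integral_mul_toLp (p : L2) (φ : 𝓢(ℝ, ℂ)) :
    ∫ x, p x * (φ.toLp 2 : L2) x = ∫ x, p x * φ x := by
  refine integral_congr_ae ?_
  filter_upwards [φ.coeFn_toLp 2] with x hx
  rw [hx]

/-- Duality: the bound extends to all of `L²` by density of Schwartz functions, and testing with
`star p` gives `‖p‖² ≤ M‖p‖`. -/
theorem norm_le_of_schwartz {p : L2} {M : ℝ} (hM : 0 ≤ M)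
    (h : ∀ φ : 𝓢(ℝ, ℂ), ‖∫ x, p x * φ x‖ ≤ M * ‖(φ.toLp 2 : L2)‖) : ‖p‖ ≤ M := by
  have hall : ∀ q : L2, ‖(inner ℂ (star p) q : ℂ)‖ ≤ M * ‖q‖ := by
    intro q
    refine DenseRange.induction_on (p := fun q : L2 => ‖(inner ℂ (star p) q : ℂ)‖ ≤ M * ‖q‖)
      (SchwartzMap.denseRange_toLpCLM (F := ℂ) (E := ℝ) (p := 2) (μ := volume) (by norm_num)) q
      (isClosed_le (by fun_prop) (by fun_prop)) fun φ => ?_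
    rw [inner_star_left]
    have := h φ
    rw [← integral_mul_toLp] at this
    exact this
  have h0 := hall (star p)
  rw [inner_self_eq_norm_sq_to_K] at h0
  simp only [norm_pow, norm_algebraMap', norm_norm, norm_star_L2] at h0
  by_contra hp
  push Not at hp
  nlinarith

/-! ### Multiplication operators -/

/-- Bounded measurable functions. -/
structure BddMeas (m : ℝ → ℂ) : Prop where
  meas : Measurable m
  bdd : ∃ C : ℝ, ∀ x, ‖m x‖ ≤ C

theorem BddMeas.of_continuous {m : ℝ → ℂ} (hm : Continuous m) {C : ℝ} (h : ∀ x, ‖m x‖ ≤ C) :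
    BddMeas m := ⟨hm.measurable, C, h⟩

theorem BddMeas.mul {m n : ℝ → ℂ} (hm : BddMeas m) (hn : BddMeas n) :
    BddMeas fun x => m x * n x := by
  obtain ⟨C, hC⟩ := hm.bdd
  obtain ⟨D, hD⟩ := hn.bdd
  refine ⟨hm.meas.mul hn.meas, C * D, fun x => ?_⟩
  rw [norm_mul]
  exact mul_le_mul (hC x) (hD x) (norm_nonneg _) ((norm_nonneg _).trans (hC x))

theorem BddMeas.add {m n : ℝ → ℂ} (hm : BddMeas m) (hn : BddMeas n) :
    BddMeas fun x => m x + n x := by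
  obtain ⟨C, hC⟩ := hm.bdd
  obtain ⟨D, hD⟩ := hn.bdd
  exact ⟨hm.meas.add hn.meas, C + D, fun x => (norm_add_le _ _).trans (add_le_add (hC x) (hD x))⟩

theorem BddMeas.const (c : ℂ) : BddMeas fun _ => c := ⟨measurable_const, ‖c‖, fun _ => le_rfl⟩

theorem BddMeas.pow {m : ℝ → ℂ} (hm : BddMeas m) (n : ℕ) : BddMeas fun x => m x ^ n := by
  induction n with
  | zero => simpa using BddMeas.const 1
  | succ n ih => simpa only [pow_succ] using ih.mul hm

theorem BddMeas.conj {m : ℝ → ℂ} (hm : BddMeas m) : BddMeas fun x => conj (m x) := by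
  obtain ⟨C, hC⟩ := hm.bdd
  exact ⟨Complex.continuous_conj.measurable.comp hm.meas, C, fun x => by simpa using hC x⟩

theorem memLp_mul_of_bound {m f : ℝ → ℂ} (hm : AEStronglyMeasurable m) {C : ℝ}
    (h : ∀ x, ‖m x‖ ≤ C) (hf : MemLp f 2) : MemLp (fun x => m x * f x) 2 := by
  refine hf.of_le_mul (c := C) (hm.mul hf.1) (.of_forall fun x => ?_)
  rw [norm_mul]
  exact mul_le_mul_of_nonneg_right (h x) (norm_nonneg _)

theorem BddMeas.memLp {m f : ℝ → ℂ} (hm : BddMeas m) (hf : MemLp f 2) :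
    MemLp (fun x => m x * f x) 2 :=
  memLp_mul_of_bound hm.meas.aestronglyMeasurable hm.bdd.choose_spec hf

theorem norm_L2_le_of_ae {p q : L2} {C : ℝ} (h : ∀ᵐ x, ‖p x‖ ≤ C * ‖q x‖) :
    ‖p‖ ≤ C * ‖q‖ := Lp.norm_le_mul_norm_of_ae_le_mul h

open Classical in
/-- Multiplication by a bounded measurable function, as an operator on `L²`. -/
def mulL2 (m : ℝ → ℂ) : L2 →L[ℂ] L2 :=
  if hm : BddMeas m then
    LinearMap.mkContinuous
      { toFun := fun g => (hm.memLp (Lp.memLp g)).toLp _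
        map_add' := fun f g => by
          refine Lp.ext ?_
          filter_upwards [MemLp.coeFn_toLp (hm.memLp (Lp.memLp (f + g))),
            MemLp.coeFn_toLp (hm.memLp (Lp.memLp f)), MemLp.coeFn_toLp (hm.memLp (Lp.memLp g)),
            Lp.coeFn_add f g, Lp.coeFn_add ((hm.memLp (Lp.memLp f)).toLp _)
              ((hm.memLp (Lp.memLp g)).toLp _)] with x h1 h2 h3 h4 h5
          rw [h1, h5, Pi.add_apply, h2, h3, h4, Pi.add_apply, mul_add]
        map_smul' := fun c g => by
          refine Lp.ext ?_
          filter_upwards [MemLp.coeFn_toLp (hm.memLp (Lp.memLp (c • g))),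
            MemLp.coeFn_toLp (hm.memLp (Lp.memLp g)), Lp.coeFn_smul c g,
            Lp.coeFn_smul c ((hm.memLp (Lp.memLp g)).toLp _)] with x h1 h2 h3 h4
          simp only [RingHom.id_apply]
          rw [h1, h4, Pi.smul_apply, h2, h3, Pi.smul_apply, smul_eq_mul, smul_eq_mul]
          ring }
      hm.bdd.choose fun g => norm_L2_le_of_ae (by
        filter_upwards [MemLp.coeFn_toLp (hm.memLp (Lp.memLp g))] with x h1
        simp only [LinearMap.coe_mk, AddHom.coe_mk]
        rw [h1, norm_mul]
        exact mul_le_mul_of_nonneg_right (hm.bdd.choose_spec x) (norm_nonneg _))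
  -- The default value lets `mulL2 (cts p)` be written without a proof of boundedness; every use
  -- through `mulL2_coe` supplies one.
  else 0

theorem mulL2_coe {m : ℝ → ℂ} (hm : BddMeas m) (g : L2) :
    mulL2 m g =ᵐ[volume] fun x => m x * g x := by
  rw [mulL2, dif_pos hm]
  exact MemLp.coeFn_toLp (hm.memLp (Lp.memLp g))

theorem norm_mulL2_le {m : ℝ → ℂ} (hm : Measurable m) {C : ℝ} (h : ∀ x, ‖m x‖ ≤ C) (g : L2) :
    ‖mulL2 m g‖ ≤ C * ‖g‖ := by
  refine norm_L2_le_of_ae ?_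
  filter_upwards [mulL2_coe ⟨hm, C, h⟩ g] with x hx
  rw [hx, norm_mul]
  exact mul_le_mul_of_nonneg_right (h x) (norm_nonneg _)

theorem L2_eq_of_ae {p : L2} {q : L2} {f : ℝ → ℂ} (hp : p =ᵐ[volume] f) (hq : q =ᵐ[volume] f) :
    p = q := Lp.ext (hp.trans hq.symm)

theorem mulL2_mulL2 {m n : ℝ → ℂ} (hm : BddMeas m) (hn : BddMeas n) (g : L2) :
    mulL2 m (mulL2 n g) = mulL2 (fun x => m x * n x) g := by
  refine Lp.ext ?_
  filter_upwards [mulL2_coe hm (mulL2 n g), mulL2_coe hn g, mulL2_coe (hm.mul hn) g]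
    with x h1 h2 h3
  rw [h1, h2, h3, mul_assoc]

theorem inner_mulL2_left {m : ℝ → ℂ} (hm : BddMeas m) (p q : L2) :
    inner ℂ (mulL2 m p) q = inner ℂ p (mulL2 (fun x => conj (m x)) q) := by
  rw [inner_eq_integral, inner_eq_integral]
  refine integral_congr_ae ?_
  filter_upwards [mulL2_coe hm p, mulL2_coe hm.conj q] with x h1 h2
  rw [h1, h2, map_mul]
  ring

theorem norm_sq_eq_integral (p : L2) : ‖p‖ ^ 2 = ∫ x, ‖p x‖ ^ 2 := by
  have h := inner_self_eq_norm_sq_to_K (𝕜 := ℂ) p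
  rw [inner_eq_integral] at h
  have h2 : ∫ x, conj (p x) * p x = ((∫ x, ‖p x‖ ^ 2 : ℝ) : ℂ) := by
    rw [← integral_complex_ofReal]
    refine integral_congr_ae (.of_forall fun x => ?_)
    simp [Complex.conj_mul']
  rw [h2] at h
  refine Complex.ofReal_injective ?_
  rw [h]
  simp

/-- Strong convergence of multiplication operators. -/
theorem tendsto_mulL2 {ι : Type*} {l : Filter ι} [l.IsCountablyGenerated] {m : ι → ℝ → ℂ}
    {m' : ℝ → ℂ} {C : ℝ} (hm : ∀ n, Measurable (m n))
    (hb : ∀ n x, ‖m n x‖ ≤ C) (hm' : BddMeas m')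
    (hlim : ∀ᵐ x, Tendsto (fun n => m n x) l (𝓝 (m' x))) (g : L2) :
    Tendsto (fun n => mulL2 (m n) g) l (𝓝 (mulL2 m' g)) := by
  obtain ⟨C', hC'⟩ := hm'.bdd
  have key : ∀ n, ‖mulL2 (m n) g - mulL2 m' g‖ ^ 2 = ∫ x, (‖m n x - m' x‖ * ‖g x‖) ^ 2 := by
    intro n
    rw [norm_sq_eq_integral]
    refine integral_congr_ae ?_
    filter_upwards [mulL2_coe ⟨hm n, C, hb n⟩ g, mulL2_coe hm' g,
      Lp.coeFn_sub (mulL2 (m n) g) (mulL2 m' g)] with x h1 h2 h3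
    rw [h3, Pi.sub_apply, h1, h2, ← sub_mul, norm_mul]
  have hsq : Tendsto (fun n => ‖mulL2 (m n) g - mulL2 m' g‖ ^ 2) l (𝓝 0) := by
    simp_rw [key]
    have hgi : Integrable fun x => ‖g x‖ ^ 2 := (Lp.memLp g).integrable_norm_pow (by norm_num)
    have h0 : (0 : ℝ) = ∫ _ : ℝ, (0 : ℝ) := by simp
    rw [h0]
    refine tendsto_integral_filter_of_dominated_convergence
      (fun x => (C + C') ^ 2 * ‖g x‖ ^ 2) (.of_forall fun n => ?_)
      (.of_forall fun n => .of_forall fun x => ?_) (hgi.const_mul _) ?_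
    · exact ((((hm n).sub hm'.meas).aestronglyMeasurable.norm).mul
        (Lp.aestronglyMeasurable g).norm).pow 2
    · rw [Real.norm_of_nonneg (by positivity), mul_pow]
      gcongr
      exact (norm_sub_le _ _).trans (add_le_add (hb n x) (hC' x))
    · filter_upwards [hlim] with x hx
      have := ((tendsto_iff_norm_sub_tendsto_zero.mp hx).mul_const ‖g x‖).pow 2
      simpa using this
  rw [tendsto_iff_norm_sub_tendsto_zero]
  have := hsq.sqrt
  simpa using this

/-! ### Weak derivatives in `L²` -/

/-- The symbol `2πiη` of `∂ₓ`. -/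
def freq (η : ℝ) : ℂ := 2 * Real.pi * Complex.I * η

theorem continuous_freq : Continuous freq := by unfold freq; fun_prop

theorem temperate_freq : Function.HasTemperateGrowth freq := by
  unfold freq
  have : Function.HasTemperateGrowth fun η : ℝ => (η : ℂ) :=
    Function.Complex.hasTemperateGrowth_ofReal
  fun_prop

theorem conj_freq (η : ℝ) : conj (freq η) = -freq η := by
  simp [freq]
  exact Or.inl (map_ofNat (starRingEnd ℂ) 2)

theorem norm_freq (η : ℝ) : ‖freq η‖ = 2 * Real.pi * |η| := by
  simp [freq, abs_of_pos Real.pi_pos]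

/-- `q` is the weak derivative of `p`. -/
def WD (p q : L2) : Prop := (𝓕 q : L2) =ᵐ[volume] fun η => freq η * (𝓕 p : L2) η

/-- Multiplication of a Schwartz function by `2πiη`. -/
def freqMul : 𝓢(ℝ, ℂ) →L[ℂ] 𝓢(ℝ, ℂ) := SchwartzMap.smulLeftCLM ℂ freq

theorem freqMul_apply (χ : 𝓢(ℝ, ℂ)) (η : ℝ) : freqMul χ η = freq η * χ η := by
  simp [freqMul, SchwartzMap.smulLeftCLM_apply_apply temperate_freq]

theorem deriv_fourier_schwartz (χ : 𝓢(ℝ, ℂ)) (x : ℝ) :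
    deriv (𝓕 χ : 𝓢(ℝ, ℂ)) x = -(𝓕 (freqMul χ) : 𝓢(ℝ, ℂ)) x := by
  have h1 : Integrable (fun x : ℝ => x • χ x) := by
    have := (χ.integrable_pow_mul volume 1)
    refine this.congr' ?_ ?_
    · exact (continuous_id.smul χ.continuous).aestronglyMeasurable
    · exact .of_forall fun x => by simp
  have h2 := (Real.hasDerivAt_fourier χ.integrable h1 x).deriv
  have h3 : (𝓕 χ : 𝓢(ℝ, ℂ)) = (𝓕 (χ : ℝ → ℂ)) := SchwartzMap.fourier_coe χ
  rw [h3, h2]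
  have h4 : ((𝓕 (freqMul χ) : 𝓢(ℝ, ℂ)) : ℝ → ℂ) = 𝓕 (freqMul χ : ℝ → ℂ) :=
    SchwartzMap.fourier_coe _
  rw [h4, Real.fourier_real_eq, Real.fourier_real_eq, ← integral_neg]
  refine integral_congr_ae (.of_forall fun y => ?_)
  simp only [freqMul_apply, smul_eq_mul, freq]
  rw [← smul_neg]
  congr 1
  ring

theorem integral_mul_deriv_fourier (p : L2) (χ : 𝓢(ℝ, ℂ)) :
    ∫ x, p x * deriv (𝓕 χ : 𝓢(ℝ, ℂ)) x = -∫ η, freq η * (𝓕 p : L2) η * χ η := by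
  simp_rw [deriv_fourier_schwartz, mul_neg]
  rw [integral_neg, ← integral_fourier_mul]
  congr 1
  refine integral_congr_ae (.of_forall fun y => ?_)
  simp only [freqMul_apply]
  ring

theorem WD.integral_deriv {p q : L2} (h : WD p q) (φ : 𝓢(ℝ, ℂ)) :
    ∫ x, p x * deriv φ x = -∫ x, q x * φ x := by
  have := integral_mul_deriv_fourier p (𝓕⁻ φ)
  rw [FourierTransform.fourier_fourierInv_eq] at this
  rw [this]
  have h2 := integral_fourier_mul q (𝓕⁻ φ)
  rw [FourierTransform.fourier_fourierInv_eq] at h2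
  rw [← h2]
  congr 1
  refine integral_congr_ae ?_
  filter_upwards [h] with η hη
  rw [hη]

theorem locallyIntegrable_cont_mul {m : ℝ → ℂ} (hm : Continuous m) (p : L2) :
    LocallyIntegrable (fun x => m x * p x) volume := by
  have := (locallyIntegrable_L2 p).locallyIntegrableOn Set.univ
  have := this.continuousOn_mul hm.continuousOn isClosed_univ.isLocallyClosed
  exact locallyIntegrableOn_univ.mp this

/-- Every Schwartz function is some `𝓕 χ`, and differentiating `𝓕 χ` multiplies `χ` by `-freq`. The
distributional identity thus becomes an identity of locally integrable functions in frequency. -/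
theorem WD.of_integral_deriv {p q : L2}
    (h : ∀ φ : 𝓢(ℝ, ℂ), ∫ x, p x * deriv φ x = -∫ x, q x * φ x) : WD p q := by
  refine ae_eq_of_forall_schwartz (locallyIntegrable_L2 _)
    (locallyIntegrable_cont_mul continuous_freq _) fun χ => ?_
  have h1 := h (𝓕 χ)
  rw [integral_mul_deriv_fourier, ← integral_fourier_mul] at h1
  exact (neg_injective h1).symm

theorem WD.unique {p q r : L2} (h : WD p q) (h' : WD p r) : q = r := by
  have : (𝓕 q : L2) = 𝓕 r := Lp.ext (h.trans h'.symm)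
  have h2 := congrArg (fun z : L2 => (𝓕⁻ z : L2)) this
  simpa using h2

theorem WD.add {p q r s : L2} (h : WD p q) (h' : WD r s) : WD (p + r) (q + s) := by
  unfold WD at *
  rw [FourierTransform.fourier_add, FourierTransform.fourier_add]
  filter_upwards [h, h', Lp.coeFn_add (𝓕 p : L2) (𝓕 r), Lp.coeFn_add (𝓕 q : L2) (𝓕 s)]
    with x h1 h2 h3 h4
  rw [h3, h4, Pi.add_apply, Pi.add_apply, h1, h2, mul_add]

theorem WD.smul {p q : L2} (c : ℂ) (h : WD p q) : WD (c • p) (c • q) := by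
  unfold WD at *
  rw [FourierTransform.fourier_smul, FourierTransform.fourier_smul]
  filter_upwards [h, Lp.coeFn_smul c (𝓕 p : L2), Lp.coeFn_smul c (𝓕 q : L2)]
    with x h1 h3 h4
  rw [h3, h4, Pi.smul_apply, Pi.smul_apply, h1, smul_eq_mul, smul_eq_mul]
  ring

theorem WD.sub {p q r s : L2} (h : WD p q) (h' : WD r s) : WD (p - r) (q - s) := by
  simpa [sub_eq_add_neg] using h.add (h'.smul (-1))

theorem inner_fourier (p q : L2) : (inner ℂ (𝓕 p : L2) (𝓕 q : L2) : ℂ) = inner ℂ p q :=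
  Lp.inner_fourier_eq p q

/-- Plancherel, with `freq` purely imaginary. -/
theorem WD.inner {p q r s : L2} (h : WD p q) (h' : WD r s) :
    (inner ℂ p s : ℂ) = -inner ℂ q r := by
  rw [← inner_fourier p s, ← inner_fourier q r, inner_eq_integral, inner_eq_integral,
    ← integral_neg]
  refine integral_congr_ae ?_
  filter_upwards [h, h'] with x h1 h2
  rw [h1, h2, map_mul, conj_freq]
  ring

theorem memLp_deriv_schwartz (φ : 𝓢(ℝ, ℂ)) : MemLp (deriv φ) 2 volume := by
  have h := (SchwartzMap.derivCLM ℂ ℂ φ).memLp 2 (μ := volume)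
  have e : ⇑(SchwartzMap.derivCLM ℂ ℂ φ) = deriv φ :=
    funext fun x => SchwartzMap.derivCLM_apply ℂ φ x
  rwa [e] at h

theorem WD.of_hasDerivAt {f f' : ℝ → ℂ} {p q : L2} (hp : p =ᵐ[volume] f) (hq : q =ᵐ[volume] f')
    (hd : ∀ x, HasDerivAt f (f' x) x) : WD p q := by
  refine WD.of_integral_deriv fun φ => ?_
  have hf : MemLp f 2 volume := (Lp.memLp p).ae_eq hp
  have hf' : MemLp f' 2 volume := (Lp.memLp q).ae_eq hq
  have h1 := integral_mul_deriv_eq_deriv_mul_of_integrable (u := f) (v := φ) (u' := f')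
    (v' := deriv φ) (fun x _ => hd x) (fun x _ => φ.hasDerivAt x)
    (hf.integrable_mul (memLp_deriv_schwartz φ))
    (hf'.integrable_mul (φ.memLp 2)) (hf.integrable_mul (φ.memLp 2))
  have e1 : ∫ x, p x * deriv φ x = ∫ x, f x * deriv φ x := integral_congr_ae (by
    filter_upwards [hp] with x hx; rw [hx])
  have e2 : ∫ x, q x * φ x = ∫ x, f' x * φ x := integral_congr_ae (by
    filter_upwards [hq] with x hx; rw [hx])
  rw [e1, e2, h1]

theorem WD.star {p q : L2} (h : WD p q) : WD (star p) (star q) := by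
  refine WD.of_integral_deriv fun φ => ?_
  have h0 := h.integral_deriv (φ.postcompCLM (𝕜 := ℝ) Complex.conjCLE.toContinuousLinearMap)
  have hd : ∀ x, deriv (φ.postcompCLM (𝕜 := ℝ) Complex.conjCLE.toContinuousLinearMap) x
      = conj (deriv φ x) := by
    intro x
    have := (φ.hasDerivAt x).star
    refine HasDerivAt.deriv ?_
    simpa using! this
  have h1 := congrArg (starRingEnd ℂ) h0
  rw [map_neg, ← integral_conj, ← integral_conj] at h1
  have e1 : ∫ x, (Star.star p : L2) x * deriv φ x = ∫ x, conj (p x * deriv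
      (φ.postcompCLM (𝕜 := ℝ) Complex.conjCLE.toContinuousLinearMap) x) := integral_congr_ae (by
    filter_upwards [Lp.coeFn_star p] with x hx; rw [hx, hd]; simp)
  have e2 : ∫ x, (Star.star q : L2) x * φ x = ∫ x, conj (q x *
      (φ.postcompCLM (𝕜 := ℝ) Complex.conjCLE.toContinuousLinearMap) x) := integral_congr_ae (by
    filter_upwards [Lp.coeFn_star q] with x hx; rw [hx]; simp)
  rw [e1, e2, h1]

theorem WD.integral_mul {p q r s : L2} (h : WD p q) (h' : WD r s) :
    ∫ x, p x * s x = -∫ x, q x * r x := by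
  rw [← inner_star_left, ← inner_star_left]
  exact h.star.inner h'

theorem WD.integral_mul_of_hasDerivAt {p q : L2} (h : WD p q) {f f' : ℝ → ℂ} (hf : MemLp f 2)
    (hf' : MemLp f' 2) (hd : ∀ x, HasDerivAt f (f' x) x) :
    ∫ x, p x * f' x = -∫ x, q x * f x := by
  have h1 := h.integral_mul (WD.of_hasDerivAt hf.coeFn_toLp hf'.coeFn_toLp hd)
  have e1 : ∫ x, p x * f' x = ∫ x, p x * (hf'.toLp f' : L2) x := integral_congr_ae (by
    filter_upwards [hf'.coeFn_toLp] with x hx; rw [hx])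
  have e2 : ∫ x, q x * f x = ∫ x, q x * (hf.toLp f : L2) x := integral_congr_ae (by
    filter_upwards [hf.coeFn_toLp] with x hx; rw [hx])
  rw [e1, e2, h1]

/-- The product rule for a `C¹` function with bounded derivative and a weakly differentiable
function. -/
theorem WD.mul {p q : L2} (h : WD p q) {a a' : ℝ → ℂ} (ha : BddMeas a) (ha' : BddMeas a')
    (hd : ∀ x, HasDerivAt a (a' x) x) : WD (mulL2 a p) (mulL2 a' p + mulL2 a q) := by
  refine WD.of_integral_deriv fun φ => ?_
  have hφ := φ.memLp 2 (μ := volume)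
  have hφ' : MemLp (deriv φ) 2 volume := memLp_deriv_schwartz φ
  have h1 := h.integral_mul_of_hasDerivAt (f := fun x => a x * φ x)
    (f' := fun x => a' x * φ x + a x * deriv φ x) (ha.memLp hφ)
    ((ha'.memLp hφ).add (ha.memLp hφ')) (fun x => (hd x).mul (φ.hasDerivAt x))
  have i1 : Integrable fun x => p x * (a' x * φ x) := (Lp.memLp p).integrable_mul (ha'.memLp hφ)
  have i2 : Integrable fun x => p x * (a x * deriv φ x) :=
    (Lp.memLp p).integrable_mul (ha.memLp hφ')
  have i3 : Integrable fun x => q x * (a x * φ x) := (Lp.memLp q).integrable_mul (ha.memLp hφ)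
  simp_rw [mul_add] at h1
  rw [integral_add i1 i2] at h1
  have e1 : ∫ x, mulL2 a p x * deriv φ x = ∫ x, p x * (a x * deriv φ x) := integral_congr_ae (by
    filter_upwards [mulL2_coe ha p] with x hx; rw [hx]; ring)
  have e2 : ∫ x, (mulL2 a' p + mulL2 a q : L2) x * φ x
      = ∫ x, (p x * (a' x * φ x) + q x * (a x * φ x)) := integral_congr_ae (by
    filter_upwards [mulL2_coe ha' p, mulL2_coe ha q, Lp.coeFn_add (mulL2 a' p) (mulL2 a q)]
      with x hx hy hz
    rw [hz, Pi.add_apply, hx, hy]; ring)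
  rw [e1, e2, integral_add i1 i3]
  linear_combination h1

/-! ### Continuous representatives -/

theorem hasDerivAt_fourierInv {h : ℝ → ℂ} (h0 : Integrable h)
    (h1 : Integrable fun η => freq η * h η) (x : ℝ) :
    HasDerivAt (𝓕⁻ h) (𝓕⁻ (fun η => freq η * h η) x) x := by
  have hx : Integrable fun η : ℝ => η • h η := by
    refine (h1.const_mul (2 * Real.pi * Complex.I)⁻¹).congr (.of_forall fun η => ?_)
    have : (2 * Real.pi * Complex.I) ≠ 0 := by simp [Real.pi_ne_zero]
    simp only [freq, Complex.real_smul]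
    field_simp
  have h2 := Real.hasDerivAt_fourier h0 hx (-x)
  have h3 : HasDerivAt (𝓕 h ∘ Neg.neg) _ x := h2.scomp x (hasDerivAt_neg x)
  have e : (𝓕⁻ h) = (𝓕 h) ∘ Neg.neg := by
    funext y
    exact Real.fourierInv_eq_fourier_neg h y
  rw [e, Real.fourierInv_eq_fourier_neg]
  refine h3.congr_deriv ?_
  rw [neg_smul, one_smul, Real.fourier_real_eq, Real.fourier_real_eq, ← integral_neg]
  refine integral_congr_ae (.of_forall fun y => ?_)
  simp only [smul_eq_mul, freq]
  rw [← smul_neg]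
  congr 1
  ring

theorem norm_fourierInv_le (h : ℝ → ℂ) (x : ℝ) : ‖(𝓕⁻ h : ℝ → ℂ) x‖ ≤ ∫ η, ‖h η‖ := by
  rw [Real.fourierInv_eq_fourier_neg, Real.fourier_real_eq]
  refine (norm_integral_le_integral_norm _).trans (le_of_eq ?_)
  refine integral_congr_ae (.of_forall fun y => ?_)
  simp only [Circle.norm_smul]

theorem continuous_fourierInv {h : ℝ → ℂ} (h0 : Integrable h) : Continuous (𝓕⁻ h : ℝ → ℂ) := by
  have e : (𝓕⁻ h) = (𝓕 h) ∘ Neg.neg := by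
    funext y
    exact Real.fourierInv_eq_fourier_neg h y
  rw [e]
  refine Continuous.comp ?_ continuous_neg
  exact VectorFourier.fourierIntegral_continuous Real.continuous_fourierChar
    (by exact continuous_inner) h0

/-- Identifies the abstract inverse transform on `L²` with the convergent integral when `p` is also
integrable; both move onto the test function. -/
theorem fourierInv_ae_eq (p : L2) (hp : Integrable p) :
    (𝓕⁻ p : L2) =ᵐ[volume] (𝓕⁻ (p : ℝ → ℂ) : ℝ → ℂ) := by
  refine ae_eq_of_forall_schwartz (locallyIntegrable_L2 _)
    (continuous_fourierInv hp).locallyIntegrable fun φ => ?_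
  rw [integral_fourierInv_mul]
  have h1 := VectorFourier.integral_fourierIntegral_smul_eq_flip (L := -innerₗ ℝ)
    (μ := (volume : Measure ℝ)) (ν := (volume : Measure ℝ))
    (f := (p : ℝ → ℂ)) (g := φ) Real.continuous_fourierChar
    (by simpa using! continuous_inner.neg) hp φ.integrable
  have e1 : ∀ ξ, VectorFourier.fourierIntegral Real.fourierChar (volume : Measure ℝ)
      (-innerₗ ℝ) (p : ℝ → ℂ) ξ = (𝓕⁻ (p : ℝ → ℂ) : ℝ → ℂ) ξ := by
    intro ξ
    rw [Real.fourierInv_eq]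
    simp [VectorFourier.fourierIntegral]
  have e2 : ∀ ξ, VectorFourier.fourierIntegral Real.fourierChar (volume : Measure ℝ)
      (-innerₗ ℝ).flip (φ : ℝ → ℂ) ξ = (𝓕⁻ φ : 𝓢(ℝ, ℂ)) ξ := by
    intro ξ
    rw [SchwartzMap.fourierInv_coe, Real.fourierInv_eq]
    simp [VectorFourier.fourierIntegral, mul_comm]
  simp_rw [e1, e2, smul_eq_mul] at h1
  exact h1.symm

/-- The continuous representative of an `H¹` function. -/
def cts (p : L2) : ℝ → ℂ := 𝓕⁻ (⇑(𝓕 p : L2))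

theorem norm_fourier_sq (p : L2) : ∫ η, ‖(𝓕 p : L2) η‖ ^ 2 = ‖p‖ ^ 2 := by
  rw [← norm_sq_eq_integral, Lp.norm_fourier_eq]

theorem integrable_norm_sq (p : L2) : Integrable fun x => ‖p x‖ ^ 2 :=
  (Lp.memLp p).integrable_norm_pow (by norm_num)

theorem integral_inv_one_add_sq_mul {r : ℝ} (hr : 0 < r) :
    ∫ η : ℝ, (1 + (r * η) ^ 2)⁻¹ = Real.pi / r := by
  have := Measure.integral_comp_mul_left (fun y : ℝ => (1 + y ^ 2)⁻¹) r
  rw [this, integral_univ_inv_one_add_sq, abs_of_pos (inv_pos.mpr hr), smul_eq_mul]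
  field_simp

theorem integrable_inv_one_add_sq_mul {r : ℝ} (hr : 0 < r) :
    Integrable fun η : ℝ => (1 + (r * η) ^ 2)⁻¹ :=
  integrable_inv_one_add_sq.comp_mul_left' hr.ne'

/-- Arithmetic-geometric mean inequality with weight `w = 1 + (2πrη)²`. The first term has integral
`c/(4r)`, and `w|p̂|²` is exactly `|p̂|² + r²|q̂|²`. The free parameters `c` and `r` are optimized
below. -/
theorem WD.amgm {p q : L2} (h : WD p q) {r c : ℝ} (hc : 0 < c) :
    ∀ᵐ η, ‖(𝓕 p : L2) η‖ ≤ c / 2 * (1 + (2 * Real.pi * r * η) ^ 2)⁻¹ +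
      1 / (2 * c) * (‖(𝓕 p : L2) η‖ ^ 2 + r ^ 2 * ‖(𝓕 q : L2) η‖ ^ 2) := by
  filter_upwards [h] with η hη
  rw [hη, norm_mul, norm_freq]
  set w := 1 + (2 * Real.pi * r * η) ^ 2
  have hw : 0 < w := by positivity
  set y := ‖(𝓕 p : L2) η‖
  have e : y ^ 2 + r ^ 2 * (2 * Real.pi * |η| * y) ^ 2 = w * y ^ 2 := by
    simp only [w, mul_pow, sq_abs]; ring
  rw [e]
  have : c / 2 * w⁻¹ + 1 / (2 * c) * (w * y ^ 2) - y = (c - w * y) ^ 2 / (2 * c * w) := by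
    field_simp
    ring
  have h2 : 0 ≤ (c - w * y) ^ 2 / (2 * c * w) := by positivity
  linarith

theorem WD.integrable_fourier {p q : L2} (h : WD p q) : Integrable (𝓕 p : L2) := by
  have h1 := h.amgm (r := 1) (c := 1) one_pos
  refine Integrable.mono' (g := fun η => _) ?_ (Lp.aestronglyMeasurable _) h1
  have hπ : 0 < 2 * Real.pi * 1 := by positivity
  exact ((integrable_inv_one_add_sq_mul hπ).const_mul _).add
    (((integrable_norm_sq _).add ((integrable_norm_sq _).const_mul _)).const_mul _)

theorem WD.integral_norm_fourier_sq_le' {p q : L2} (h : WD p q) {r : ℝ} (hr : 0 < r) :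
    (∫ η, ‖(𝓕 p : L2) η‖) ^ 2 ≤ (‖p‖ ^ 2 + r ^ 2 * ‖q‖ ^ 2) / (2 * r) := by
  set A := ∫ η, ‖(𝓕 p : L2) η‖
  have hA : 0 ≤ A := integral_nonneg fun _ => norm_nonneg _
  have key : ∀ c, 0 < c → A ≤ c / (4 * r) + 1 / (2 * c) * (‖p‖ ^ 2 + r ^ 2 * ‖q‖ ^ 2) := by
    intro c hc
    have hπ : 0 < 2 * Real.pi * r := by positivity
    have i1 := (integrable_inv_one_add_sq_mul hπ).const_mul (c / 2)
    have i2 : Integrable fun η => ‖(𝓕 p : L2) η‖ ^ 2 + r ^ 2 * ‖(𝓕 q : L2) η‖ ^ 2 :=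
      (integrable_norm_sq (𝓕 p : L2)).add ((integrable_norm_sq (𝓕 q : L2)).const_mul (r ^ 2))
    have h1 := integral_mono_ae h.integrable_fourier.norm (i1.add (i2.const_mul (1 / (2 * c))))
      (h.amgm (r := r) hc)
    refine h1.trans (le_of_eq ?_)
    simp only [Pi.add_apply]
    rw [integral_add i1 (i2.const_mul (1 / (2 * c))), integral_const_mul, integral_const_mul,
      integral_inv_one_add_sq_mul hπ]
    rw [integral_add (integrable_norm_sq (𝓕 p : L2))
      ((integrable_norm_sq (𝓕 q : L2)).const_mul (r ^ 2)), integral_const_mul, norm_fourier_sq,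
      norm_fourier_sq]
    have := Real.pi_ne_zero
    field_simp
    ring
  rcases hA.eq_or_lt with h0 | h0
  · rw [← h0, zero_pow two_ne_zero]; positivity
  -- With `c = 2rA` the first term is `A/2` and is absorbed on the left.
  · have h1 := key (2 * r * A) (by positivity)
    have e : (2 * r * A) / (4 * r) = A / 2 := by field_simp; ring
    rw [e] at h1
    rw [le_div_iff₀ (by positivity)]
    have h2 : A / 2 ≤ 1 / (2 * (2 * r * A)) * (‖p‖ ^ 2 + r ^ 2 * ‖q‖ ^ 2) := by linarith
    rw [one_div, inv_mul_eq_div, le_div_iff₀ (by positivity)] at h2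
    linarith

theorem WD.integral_norm_fourier_sq_le {p q : L2} (h : WD p q) :
    (∫ η, ‖(𝓕 p : L2) η‖) ^ 2 ≤ ‖p‖ * ‖q‖ := by
  have hlim : Tendsto (fun δ : ℝ => (‖p‖ + δ) * (‖q‖ + δ)) (𝓝[>] 0) (𝓝 (‖p‖ * ‖q‖)) := by
    have : Continuous fun δ : ℝ => (‖p‖ + δ) * (‖q‖ + δ) := by fun_prop
    have := this.tendsto 0
    simp only [add_zero] at this
    exact this.mono_left nhdsWithin_le_nhds
  refine ge_of_tendsto hlim ?_
  filter_upwards [self_mem_nhdsWithin] with δ hδ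
  have hδ : 0 < δ := hδ
  have hp := norm_nonneg p
  have hq := norm_nonneg q
  -- The optimal `r` is `‖p‖/‖q‖`; both norms are shifted by `δ` since either may vanish.
  have h1 := h.integral_norm_fourier_sq_le' (r := (‖p‖ + δ) / (‖q‖ + δ)) (by positivity)
  refine h1.trans ?_
  rw [div_le_iff₀ (by positivity)]
  have e : (‖p‖ + δ) * (‖q‖ + δ) * (2 * ((‖p‖ + δ) / (‖q‖ + δ))) = 2 * (‖p‖ + δ) ^ 2 := by
    field_simp
  rw [e]
  have h3 : ((‖p‖ + δ) / (‖q‖ + δ)) ^ 2 * ‖q‖ ^ 2 ≤ (‖p‖ + δ) ^ 2 := by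
    rw [div_pow, div_mul_eq_mul_div, div_le_iff₀ (by positivity)]
    gcongr
    linarith
  have h4 : ‖p‖ ^ 2 ≤ (‖p‖ + δ) ^ 2 := by gcongr; linarith
  linarith

/-- Agmon's inequality, from the `L¹` bound on the Fourier transform. -/
theorem WD.norm_cts_sq_le {p q : L2} (h : WD p q) (x : ℝ) : ‖cts p x‖ ^ 2 ≤ ‖p‖ * ‖q‖ :=
  (pow_le_pow_left₀ (norm_nonneg _) (norm_fourierInv_le _ x) 2).trans
    h.integral_norm_fourier_sq_le

theorem WD.norm_cts_le {p q : L2} (h : WD p q) (x : ℝ) : ‖cts p x‖ ≤ ‖p‖ + ‖q‖ := by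
  have := h.norm_cts_sq_le x
  have hp := norm_nonneg p
  have hq := norm_nonneg q
  refine abs_le_of_sq_le_sq' (by nlinarith) (by positivity) |>.2

theorem WD.cts_ae {p q : L2} (h : WD p q) : p =ᵐ[volume] cts p := by
  have := fourierInv_ae_eq (𝓕 p) h.integrable_fourier
  rwa [FourierTransform.fourierInv_fourier_eq] at this

theorem WD.continuous_cts {p q : L2} (h : WD p q) : Continuous (cts p) :=
  continuous_fourierInv h.integrable_fourier

theorem WD.hasDerivAt_cts {p q r : L2} (h : WD p q) (h' : WD q r) (x : ℝ) :
    HasDerivAt (cts p) (cts q x) x := by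
  have h1 := hasDerivAt_fourierInv h.integrable_fourier
    (h'.integrable_fourier.congr h) x
  refine h1.congr_deriv ?_
  unfold cts
  exact Real.fourierInv_congr_ae h.symm x

theorem WD.bddMeas_cts {p q : L2} (h : WD p q) : BddMeas (cts p) :=
  .of_continuous h.continuous_cts fun x => h.norm_cts_le x

theorem WD.cts_eq_of_ae {p q : L2} (h : WD p q) {f : ℝ → ℂ} (hf : Continuous f)
    (hp : p =ᵐ[volume] f) : cts p = f :=
  (h.continuous_cts.ae_eq_iff_eq volume hf).mp (h.cts_ae.symm.trans hp)

/-! ### Scaling -/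

theorem eLpNorm_comp_mul {f : ℝ → ℂ} {c : ℝ} (hc : c ≠ 0) (p : ℝ≥0∞) :
    eLpNorm (fun x => f (c * x)) p volume
      = ENNReal.ofReal |c⁻¹| ^ (1 / p).toReal * eLpNorm f p volume := by
  have hm : MeasurableEmbedding fun x : ℝ => c * x :=
    (Homeomorph.mulLeft₀ c hc).measurableEmbedding
  have h1 := hm.eLpNorm_map_measure (g := f) (p := p) (μ := volume)
  rw [Real.map_volume_mul_left hc, eLpNorm_smul_measure_of_ne_zero (by simpa using hc)] at h1
  rw [smul_eq_mul] at h1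
  exact h1.symm

theorem ae_comp_mul {P : ℝ → Prop} (h : ∀ᵐ x, P x) {c : ℝ} (hc : c ≠ 0) :
    ∀ᵐ x : ℝ, P (c * x) := by
  have hm : MeasurableEmbedding fun x : ℝ => c * x :=
    (Homeomorph.mulLeft₀ c hc).measurableEmbedding
  have : ∀ᵐ x ∂(Measure.map (fun x : ℝ => c * x) volume), P x := by
    rw [Real.map_volume_mul_left hc]
    exact Measure.ae_smul_measure h _
  exact hm.ae_map_iff.mp this

theorem memLp_comp_mul {f : ℝ → ℂ} {c : ℝ} (hc : c ≠ 0) {p : ℝ≥0∞} (hf : MemLp f p volume) :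
    MemLp (fun x => f (c * x)) p volume := by
  have hm : MeasurableEmbedding fun x : ℝ => c * x :=
    (Homeomorph.mulLeft₀ c hc).measurableEmbedding
  refine (hm.memLp_map_measure_iff (g := f)).mp ?_
  rw [Real.map_volume_mul_left hc]
  exact hf.smul_measure (by simp)

/-- Passage between the two normalizations of the Fourier transform. The total factor `(2π)^(-1/2)
(2π)^(1/p)` is `1` for `p = 2` and `(2π)^(-1/2)` for `p = ∞`. -/
theorem eLpNorm_hat (w : ℝ → ℂ) (g : L2) (p : ℝ≥0∞) :
    eLpNorm (fun ξ => w ξ * hat g ξ) p volume =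
      ENNReal.ofReal (Real.sqrt (2 * Real.pi))⁻¹ * (ENNReal.ofReal (2 * Real.pi) ^ (1 / p).toReal *
        eLpNorm (fun η => w (2 * Real.pi * η) * (𝓕 g : L2) η) p volume) := by
  have h2π : (2 * Real.pi) ≠ 0 := by positivity
  have e : (fun ξ => w ξ * hat g ξ) = ((Real.sqrt (2 * Real.pi))⁻¹ : ℝ) •
      fun ξ => (fun η => w (2 * Real.pi * η) * (𝓕 g : L2) η) ((2 * Real.pi)⁻¹ * ξ) := by
    funext ξ
    simp only [Pi.smul_apply, hat, Complex.real_smul]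
    rw [mul_inv_cancel_left₀ h2π, div_eq_inv_mul]
    ring
  rw [e, eLpNorm_const_smul,
    eLpNorm_comp_mul (f := fun η => w (2 * Real.pi * η) * (𝓕 g : L2) η) (inv_ne_zero h2π), inv_inv,
    abs_of_pos (by positivity)]
  congr 1
  rw [Real.enorm_eq_ofReal (by positivity)]

theorem h2Norm_eq (p : L2) :
    h2Norm p = eLpNorm (fun η => ((1 + ‖freq η‖ ^ 2 : ℝ) : ℂ) * (𝓕 p : L2) η) 2 volume := by
  unfold h2Norm
  rw [eLpNorm_hat (fun ξ => ((1 + ξ ^ 2 : ℝ) : ℂ)), ← mul_assoc]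
  have : ENNReal.ofReal (Real.sqrt (2 * Real.pi))⁻¹ *
      ENNReal.ofReal (2 * Real.pi) ^ (1 / (2 : ℝ≥0∞)).toReal = 1 := by
    rw [ENNReal.ofReal_rpow_of_pos (by positivity), ← ENNReal.ofReal_mul (by positivity)]
    simp only [one_div, ENNReal.toReal_inv, ENNReal.toReal_ofNat]
    rw [show (2⁻¹ : ℝ) = 1 / 2 by norm_num, ← Real.sqrt_eq_rpow, inv_mul_cancel₀ (by positivity), ENNReal.ofReal_one]
  rw [this, one_mul]
  congr 1
  funext η
  simp only [norm_freq, mul_pow, sq_abs]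

theorem norm_eq_of_ae {p : L2} {f : ℝ → ℂ} (h : p =ᵐ[volume] f) :
    ENNReal.ofReal ‖p‖ = eLpNorm f 2 volume := by
  rw [Lp.norm_def, ENNReal.ofReal_toReal (Lp.eLpNorm_ne_top p), eLpNorm_congr_ae h]

theorem fourier_fourierInv (p : L2) : (𝓕 (𝓕⁻ p : L2) : L2) = p :=
  FourierTransform.fourier_fourierInv_eq p

theorem norm_fourierInv_L2 (p : L2) : ‖(𝓕⁻ p : L2)‖ = ‖p‖ := by
  rw [← Lp.norm_fourier_eq (𝓕⁻ p : L2), fourier_fourierInv]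

/-- The function `(1 + |freq|²) p̂` lies in `L²`, and the multipliers `freq^k / (1 + |freq|²)`, `k ≤
2`, are bounded by `1`. -/
theorem exists_derivs {p : L2} (h : h2Norm p < ∞) :
    ∃ p1 p2, WD p p1 ∧ WD p1 p2 ∧ ‖p‖ ≤ (h2Norm p).toReal ∧ ‖p1‖ ≤ (h2Norm p).toReal ∧
      ‖p2‖ ≤ (h2Norm p).toReal := by
  have hw : Continuous fun η => ((1 + ‖freq η‖ ^ 2 : ℝ) : ℂ) := by
    have := continuous_freq
    fun_prop
  have hpos : ∀ η, (0 : ℝ) < 1 + ‖freq η‖ ^ 2 := fun η => by positivity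
  have hne : ∀ η, ((1 + ‖freq η‖ ^ 2 : ℝ) : ℂ) ≠ 0 := fun η =>
    Complex.ofReal_ne_zero.mpr (hpos η).ne'
  rw [h2Norm_eq] at h
  have hA : MemLp (fun η => ((1 + ‖freq η‖ ^ 2 : ℝ) : ℂ) * (𝓕 p : L2) η) 2 volume :=
    ⟨hw.aestronglyMeasurable.mul (Lp.aestronglyMeasurable _), h⟩
  have hAn : ‖hA.toLp _‖ = (h2Norm p).toReal := by rw [Lp.norm_toLp, h2Norm_eq]
  have hb : ∀ k : ℕ, k ≤ 2 → ∀ η, ‖freq η ^ k / ((1 + ‖freq η‖ ^ 2 : ℝ) : ℂ)‖ ≤ 1 := by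
    intro k hk η
    rw [norm_div, norm_pow, Complex.norm_real, Real.norm_of_nonneg (hpos η).le,
      div_le_one (hpos η)]
    have := norm_nonneg (freq η)
    interval_cases k <;> nlinarith
  have hm : ∀ k : ℕ, Measurable fun η => freq η ^ k / ((1 + ‖freq η‖ ^ 2 : ℝ) : ℂ) := fun k =>
    ((continuous_freq.pow k).div hw hne).measurable
  have hf : ∀ k : ℕ, k ≤ 2 → mulL2 (fun η => freq η ^ k / ((1 + ‖freq η‖ ^ 2 : ℝ) : ℂ))
      (hA.toLp _) =ᵐ[volume] fun η => freq η ^ k * (𝓕 p : L2) η := by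
    intro k hk
    filter_upwards [mulL2_coe ⟨hm k, 1, hb k hk⟩ (hA.toLp _), hA.coeFn_toLp] with η h1 h2
    rw [h1, h2]
    have := hne η
    field_simp
  have hn : ∀ k : ℕ, k ≤ 2 → ‖mulL2 (fun η => freq η ^ k / ((1 + ‖freq η‖ ^ 2 : ℝ) : ℂ))
      (hA.toLp _)‖ ≤ (h2Norm p).toReal := by
    intro k hk
    have := norm_mulL2_le (hm k) (hb k hk) (hA.toLp _)
    rwa [one_mul, hAn] at this
  have h0 : (𝓕 p : L2) = mulL2 (fun η => freq η ^ 0 / ((1 + ‖freq η‖ ^ 2 : ℝ) : ℂ))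
      (hA.toLp _) := by
    refine Lp.ext ?_
    filter_upwards [hf 0 (by norm_num)] with η h1
    rw [h1, pow_zero, one_mul]
  refine ⟨𝓕⁻ (mulL2 (fun η => freq η ^ 1 / ((1 + ‖freq η‖ ^ 2 : ℝ) : ℂ)) (hA.toLp _)),
    𝓕⁻ (mulL2 (fun η => freq η ^ 2 / ((1 + ‖freq η‖ ^ 2 : ℝ) : ℂ)) (hA.toLp _)), ?_, ?_, ?_, ?_, ?_⟩
  · unfold WD
    rw [fourier_fourierInv]
    filter_upwards [hf 1 (by norm_num)] with η h1
    rw [h1, pow_one]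
  · unfold WD
    rw [fourier_fourierInv, fourier_fourierInv]
    filter_upwards [hf 1 (by norm_num), hf 2 (by norm_num)] with η h1 h2
    rw [h1, h2]
    ring
  · rw [← Lp.norm_fourier_eq, h0]
    exact hn 0 (by norm_num)
  · rw [norm_fourierInv_L2]
    exact hn 1 (by norm_num)
  · rw [norm_fourierInv_L2]
    exact hn 2 (by norm_num)

theorem h2Norm_of_WD {p p1 p2 : L2} (h1 : WD p p1) (h2 : WD p1 p2) :
    h2Norm p = ENNReal.ofReal ‖p - p2‖ := by
  rw [h2Norm_eq, ← Lp.norm_fourier_eq, eq_comm]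
  refine norm_eq_of_ae ?_
  have e : (𝓕 (p - p2 : L2) : L2) = 𝓕 p - 𝓕 p2 := by
    rw [sub_eq_add_neg, FourierTransform.fourier_add, sub_eq_add_neg, ← neg_one_smul ℂ,
      FourierTransform.fourier_smul, neg_one_smul]
  rw [e]
  filter_upwards [h1, h2, Lp.coeFn_sub (𝓕 p : L2) (𝓕 p2)] with η e1 e2 e3
  rw [e3, Pi.sub_apply, e2, e1]
  have : ((‖freq η‖ ^ 2 : ℝ) : ℂ) = -(freq η * freq η) := by
    push_cast
    rw [← Complex.conj_mul', conj_freq]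
    ring
  rw [Complex.ofReal_add, this]
  push_cast
  ring

/-! ### From weak to strong differentiability -/

/-- The mean value inequality for `s ↦ ⟨g s, χ⟩ - s⟨N t, χ⟩` has a constant `ε‖χ‖` on an interval
that does not depend on `χ`, since `N` is continuous in norm. Duality then turns the tested
estimates into one in `L²`. -/
theorem hasDerivWithinAt_of_weak {g N : ℝ → L2} {a b : ℝ} (hN : ContinuousOn N (Set.Icc a b))
    (h : ∀ χ : 𝓢(ℝ, ℂ), ∀ t ∈ Set.Icc a b,
      HasDerivWithinAt (fun s => ∫ x, g s x * χ x) (∫ x, N t x * χ x) (Set.Icc a b) t) :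
    ∀ t ∈ Set.Icc a b, HasDerivWithinAt g (N t) (Set.Icc a b) t := by
  intro t ht
  rw [hasDerivWithinAt_iff_isLittleO, Asymptotics.isLittleO_iff]
  intro ε hε
  obtain ⟨δ, hδ, hδN⟩ := Metric.continuousWithinAt_iff.mp (hN t ht) ε hε
  have hmem : Metric.ball t δ ∩ Set.Icc a b ∈ 𝓝[Set.Icc a b] t :=
    inter_mem (nhdsWithin_le_nhds (Metric.ball_mem_nhds t hδ)) self_mem_nhdsWithin
  filter_upwards [hmem] with s hs
  refine norm_le_of_schwartz (by positivity) fun χ => ?_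
  set J := Metric.ball t δ ∩ Set.Icc a b
  have hJ : Convex ℝ J := (convex_ball t δ).inter (convex_Icc a b)
  set c := ∫ x, N t x * χ x
  have hd : ∀ r ∈ J, HasDerivWithinAt (fun s => (∫ x, g s x * χ x) - (s : ℂ) * c)
      ((∫ x, N r x * χ x) - c) J r := by
    intro r hr
    have h1 := (h χ r hr.2).mono (Set.inter_subset_right : J ⊆ _)
    have h2 : HasDerivWithinAt (fun s : ℝ => (s : ℂ) * c) c J r := by
      have := (Complex.ofRealCLM.hasDerivAt (x := r)).mul_const c
      simpa using! this.hasDerivWithinAt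
    exact h1.sub h2
  have hsub : ∀ p q : L2, (∫ x, (p - q : L2) x * χ x) = (∫ x, p x * χ x) - ∫ x, q x * χ x := by
    intro p q
    rw [← integral_sub (integrable_mul_schwartz p χ) (integrable_mul_schwartz q χ)]
    refine integral_congr_ae ?_
    filter_upwards [Lp.coeFn_sub p q] with x hx
    rw [hx, Pi.sub_apply, sub_mul]
  have hbd : ∀ r ∈ J, ‖(∫ x, N r x * χ x) - c‖ ≤ ε * ‖(χ.toLp 2 : L2)‖ := by
    intro r hr
    rw [← hsub, ← integral_mul_toLp]
    refine (norm_integral_mul_le _ _).trans ?_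
    gcongr
    have := hδN hr.2 hr.1
    rw [dist_eq_norm] at this
    exact this.le
  have htJ : t ∈ J := ⟨Metric.mem_ball_self hδ, ht⟩
  have key := Convex.norm_image_sub_le_of_norm_hasDerivWithin_le hd hbd hJ htJ hs
  have e : (∫ x, (g s - g t - (s - t) • N t : L2) x * χ x)
      = ((∫ x, g s x * χ x) - (s : ℂ) * c) - ((∫ x, g t x * χ x) - (t : ℂ) * c) := by
    rw [hsub, hsub]
    have : ∫ x, ((s - t) • N t : L2) x * χ x = ((s - t : ℝ) : ℂ) * c := by
      rw [← integral_const_mul]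
      refine integral_congr_ae ?_
      filter_upwards [Lp.coeFn_smul (s - t) (N t)] with x hx
      rw [hx, Pi.smul_apply, Complex.real_smul, mul_assoc]
    rw [this]
    push_cast
    ring
  rw [e]
  refine key.trans (le_of_eq ?_)
  ring

/-! ### The symbol of the linear flow -/

theorem temperate_cexp_I : Function.HasTemperateGrowth fun y : ℝ => Complex.exp (Complex.I * y) := by
  have hd : ∀ n : ℕ, iteratedDeriv n (fun y : ℝ => Complex.exp (Complex.I * y)) =
      fun y : ℝ => Complex.I ^ n * Complex.exp (Complex.I * y) := by
    intro n
    induction n with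
    | zero => simp
    | succ n ih =>
      rw [iteratedDeriv_succ, ih]
      funext y
      have h1 : HasDerivAt (fun y : ℝ => Complex.I * (y : ℂ)) Complex.I y := by
        simpa using (Complex.ofRealCLM.hasDerivAt (x := y)).const_mul Complex.I
      have h2 := (h1.cexp.const_mul (Complex.I ^ n)).deriv
      rw [h2]
      ring
  refine ⟨?_, fun n => ⟨0, 1, fun y => ?_⟩⟩
  · exact Complex.contDiff_exp.comp (contDiff_const.mul Complex.ofRealCLM.contDiff)
  · rw [norm_iteratedFDeriv_eq_norm_iteratedDeriv, hd]
    rw [norm_mul, norm_pow, Complex.norm_I, mul_comm Complex.I, Complex.norm_exp_ofReal_mul_I]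
    simp

/-- Allows the propagator to be moved onto Schwartz test functions. -/
theorem temperate_symbol (t : ℝ) : Function.HasTemperateGrowth (symbol t) := by
  have h1 : Function.HasTemperateGrowth fun η : ℝ => -(t * (2 * Real.pi * η) ^ 5) := by
    fun_prop
  have h2 := temperate_cexp_I.comp h1
  refine (congrArg Function.HasTemperateGrowth ?_).mp h2
  funext η
  simp [symbol]

theorem bddMeas_symbol (t : ℝ) : BddMeas (symbol t) :=
  .of_continuous (continuous_symbol t) fun η => (norm_symbol t η).le

theorem conj_symbol_mul (t η : ℝ) : conj (symbol t η) * symbol t η = 1 := by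
  rw [Complex.conj_mul', norm_symbol]
  simp

theorem freq_pow_five (η : ℝ) : freq η ^ 5 = Complex.I * (((2 * Real.pi * η) ^ 5 : ℝ) : ℂ) := by
  unfold freq
  push_cast
  have : Complex.I ^ 5 = Complex.I := by
    rw [show (5 : ℕ) = 4 + 1 from rfl, pow_succ, Complex.I_pow_four, one_mul]
  calc (2 * (Real.pi : ℂ) * Complex.I * η) ^ 5 = Complex.I ^ 5 * (2 * Real.pi * η) ^ 5 := by ring
    _ = _ := by rw [this]

theorem symbol_add (s t η : ℝ) : symbol (s + t) η = symbol s η * symbol t η := by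
  unfold symbol
  rw [← Complex.exp_add]
  congr 1
  push_cast
  ring

theorem hasDerivAt_symbol (t η : ℝ) :
    HasDerivAt (fun s => symbol s η) (-(freq η ^ 5) * symbol t η) t := by
  have h1 : HasDerivAt (fun s : ℝ => -(Complex.I * ((s * (2 * Real.pi * η) ^ 5 : ℝ) : ℂ)))
      (-(freq η ^ 5)) t := by
    rw [freq_pow_five]
    have h0 : HasDerivAt (fun s : ℝ => ((s * (2 * Real.pi * η) ^ 5 : ℝ) : ℂ))
      (((2 * Real.pi * η) ^ 5 : ℝ) : ℂ) t := by
      have := (hasDerivAt_id t).mul_const ((2 * Real.pi * η) ^ 5)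
      simpa using! this.ofReal_comp
    exact (h0.const_mul Complex.I).neg
  have := h1.cexp
  unfold symbol
  refine this.congr_deriv ?_
  ring

theorem norm_symbol_sub_le (s t η : ℝ) :
    ‖symbol s η - symbol t η‖ ≤ ‖freq η ^ 5‖ * |s - t| := by
  have h := Convex.norm_image_sub_le_of_norm_hasDerivWithin_le (f := fun s => symbol s η)
    (f' := fun s => -(freq η ^ 5) * symbol s η) (s := Set.univ) (x := t) (y := s)
    (C := ‖freq η ^ 5‖) (fun x _ => (hasDerivAt_symbol x η).hasDerivWithinAt)
    (fun x _ => by simp [norm_symbol]) convex_univ trivial trivial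
  simpa using h

theorem norm_symbol_taylor_le (s t η : ℝ) :
    ‖symbol s η - symbol t η + (s - t) * (freq η ^ 5 * symbol t η)‖
      ≤ ‖freq η ^ 5‖ ^ 2 * |s - t| ^ 2 := by
  have hd : ∀ r : ℝ, HasDerivAt (fun s : ℝ => symbol s η + (s - t : ℂ) * (freq η ^ 5 * symbol t η))
      (-(freq η ^ 5) * (symbol r η - symbol t η)) r := by
    intro r
    have h2 : HasDerivAt (fun s : ℝ => (s - t : ℂ) * (freq η ^ 5 * symbol t η))
        (1 * (freq η ^ 5 * symbol t η)) r :=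
      (((Complex.ofRealCLM.hasDerivAt (x := r)).sub_const (t : ℂ))).mul_const _
    refine ((hasDerivAt_symbol r η).add h2).congr_deriv ?_
    ring
  have h := Convex.norm_image_sub_le_of_norm_hasDerivWithin_le
    (s := Set.uIcc t s) (x := t) (y := s)
    (C := ‖freq η ^ 5‖ ^ 2 * |s - t|) (fun x _ => (hd x).hasDerivWithinAt)
    (fun x hx => by
      rw [norm_mul, norm_neg, pow_two, mul_assoc]
      refine mul_le_mul_of_nonneg_left ?_ (norm_nonneg _)
      refine (norm_symbol_sub_le x t η).trans ?_
      refine mul_le_mul_of_nonneg_left ?_ (norm_nonneg _)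
      exact Set.abs_sub_left_of_mem_uIcc hx) (convex_uIcc t s) Set.left_mem_uIcc Set.right_mem_uIcc
  have e : symbol s η - symbol t η + (s - t) * (freq η ^ 5 * symbol t η)
      = symbol s η + (s - t) * (freq η ^ 5 * symbol t η)
        - (symbol t η + ((t : ℂ) - t) * (freq η ^ 5 * symbol t η)) := by ring
  rw [e]
  refine h.trans (le_of_eq ?_)
  rw [Real.norm_eq_abs]
  ring

/-- Multiplication of a Schwartz function by the symbol. -/
def symbolMul (t : ℝ) : 𝓢(ℝ, ℂ) →L[ℂ] 𝓢(ℝ, ℂ) := SchwartzMap.smulLeftCLM ℂ (symbol t)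

theorem symbolMul_apply (t : ℝ) (χ : 𝓢(ℝ, ℂ)) (η : ℝ) : symbolMul t χ η = symbol t η * χ η := by
  simp [symbolMul, SchwartzMap.smulLeftCLM_apply_apply (temperate_symbol t)]

theorem freqMul_iterate_apply (χ : 𝓢(ℝ, ℂ)) (n : ℕ) (η : ℝ) :
    (freqMul^[n] χ) η = freq η ^ n * χ η := by
  induction n with
  | zero => simp
  | succ n ih => rw [Function.iterate_succ', Function.comp_apply, freqMul_apply, ih]; ring

/-- Product rule: testing against the moving symbol. -/
theorem hasDerivWithinAt_integral_symbol {v : ℝ → L2} {I : Set ℝ} {t : ℝ} {c : ℂ}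
    (hv : ContinuousWithinAt v I t) (χ : 𝓢(ℝ, ℂ))
    (hd : HasDerivWithinAt (fun s => ∫ η, v s η * symbolMul t χ η) c I t) :
    HasDerivWithinAt (fun s => ∫ η, v s η * symbolMul s χ η)
      (c - ∫ η, v t η * (freq η ^ 5 * symbolMul t χ η)) I t := by
  set M := ‖((freqMul^[5] χ).toLp 2 : L2)‖
  set K := ∫ η, ‖v t η‖ * ‖(freqMul^[10] χ) η‖
  have hKi : Integrable fun η => ‖v t η‖ * ‖(freqMul^[10] χ) η‖ := by
    have := (integrable_mul_schwartz (v t) (freqMul^[10] χ)).norm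
    simpa only [norm_mul] using this
  rw [hasDerivWithinAt_iff_isLittleO] at hd ⊢
  -- `v` is only continuous, so the change of the test function is split in two. Against `v s - v t`
  -- a first-order bound on the symbols suffices, as the other factor is `o(1)`; against the fixed
  -- `v t` the second-order Taylor bound is used.
  have hrest : (fun s => (∫ η, v s η * symbolMul s χ η) - (∫ η, v s η * symbolMul t χ η)
      + ((s - t : ℝ) : ℂ) * ∫ η, v t η * (freq η ^ 5 * symbolMul t χ η)) =o[𝓝[I] t]
        fun s => s - t := by
    rw [Asymptotics.isLittleO_iff]
    intro ε hε
    have h1 : ∀ᶠ s in 𝓝[I] t, ‖v s - v t‖ * M < ε / 2 := by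
      have : Tendsto (fun s => ‖v s - v t‖ * M) (𝓝[I] t) (𝓝 0) := by
        simpa using (tendsto_iff_norm_sub_tendsto_zero.mp hv).mul_const M
      exact this.eventually_lt_const (by positivity)
    have h2 : ∀ᶠ s in 𝓝[I] t, K * |s - t| < ε / 2 := by
      have : Tendsto (fun s => K * |s - t|) (𝓝 t) (𝓝 0) := by
        have hc : Continuous fun s => K * |s - t| := by fun_prop
        simpa using hc.tendsto t
      exact (this.mono_left nhdsWithin_le_nhds).eventually_lt_const (by positivity)
    filter_upwards [h1, h2] with s hs1 hs2
    have i1 := integrable_mul_schwartz (v s) (symbolMul s χ)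
    have i2 := integrable_mul_schwartz (v s) (symbolMul t χ)
    have i3 := integrable_mul_schwartz (v t) (symbolMul s χ)
    have i4 := integrable_mul_schwartz (v t) (symbolMul t χ)
    have i5 : Integrable fun η => v t η * (freq η ^ 5 * symbolMul t χ η) := by
      have := integrable_mul_schwartz (v t) (freqMul^[5] (symbolMul t χ))
      simpa only [freqMul_iterate_apply] using this
    have i12 : Integrable fun η => v s η * symbolMul s χ η - v s η * symbolMul t χ η := i1.sub i2
    have i34 : Integrable fun η => v t η * symbolMul s χ η - v t η * symbolMul t χ η := i3.sub i4
    have a1 : ‖∫ η, (v s - v t : L2) η * (symbolMul s χ η - symbolMul t χ η)‖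
        ≤ ‖v s - v t‖ * (|s - t| * M) := by
      have e : ∀ η, symbolMul s χ η - symbolMul t χ η = (symbolMul s χ - symbolMul t χ) η :=
        fun η => by simp
      simp_rw [e]
      rw [← integral_mul_toLp]
      refine (norm_integral_mul_le _ _).trans ?_
      gcongr
      refine norm_L2_le_of_ae ?_
      filter_upwards [(symbolMul s χ - symbolMul t χ).coeFn_toLp 2,
        (freqMul^[5] χ).coeFn_toLp 2] with η e1 e2
      rw [e1, e2, freqMul_iterate_apply]
      simp only [sub_apply, symbolMul_apply]
      rw [← sub_mul, norm_mul, norm_mul, ← mul_assoc]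
      gcongr
      rw [mul_comm]
      exact norm_symbol_sub_le s t η
    have a2 : ‖∫ η, v t η * (symbolMul s χ η - symbolMul t χ η
        + (s - t) * (freq η ^ 5 * symbolMul t χ η))‖ ≤ K * |s - t| ^ 2 := by
      rw [mul_comm, ← integral_const_mul]
      refine norm_integral_le_of_norm_le (hKi.const_mul _) (.of_forall fun η => ?_)
      simp only [symbolMul_apply, freqMul_iterate_apply]
      rw [norm_mul]
      have e : symbol s η * χ η - symbol t η * χ η + (s - t) * (freq η ^ 5 * (symbol t η * χ η))
        = (symbol s η - symbol t η + (s - t) * (freq η ^ 5 * symbol t η)) * χ η := by ring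
      rw [e, norm_mul, norm_mul]
      have := norm_symbol_taylor_le s t η
      calc ‖v t η‖ * (‖symbol s η - symbol t η + (s - t) * (freq η ^ 5 * symbol t η)‖ * ‖χ η‖)
          ≤ ‖v t η‖ * ((‖freq η ^ 5‖ ^ 2 * |s - t| ^ 2) * ‖χ η‖) := by gcongr
        _ = |s - t| ^ 2 * (‖v t η‖ * (‖freq η ^ 10‖ * ‖χ η‖)) := by
          rw [norm_pow, norm_pow]; ring
    have e : (∫ η, v s η * symbolMul s χ η) - (∫ η, v s η * symbolMul t χ η)
        + ((s - t : ℝ) : ℂ) * ∫ η, v t η * (freq η ^ 5 * symbolMul t χ η)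
        = (∫ η, (v s - v t : L2) η * (symbolMul s χ η - symbolMul t χ η))
          + ∫ η, v t η * (symbolMul s χ η - symbolMul t χ η
            + (s - t) * (freq η ^ 5 * symbolMul t χ η)) := by
      have e1 : ∫ η, (v s - v t : L2) η * (symbolMul s χ η - symbolMul t χ η)
          = (∫ η, v s η * symbolMul s χ η) - (∫ η, v s η * symbolMul t χ η)
            - ((∫ η, v t η * symbolMul s χ η) - ∫ η, v t η * symbolMul t χ η) := by
        rw [← integral_sub i1 i2, ← integral_sub i3 i4, ← integral_sub i12 i34]
        refine integral_congr_ae ?_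
        filter_upwards [Lp.coeFn_sub (v s) (v t)] with η hη
        rw [hη, Pi.sub_apply]
        ring
      have e2 : ∫ η, v t η * (symbolMul s χ η - symbolMul t χ η
            + (s - t) * (freq η ^ 5 * symbolMul t χ η))
          = ((∫ η, v t η * symbolMul s χ η) - ∫ η, v t η * symbolMul t χ η)
            + ((s - t : ℝ) : ℂ) * ∫ η, v t η * (freq η ^ 5 * symbolMul t χ η) := by
        rw [← integral_const_mul, ← integral_sub i3 i4, ← integral_add i34 (i5.const_mul _)]
        refine integral_congr_ae (.of_forall fun η => ?_)
        push_cast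
        ring
      rw [e1, e2]
      ring
    rw [e, Real.norm_eq_abs]
    refine (norm_add_le _ _).trans ((add_le_add a1 a2).trans ?_)
    have h0 : 0 ≤ |s - t| := abs_nonneg _
    nlinarith
  refine (hd.add hrest).congr_left fun s => ?_
  simp only [Complex.real_smul]
  ring

/-! ### Continuity of products and of the propagator -/

section

theorem WD.cts_sub {p q r s : L2} (h : WD p q) (h' : WD r s) (x : ℝ) :
    cts (p - r) x = cts p x - cts r x := by
  refine congrFun ((h.sub h').cts_eq_of_ae (h.continuous_cts.sub h'.continuous_cts) ?_) x
  filter_upwards [Lp.coeFn_sub p r, h.cts_ae, h'.cts_ae] with x h1 h2 h3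
  rw [h1, Pi.sub_apply, h2, h3, Pi.sub_apply]

theorem WD.norm_mulL2_cts_le {p q : L2} (h : WD p q) (w : L2) :
    ‖mulL2 (cts p) w‖ ≤ (‖p‖ + ‖q‖) * ‖w‖ :=
  norm_mulL2_le h.continuous_cts.measurable h.norm_cts_le w

theorem WD.mulL2_cts_sub {p q r s : L2} (h : WD p q) (h' : WD r s) (w : L2) :
    mulL2 (cts (p - r)) w = mulL2 (cts p) w - mulL2 (cts r) w := by
  refine Lp.ext ?_
  filter_upwards [mulL2_coe (h.sub h').bddMeas_cts w, mulL2_coe h.bddMeas_cts w,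
    mulL2_coe h'.bddMeas_cts w, Lp.coeFn_sub (mulL2 (cts p) w) (mulL2 (cts r) w)] with x h1 h2 h3 h4
  rw [h4, Pi.sub_apply, h1, h2, h3, h.cts_sub h', sub_mul]

/-- The factor must converge uniformly, which is why convergence of its derivative in `L²` is
assumed as well. -/
theorem tendsto_mulL2_cts {ι : Type*} {l : Filter ι} {p p1 w : ι → L2} {q q1 v : L2}
    (hwd : ∀ᶠ s in l, WD (p s) (p1 s)) (hwd' : WD q q1) (hp : Tendsto p l (𝓝 q))
    (hp1 : Tendsto p1 l (𝓝 q1)) (hw : Tendsto w l (𝓝 v)) :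
    Tendsto (fun s => mulL2 (cts (p s)) (w s)) l (𝓝 (mulL2 (cts q) v)) := by
  rw [tendsto_iff_norm_sub_tendsto_zero]
  have hb : Tendsto (fun s => (‖p s - q‖ + ‖p1 s - q1‖) * ‖w s‖
      + (‖q‖ + ‖q1‖) * ‖w s - v‖) l (𝓝 0) := by
    have h1 := tendsto_iff_norm_sub_tendsto_zero.mp hp
    have h2 := tendsto_iff_norm_sub_tendsto_zero.mp hp1
    have h3 := tendsto_iff_norm_sub_tendsto_zero.mp hw
    have := ((h1.add h2).mul hw.norm).add (h3.const_mul (‖q‖ + ‖q1‖))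
    simpa using this
  refine squeeze_zero' (.of_forall fun s => norm_nonneg _) ?_ hb
  filter_upwards [hwd] with s hs
  have e : mulL2 (cts (p s)) (w s) - mulL2 (cts q) v
      = mulL2 (cts (p s - q)) (w s) + mulL2 (cts q) (w s - v) := by
    rw [hs.mulL2_cts_sub hwd', map_sub]
    abel
  rw [e]
  exact (norm_add_le _ _).trans (add_le_add
    ((hs.sub hwd').norm_mulL2_cts_le _) (hwd'.norm_mulL2_cts_le _))

theorem continuousOn_mulL2_cts {p p1 w : ℝ → L2} {I : Set ℝ} (hwd : ∀ t ∈ I, WD (p t) (p1 t))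
    (hp : ContinuousOn p I) (hp1 : ContinuousOn p1 I) (hw : ContinuousOn w I) :
    ContinuousOn (fun t => mulL2 (cts (p t)) (w t)) I := fun t ht =>
  tendsto_mulL2_cts (eventually_nhdsWithin_of_forall hwd) (hwd t ht) (hp t ht) (hp1 t ht) (hw t ht)

/-- The propagators are not continuous in operator norm, high frequencies rotating arbitrarily fast.
Strong continuity at the fixed vector `G t` and unitarity applied to `G s - G t` are combined
instead. -/
theorem continuousOn_mulL2_symbol {G : ℝ → L2} {I : Set ℝ} (hG : ContinuousOn G I) :
    ContinuousOn (fun t => mulL2 (symbol t) (G t)) I := by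
  intro t ht
  unfold ContinuousWithinAt
  have h1 : Tendsto (fun s => mulL2 (symbol s) (G t)) (𝓝[I] t) (𝓝 (mulL2 (symbol t) (G t))) :=
    tendsto_mulL2 (C := 1) (fun s => (continuous_symbol s).measurable)
      (fun s x => (norm_symbol s x).le) (bddMeas_symbol t)
      (.of_forall fun η => (hasDerivAt_symbol t η).continuousAt.tendsto.mono_left
        nhdsWithin_le_nhds) _
  have h2 : Tendsto (fun s => mulL2 (symbol s) (G s - G t)) (𝓝[I] t) (𝓝 0) := by
    rw [tendsto_zero_iff_norm_tendsto_zero]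
    refine squeeze_zero (fun s => norm_nonneg _) (fun s => ?_)
      (tendsto_iff_norm_sub_tendsto_zero.mp (hG t ht))
    have := norm_mulL2_le (continuous_symbol s).measurable (fun x => (norm_symbol s x).le)
      (G s - G t)
    rwa [one_mul] at this
  have := h2.add h1
  rw [zero_add] at this
  refine this.congr fun s => ?_
  rw [map_sub]
  abel

/-! ### The nonlinearity -/

/-- `u⁴ w`, where `u` is given by its continuous representative. -/
def quart (p w : L2) : L2 :=
  mulL2 (cts p) (mulL2 (cts p) (mulL2 (cts p) (mulL2 (cts p) w)))

theorem WD.quart_coe {p q : L2} (h : WD p q) (w : L2) :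
    quart p w =ᵐ[volume] fun x => cts p x ^ 4 * w x := by
  have hb := h.bddMeas_cts
  unfold quart
  filter_upwards [mulL2_coe hb w, mulL2_coe hb (mulL2 (cts p) w),
    mulL2_coe hb (mulL2 (cts p) (mulL2 (cts p) w)),
    mulL2_coe hb (mulL2 (cts p) (mulL2 (cts p) (mulL2 (cts p) w)))] with x h1 h2 h3 h4
  rw [h4, h3, h2, h1]
  ring

theorem WD.quart_self_coe {p q : L2} (h : WD p q) :
    quart p p =ᵐ[volume] fun x => cts p x ^ 5 := by
  filter_upwards [h.quart_coe p, h.cts_ae] with x h1 h2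
  rw [h1, h2]
  ring

theorem WD.quart_deriv_coe {p q r : L2} (h : WD p q) (h' : WD q r) :
    quart p q =ᵐ[volume] fun x => cts p x ^ 4 * cts q x := by
  filter_upwards [h.quart_coe q, h'.cts_ae] with x h1 h2
  rw [h1, h2]

/-- `∂ₓ(u⁵) = 5 u⁴ uₓ`. -/
theorem WD.quart {p q r : L2} (h : WD p q) (h' : WD q r) :
    WD (quart p p) ((5 : ℂ) • quart p q) := by
  refine WD.of_hasDerivAt (f := fun x => cts p x ^ 5)
    (f' := fun x => 5 * (cts p x ^ 4 * cts q x)) h.quart_self_coe ?_ fun x => ?_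
  · filter_upwards [h.quart_deriv_coe h', Lp.coeFn_smul (5 : ℂ) (FifthKdV.quart p q)] with x h1 h2
    rw [h2, Pi.smul_apply, h1, smul_eq_mul]
  · refine ((h.hasDerivAt_cts h' x).pow 5).congr_deriv ?_
    push_cast
    ring

theorem continuousOn_quart {p p1 w : ℝ → L2} {I : Set ℝ} (hwd : ∀ t ∈ I, WD (p t) (p1 t))
    (hp : ContinuousOn p I) (hp1 : ContinuousOn p1 I) (hw : ContinuousOn w I) :
    ContinuousOn (fun t => quart (p t) (w t)) I :=
  continuousOn_mulL2_cts hwd hp hp1 (continuousOn_mulL2_cts hwd hp hp1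
    (continuousOn_mulL2_cts hwd hp hp1 (continuousOn_mulL2_cts hwd hp hp1 hw)))

/-! ### Evolutions on a compact time interval -/

/-- A real solution in `C([0, τ]; H²)`, with derivatives `u1`, `u2`; the equation is tested in
frequency. -/
structure Evol (τ : ℝ) (u u1 u2 : ℝ → L2) : Prop where
  wd1 : ∀ t ∈ Set.Icc 0 τ, WD (u t) (u1 t)
  wd2 : ∀ t ∈ Set.Icc 0 τ, WD (u1 t) (u2 t)
  cont : ContinuousOn u (Set.Icc 0 τ)
  cont1 : ContinuousOn u1 (Set.Icc 0 τ)
  cont2 : ContinuousOn u2 (Set.Icc 0 τ)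
  real : ∀ t ∈ Set.Icc 0 τ, star (u t) = u t
  eqn : ∀ χ : 𝓢(ℝ, ℂ), ∀ t ∈ Set.Icc 0 τ,
    HasDerivWithinAt (fun s => ∫ η, (𝓕 (u s) : L2) η * χ η)
      ((∫ η, (𝓕 (u t) : L2) η * (freq η ^ 5 * χ η))
        - (1 / 5) * ∫ η, (𝓕 (quart (u t) (u t)) : L2) η * (freq η * χ η)) (Set.Icc 0 τ) t

/-- The Fourier transform of the profile. -/
def gprof (u : ℝ → L2) (t : ℝ) : L2 := mulL2 (symbol t) (𝓕 (u t))

theorem fourier_profile (u : ℝ → L2) (t : ℝ) : 𝓕 (profile u t) = gprof u t := by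
  unfold profile backwardFlow gprof
  rw [fourier_fourierInv]
  refine L2_eq_of_ae (MemLp.coeFn_toLp _) (mulL2_coe (bddMeas_symbol t) _)

theorem continuousOn_fourier {p : ℝ → L2} {I : Set ℝ} (hp : ContinuousOn p I) :
    ContinuousOn (fun t => (𝓕 (p t) : L2)) I :=
  (Lp.fourierTransformₗᵢ ℝ ℂ).continuous.comp_continuousOn hp

variable {τ : ℝ} {u u1 u2 : ℝ → L2}

/-- The term `freq⁵` of the equation cancels the time derivative of the symbol, leaving only the
nonlinear flux. -/
theorem Evol.gprof_weak (h : Evol τ u u1 u2) (χ : 𝓢(ℝ, ℂ)) {t : ℝ} (ht : t ∈ Set.Icc 0 τ) :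
    HasDerivWithinAt (fun s => ∫ η, gprof u s η * χ η)
      (-(1 / 5) * ∫ η, (mulL2 (symbol t) (𝓕 (quart (u t) (u t)))) η * (freq η * χ η))
      (Set.Icc 0 τ) t := by
  have h1 := hasDerivWithinAt_integral_symbol (continuousOn_fourier h.cont t ht) χ
    (h.eqn (symbolMul t χ) t ht)
  have e : ∀ s, ∫ η, gprof u s η * χ η = ∫ η, (𝓕 (u s) : L2) η * symbolMul s χ η := by
    intro s
    refine integral_congr_ae ?_
    filter_upwards [mulL2_coe (bddMeas_symbol s) (𝓕 (u s))] with η hη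
    rw [gprof, hη, symbolMul_apply]
    ring
  simp_rw [e]
  refine h1.congr_deriv ?_
  have e2 : ∫ η, (mulL2 (symbol t) (𝓕 (quart (u t) (u t)))) η * (freq η * χ η)
      = ∫ η, (𝓕 (quart (u t) (u t)) : L2) η * (freq η * symbolMul t χ η) := by
    refine integral_congr_ae ?_
    filter_upwards [mulL2_coe (bddMeas_symbol t) (𝓕 (quart (u t) (u t)))] with η hη
    rw [hη, symbolMul_apply]
    ring
  rw [e2]
  ring

theorem Evol.continuousOn_quart (h : Evol τ u u1 u2) {w : ℝ → L2}
    (hw : ContinuousOn w (Set.Icc 0 τ)) :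
    ContinuousOn (fun t => quart (u t) (w t)) (Set.Icc 0 τ) :=
  FifthKdV.continuousOn_quart h.wd1 h.cont h.cont1 hw

/-- Since `u⁴u_x` is in `L²` and continuous in time, the weak derivative of the profile is a strong
one. This is the only form in which the equation is differentiated from here on. -/
theorem Evol.hasDerivWithinAt_gprof (h : Evol τ u u1 u2) {t : ℝ} (ht : t ∈ Set.Icc 0 τ) :
    HasDerivWithinAt (gprof u) (-mulL2 (symbol t) (𝓕 (quart (u t) (u1 t)))) (Set.Icc 0 τ) t := by
  refine hasDerivWithinAt_of_weak (N := fun t => -mulL2 (symbol t) (𝓕 (quart (u t) (u1 t))))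
    (continuousOn_mulL2_symbol (continuousOn_fourier (h.continuousOn_quart h.cont1))).neg
    (fun χ t ht => ?_) t ht
  refine (h.gprof_weak χ ht).congr_deriv ?_
  rw [← integral_const_mul]
  refine integral_congr_ae ?_
  have hw := (h.wd1 t ht).quart (h.wd2 t ht)
  unfold WD at hw
  rw [FourierTransform.fourier_smul] at hw
  filter_upwards [hw, mulL2_coe (bddMeas_symbol t) (𝓕 (quart (u t) (u t))),
    mulL2_coe (bddMeas_symbol t) (𝓕 (quart (u t) (u1 t))),
    Lp.coeFn_neg (mulL2 (symbol t) (𝓕 (quart (u t) (u1 t)))),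
    Lp.coeFn_smul (5 : ℂ) (𝓕 (quart (u t) (u1 t)) : L2)] with η h1 h2 h3 h4 h5
  rw [h5, Pi.smul_apply, smul_eq_mul] at h1
  rw [h4, Pi.neg_apply, h2, h3]
  linear_combination (-1 / 5 * symbol t η * χ η) * h1.symm

/-! ### Consequences of the regularity assumptions -/

theorem star_eq_of_im_zero {p : L2} (h : ∀ᵐ x, (p x).im = 0) : star p = p := by
  refine Lp.ext ?_
  filter_upwards [Lp.coeFn_star p, h] with x h1 h2
  rw [h1, Pi.star_apply]
  exact Complex.conj_eq_iff_im.mpr h2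

theorem WD.star_eq {p q : L2} (h : WD p q) (hp : Star.star p = p) : Star.star q = q := by
  have := h.star
  rw [hp] at this
  exact this.unique h

theorem conj_cts {p q : L2} (h : WD p q) (hp : star p = p) (x : ℝ) :
    conj (cts p x) = cts p x := by
  refine congrFun (h.cts_eq_of_ae (f := fun x => conj (cts p x))
    (Complex.continuous_conj.comp h.continuous_cts) ?_) x |>.symm
  have h1 := Lp.coeFn_star p
  rw [hp] at h1
  filter_upwards [h1, h.cts_ae] with x h2 h3
  rw [← h3, h2]
  simp only [← h2]
  exact h2

open Classical in
/-- The weak derivative, when it exists. -/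
def wderiv (p : L2) : L2 := if h : ∃ q, WD p q then h.choose else 0

theorem WD.wderiv_eq {p q : L2} (h : WD p q) : wderiv p = q := by
  have hex : ∃ q, WD p q := ⟨q, h⟩
  rw [wderiv, dif_pos hex]
  exact hex.choose_spec.unique h

theorem iteratedDeriv_fourier_schwartz (χ : 𝓢(ℝ, ℂ)) (n : ℕ) :
    iteratedDeriv n (𝓕 χ : 𝓢(ℝ, ℂ)) = ⇑((-1 : ℂ) ^ n • (𝓕 (freqMul^[n] χ) : 𝓢(ℝ, ℂ))) := by
  induction n with
  | zero => simp
  | succ n ih =>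
    rw [iteratedDeriv_succ, ih]
    funext x
    have e : ⇑((-1 : ℂ) ^ n • (𝓕 (freqMul^[n] χ) : 𝓢(ℝ, ℂ)))
        = fun x => (-1 : ℂ) ^ n * (𝓕 (freqMul^[n] χ) : 𝓢(ℝ, ℂ)) x := by
      funext x
      simp
    have h1 := ((𝓕 (freqMul^[n] χ) : 𝓢(ℝ, ℂ)).hasDerivAt x).const_mul ((-1 : ℂ) ^ n)
    rw [e, h1.deriv, deriv_fourier_schwartz, Function.iterate_succ_apply']
    simp [pow_succ]

/-- By uniqueness of weak derivatives, the derivatives of `u s - u t` are the differences of the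
chosen derivatives, so continuity in `H²` gives continuity of each of them in `L²`. The equation is
tested on `𝓕 χ` to move it to frequency. -/
theorem evol_of_isSolution {T : EReal} {u₀ : L2} {u : ℝ → L2} (h : IsSolution T u₀ u) {τ : ℝ}
    (hτ : τ ∈ lifespan T) :
    Evol τ u (fun t => wderiv (u t)) (fun t => wderiv (wderiv (u t))) := by
  have hsub : Set.Icc 0 τ ⊆ lifespan T := fun t ht =>
    ⟨ht.1, lt_of_le_of_lt (EReal.coe_le_coe_iff.mpr ht.2) hτ.2⟩
  have hwd1 : ∀ t ∈ Set.Icc 0 τ, WD (u t) (wderiv (u t)) := by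
    intro t ht
    obtain ⟨p1, p2, h1, h2, -⟩ := exists_derivs (h.mem_h2 t (hsub ht))
    rwa [h1.wderiv_eq]
  have hwd2 : ∀ t ∈ Set.Icc 0 τ, WD (wderiv (u t)) (wderiv (wderiv (u t))) := by
    intro t ht
    obtain ⟨p1, p2, h1, h2, -⟩ := exists_derivs (h.mem_h2 t (hsub ht))
    rwa [h1.wderiv_eq, h2.wderiv_eq]
  have hdiff : ∀ t ∈ Set.Icc 0 τ, ∀ᶠ s in 𝓝[Set.Icc 0 τ] t,
      ‖u s - u t‖ ≤ (h2Norm (u s - u t)).toReal ∧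
      ‖wderiv (u s) - wderiv (u t)‖ ≤ (h2Norm (u s - u t)).toReal ∧
      ‖wderiv (wderiv (u s)) - wderiv (wderiv (u t))‖ ≤ (h2Norm (u s - u t)).toReal := by
    intro t ht
    have h1 : ∀ᶠ s in 𝓝[Set.Icc 0 τ] t, h2Norm (u s - u t) < ∞ :=
      ((h.continuous_h2 t (hsub ht)).mono_left (nhdsWithin_mono _ hsub)).eventually_lt_const
        (by simp)
    filter_upwards [h1, self_mem_nhdsWithin] with s hs hsI
    obtain ⟨p1, p2, h1, h2, h3, h4, h5⟩ := exists_derivs hs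
    have e1 := h1.unique ((hwd1 s hsI).sub (hwd1 t ht))
    subst e1
    have e2 := h2.unique ((hwd2 s hsI).sub (hwd2 t ht))
    subst e2
    exact ⟨h3, h4, h5⟩
  have hlim : ∀ t ∈ Set.Icc 0 τ,
      Tendsto (fun s => (h2Norm (u s - u t)).toReal) (𝓝[Set.Icc 0 τ] t) (𝓝 0) := by
    intro t ht
    have := (ENNReal.tendsto_toReal ENNReal.zero_ne_top).comp
      ((h.continuous_h2 t (hsub ht)).mono_left (nhdsWithin_mono _ hsub))
    simpa using! this
  refine ⟨hwd1, hwd2, fun t ht => ?_, fun t ht => ?_, fun t ht => ?_, fun t ht =>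
    star_eq_of_im_zero (h.real t (hsub ht)), fun χ t ht => ?_⟩
  · unfold ContinuousWithinAt
    rw [tendsto_iff_norm_sub_tendsto_zero]
    exact squeeze_zero' (.of_forall fun s => norm_nonneg _)
      ((hdiff t ht).mono fun s hs => hs.1) (hlim t ht)
  · unfold ContinuousWithinAt
    rw [tendsto_iff_norm_sub_tendsto_zero]
    exact squeeze_zero' (.of_forall fun s => norm_nonneg _)
      ((hdiff t ht).mono fun s hs => hs.2.1) (hlim t ht)
  · unfold ContinuousWithinAt
    rw [tendsto_iff_norm_sub_tendsto_zero]
    exact squeeze_zero' (.of_forall fun s => norm_nonneg _)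
      ((hdiff t ht).mono fun s hs => hs.2.2) (hlim t ht)
  · have h1 := (h.equation (𝓕 χ) t (hsub ht)).mono hsub
    simp_rw [integral_fourier_mul]
    refine h1.congr_deriv ?_
    have e1 : ∫ x, u t x * iteratedDeriv 5 (𝓕 χ : 𝓢(ℝ, ℂ)) x
        = -∫ η, (𝓕 (u t) : L2) η * (freq η ^ 5 * χ η) := by
      have h2 := integral_fourier_mul (u t) (freqMul^[5] χ)
      simp_rw [freqMul_iterate_apply] at h2
      rw [h2, iteratedDeriv_fourier_schwartz, ← integral_neg]
      refine integral_congr_ae (.of_forall fun x => ?_)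
      have : ((-1 : ℂ) ^ 5) = -1 := by norm_num
      simp [this]
    have e2 : ∫ x, u t x ^ 5 * deriv (𝓕 χ : 𝓢(ℝ, ℂ)) x
        = -∫ η, (𝓕 (quart (u t) (u t)) : L2) η * (freq η * χ η) := by
      have h2 := integral_mul_deriv_fourier (quart (u t) (u t)) χ
      have h3 : ∫ x, u t x ^ 5 * deriv (𝓕 χ : 𝓢(ℝ, ℂ)) x
          = ∫ x, (quart (u t) (u t)) x * deriv (𝓕 χ : 𝓢(ℝ, ℂ)) x := by
        refine integral_congr_ae ?_
        filter_upwards [(hwd1 t ht).quart_self_coe, (hwd1 t ht).cts_ae] with x e3 e4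
        rw [e3, e4]
      rw [h3, h2]
      congr 1
      refine integral_congr_ae (.of_forall fun x => ?_)
      ring
    rw [e1, e2]
    ring

end

/-! ### Fourier multipliers and frequency truncation -/

section

/-- The Fourier multiplier with symbol `m`. -/
def fm (m : ℝ → ℂ) (p : L2) : L2 := 𝓕⁻ (mulL2 m (𝓕 p))

theorem fourier_fm (m : ℝ → ℂ) (p : L2) : (𝓕 (fm m p) : L2) = mulL2 m (𝓕 p) :=
  fourier_fourierInv _

theorem fourierInv_fourier (p : L2) : (𝓕⁻ (𝓕 p : L2) : L2) = p :=
  FourierTransform.fourierInv_fourier_eq p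

theorem norm_fm_le {m : ℝ → ℂ} (hm : Measurable m) {C : ℝ} (h : ∀ x, ‖m x‖ ≤ C) (p : L2) :
    ‖fm m p‖ ≤ C * ‖p‖ := by
  rw [fm, norm_fourierInv_L2]
  have := norm_mulL2_le hm h (𝓕 p)
  rwa [Lp.norm_fourier_eq] at this

theorem mulL2_one (p : L2) : mulL2 (fun _ => 1) p = p := by
  refine Lp.ext ?_
  filter_upwards [mulL2_coe (BddMeas.const 1) p] with x hx
  rw [hx, one_mul]

theorem mulL2_zero (p : L2) : mulL2 (fun _ => 0) p = 0 := by
  refine Lp.ext ?_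
  filter_upwards [mulL2_coe (BddMeas.const 0) p, Lp.coeFn_zero ℂ 2 (volume : Measure ℝ)] with x hx h0
  rw [hx, h0, zero_mul, Pi.zero_apply]

theorem tendsto_fourierInv {ι : Type*} {l : Filter ι} {p : ι → L2} {q : L2}
    (h : Tendsto p l (𝓝 q)) : Tendsto (fun n => (𝓕⁻ (p n) : L2)) l (𝓝 (𝓕⁻ q)) :=
  ((Lp.fourierTransformₗᵢ ℝ ℂ).symm.continuous.tendsto q).comp h

theorem tendsto_fm {ι : Type*} {l : Filter ι} [l.IsCountablyGenerated] {m : ι → ℝ → ℂ}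
    {m' : ℝ → ℂ} {C : ℝ} (hm : ∀ n, Measurable (m n)) (hb : ∀ n x, ‖m n x‖ ≤ C) (hm' : BddMeas m')
    (hlim : ∀ᵐ x, Tendsto (fun n => m n x) l (𝓝 (m' x))) (p : L2) :
    Tendsto (fun n => fm (m n) p) l (𝓝 (fm m' p)) :=
  tendsto_fourierInv (tendsto_mulL2 hm hb hm' hlim _)

theorem fm_one (p : L2) : fm (fun _ => 1) p = p := by
  rw [fm, mulL2_one, fourierInv_fourier]

theorem fm_zero (p : L2) : fm (fun _ => 0) p = 0 := by
  rw [fm, mulL2_zero]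
  exact map_zero (Lp.fourierTransformₗᵢ ℝ ℂ).symm

theorem fm_fm {m n : ℝ → ℂ} (hm : BddMeas m) (hn : BddMeas n) (p : L2) :
    fm m (fm n p) = fm (fun x => m x * n x) p := by
  unfold fm
  rw [fourier_fourierInv, mulL2_mulL2 hm hn]

theorem fm_WD {m n : ℝ → ℂ} (hm : BddMeas m) (hn : BddMeas n) (h : ∀ η, n η = freq η * m η)
    (p : L2) : WD (fm m p) (fm n p) := by
  unfold WD
  rw [fourier_fm, fourier_fm]
  filter_upwards [mulL2_coe hm (𝓕 p), mulL2_coe hn (𝓕 p)] with η h1 h2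
  rw [h1, h2, h]
  ring

theorem WD.fm_eq {p q : L2} (hpq : WD p q) {m n : ℝ → ℂ} (hm : BddMeas m) (hn : BddMeas n)
    (h : ∀ η, n η = freq η * m η) : fm n p = fm m q := by
  unfold fm
  congr 1
  refine Lp.ext ?_
  filter_upwards [mulL2_coe hm (𝓕 q), mulL2_coe hn (𝓕 p), hpq] with η h1 h2 h3
  rw [h1, h2, h3, h]
  ring

theorem inner_fm_left {m : ℝ → ℂ} (hm : BddMeas m) (p q : L2) :
    (inner ℂ (fm m p) q : ℂ) = inner ℂ p (fm (fun x => conj (m x)) q) := by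
  rw [← inner_fourier (FifthKdV.fm m p), ← inner_fourier p, fourier_fm, fourier_fm, inner_mulL2_left hm]

/-- The sharp frequency cutoff. -/
def cutoff (n : ℕ) (η : ℝ) : ℂ := if |η| ≤ n then 1 else 0

theorem norm_cutoff_le (n : ℕ) (η : ℝ) : ‖cutoff n η‖ ≤ 1 := by
  unfold cutoff
  split_ifs <;> simp

theorem measurable_cutoff (n : ℕ) : Measurable (cutoff n) :=
  Measurable.ite (measurableSet_le (by fun_prop) measurable_const) measurable_const
    measurable_const

theorem tendsto_cutoff (η : ℝ) : Tendsto (fun n => cutoff n η) atTop (𝓝 1) := by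
  refine tendsto_const_nhds.congr' ?_
  obtain ⟨N, hN⟩ := exists_nat_ge |η|
  filter_upwards [eventually_ge_atTop N] with n hn
  have : |η| ≤ n := hN.trans (by exact_mod_cast hn)
  simp [cutoff, this]

theorem norm_freq_pow_cutoff_le (k n : ℕ) (η : ℝ) :
    ‖freq η ^ k * cutoff n η‖ ≤ (2 * Real.pi * n) ^ k := by
  unfold cutoff
  split_ifs with h
  · rw [mul_one, norm_pow, norm_freq]
    gcongr
  · rw [mul_zero, norm_zero]
    positivity

theorem bddMeas_cutoff (n : ℕ) : BddMeas (cutoff n) := ⟨measurable_cutoff n, 1, norm_cutoff_le n⟩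

theorem bddMeas_freq_pow_cutoff (k n : ℕ) : BddMeas fun η => freq η ^ k * cutoff n η :=
  ⟨(continuous_freq.pow k).measurable.mul (measurable_cutoff n), _, norm_freq_pow_cutoff_le k n⟩

/-- The `k`-th derivative of the frequency truncation. -/
def trunc (n k : ℕ) (p : L2) : L2 := fm (fun η => freq η ^ k * cutoff n η) p

theorem trunc_zero_eq (n : ℕ) (p : L2) : trunc n 0 p = fm (cutoff n) p := by
  simp [trunc]

theorem WD_trunc (n k : ℕ) (p : L2) : WD (trunc n k p) (trunc n (k + 1) p) :=
  fm_WD (bddMeas_freq_pow_cutoff k n) (bddMeas_freq_pow_cutoff (k + 1) n) (fun η => by ring) p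

theorem WD.trunc_eq {p q : L2} (h : WD p q) (n k : ℕ) : trunc n (k + 1) p = trunc n k q :=
  h.fm_eq (bddMeas_freq_pow_cutoff k n) (bddMeas_freq_pow_cutoff (k + 1) n) (fun η => by ring)

theorem norm_trunc_zero_le (n : ℕ) (p : L2) : ‖trunc n 0 p‖ ≤ ‖p‖ := by
  rw [trunc_zero_eq]
  have := norm_fm_le (measurable_cutoff n) (norm_cutoff_le n) p
  rwa [one_mul] at this

theorem tendsto_trunc (p : L2) : Tendsto (fun n => trunc n 0 p) atTop (𝓝 p) := by
  simp_rw [trunc_zero_eq]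
  have := tendsto_fm measurable_cutoff norm_cutoff_le (BddMeas.const 1)
    (.of_forall tendsto_cutoff) p
  rwa [fm_one] at this

theorem hasDerivAt_cts_trunc (n k : ℕ) (p : L2) (x : ℝ) :
    HasDerivAt (cts (trunc n k p)) (cts (trunc n (k + 1) p) x) x :=
  (WD_trunc n k p).hasDerivAt_cts (WD_trunc n (k + 1) p) x

theorem norm_L2_eq_of_ae {p q : L2} (h : p =ᵐ[volume] q) : ‖p‖ = ‖q‖ := by
  rw [Lp.ext h]

theorem tendsto_integral_mul {ι : Type*} {l : Filter ι} {p q : ι → L2} {p' q' : L2}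
    (hp : Tendsto p l (𝓝 p')) (hq : Tendsto q l (𝓝 q')) :
    Tendsto (fun n => ∫ x, p n x * q n x) l (𝓝 (∫ x, p' x * q' x)) := by
  have hs : Tendsto (fun n => star (p n)) l (𝓝 (star p')) := by
    rw [tendsto_iff_norm_sub_tendsto_zero] at hp ⊢
    refine hp.congr fun n => ?_
    rw [← norm_star_L2]
    refine norm_L2_eq_of_ae ?_
    filter_upwards [Lp.coeFn_star (p n - p'), Lp.coeFn_star (p n), Lp.coeFn_star p',
      Lp.coeFn_sub (p n) p', Lp.coeFn_sub (star (p n)) (star p')] with x e1 e2 e3 e4 e5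
    rw [e1, Pi.star_apply, e4, e5, Pi.sub_apply, Pi.sub_apply, e2, e3, Pi.star_apply,
      Pi.star_apply, star_sub]
  simp_rw [← inner_star_left]
  exact hs.inner hq

theorem WD.of_tendsto {p q : ℕ → L2} {p' q' : L2} (h : ∀ n, WD (p n) (q n))
    (hp : Tendsto p atTop (𝓝 p')) (hq : Tendsto q atTop (𝓝 q')) : WD p' q' := by
  refine WD.of_integral_deriv fun φ => ?_
  have hφ : ∀ p : L2, ∫ x, p x * deriv φ x
      = ∫ x, p x * ((memLp_deriv_schwartz φ).toLp (deriv φ) : L2) x := by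
    intro p
    refine integral_congr_ae ?_
    filter_upwards [(memLp_deriv_schwartz φ).coeFn_toLp] with x hx
    rw [hx]
  have h1 := tendsto_integral_mul hp (tendsto_const_nhds (x :=
    ((memLp_deriv_schwartz φ).toLp (deriv φ) : L2)))
  have h2 := (tendsto_integral_mul hq (tendsto_const_nhds (x := (φ.toLp 2 : L2)))).neg
  rw [hφ, ← integral_mul_toLp]
  refine tendsto_nhds_unique h1 (h2.congr fun n => ?_)
  rw [← hφ, (h n).integral_deriv, integral_mul_toLp]

/-- The product rule in `H¹`. -/
theorem WD.mul_cts {p q r s : L2} (h : WD p q) (h' : WD r s) :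
    WD (mulL2 (cts p) r) (mulL2 (cts r) q + mulL2 (cts p) s) := by
  -- Truncations of `p` have bounded representatives with bounded derivatives, so the rule for a
  -- `C¹` factor applies to them; both sides then converge in `L²`.
  have hp := tendsto_trunc p
  have hq := tendsto_trunc q
  have hwd : ∀ n, WD (trunc n 0 p) (trunc n 0 q) := fun n => by
    rw [← h.trunc_eq]; exact WD_trunc n 0 p
  refine WD.of_tendsto (p := fun n => mulL2 (cts (trunc n 0 p)) r)
    (q := fun n => mulL2 (cts r) (trunc n 0 q) + mulL2 (cts (trunc n 0 p)) s) (fun n => ?_)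
    (tendsto_mulL2_cts (.of_forall hwd) h hp hq tendsto_const_nhds)
    (((((mulL2 (cts r)).continuous.tendsto q).comp hq)).add
      (tendsto_mulL2_cts (.of_forall hwd) h hp hq tendsto_const_nhds))
  have h1 := h'.mul (WD_trunc n 0 p).bddMeas_cts (WD_trunc n 1 p).bddMeas_cts
    (hasDerivAt_cts_trunc n 0 p)
  have e : mulL2 (cts (trunc n 1 p)) r = mulL2 (cts r) (trunc n 0 q) := by
    rw [← h.trunc_eq]
    refine Lp.ext ?_
    filter_upwards [mulL2_coe (WD_trunc n 1 p).bddMeas_cts r, mulL2_coe h'.bddMeas_cts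
      (trunc n (0 + 1) p), h'.cts_ae, (WD_trunc n 1 p).cts_ae] with x e1 e2 e3 e4
    rw [e1, e2, e3, zero_add, e4, mul_comm]
  rwa [e] at h1

/-! ### Conservation of mass -/

theorem hasDerivWithinAt_norm_sq {g : ℝ → L2} {N : L2} {I : Set ℝ} {t : ℝ}
    (h : HasDerivWithinAt g N I t) :
    HasDerivWithinAt (fun s => ‖g s‖ ^ 2) (2 * (inner ℂ (g t) N : ℂ).re) I t := by
  have h1 := HasDerivWithinAt.inner ℂ h h
  have h2 := Complex.reCLM.hasFDerivAt.comp_hasDerivWithinAt t h1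
  have e : (fun s => ‖g s‖ ^ 2) = Complex.reCLM ∘ fun s => (inner ℂ (g s) (g s) : ℂ) := by
    funext s
    simp [inner_self_eq_norm_sq_to_K, ← Complex.ofReal_pow]
  rw [e]
  refine h2.congr_deriv ?_
  have : (inner ℂ N (g t) : ℂ).re = (inner ℂ (g t) N : ℂ).re := by
    rw [← inner_conj_symm, Complex.conj_re]
  simp only [Complex.reCLM_apply, Complex.add_re, this]
  ring

theorem norm_gprof (u : ℝ → L2) (t : ℝ) : ‖gprof u t‖ = ‖u t‖ := by
  rw [← Lp.norm_fourier_eq (u t)]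
  have h1 := norm_mulL2_le (continuous_symbol t).measurable (fun x => (norm_symbol t x).le)
    (𝓕 (u t))
  have h2 := norm_mulL2_le (C := 1) (bddMeas_symbol t).conj.meas
    (fun x => by simp [norm_symbol]) (gprof u t)
  rw [gprof, mulL2_mulL2 (bddMeas_symbol t).conj (bddMeas_symbol t)] at h2
  simp_rw [conj_symbol_mul] at h2
  rw [mulL2_one, one_mul] at h2
  rw [one_mul] at h1
  exact le_antisymm h1 h2

theorem inner_mulL2_symbol (t : ℝ) (p q : L2) :
    (inner ℂ (mulL2 (symbol t) p) (mulL2 (symbol t) q) : ℂ) = inner ℂ p q := by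
  rw [inner_mulL2_left (bddMeas_symbol t), mulL2_mulL2 (bddMeas_symbol t).conj (bddMeas_symbol t)]
  simp_rw [conj_symbol_mul]
  rw [mulL2_one]

theorem inner_eq_integral_of_star {p : L2} (hp : star p = p) (q : L2) :
    (inner ℂ p q : ℂ) = ∫ x, p x * q x := by
  rw [← inner_star_left, hp]

variable {τ : ℝ} {u u1 u2 : ℝ → L2}

/-- `u · u⁴u_x` is the derivative of `u⁶/6`; reality of `p` makes the inner product bilinear. -/
theorem inner_quart_eq_zero {p q r : L2} (h : WD p q) (h' : WD q r) (hp : star p = p) :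
    (inner ℂ p (quart p q) : ℂ) = 0 := by
  have h1 := h.integral_mul (h.quart h')
  rw [inner_eq_integral_of_star hp]
  have e1 : ∫ x, p x * ((5 : ℂ) • quart p q : L2) x = 5 * ∫ x, p x * quart p q x := by
    rw [← integral_const_mul]
    refine integral_congr_ae ?_
    filter_upwards [Lp.coeFn_smul (5 : ℂ) (quart p q)] with x hx
    rw [hx, Pi.smul_apply, smul_eq_mul]
    ring
  have e2 : ∫ x, q x * quart p p x = ∫ x, p x * quart p q x := by
    refine integral_congr_ae ?_
    filter_upwards [h.quart_coe p, h.quart_coe q] with x h1 h2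
    rw [h1, h2]
    ring
  rw [e1, e2] at h1
  linear_combination (1 / 6 : ℂ) * h1

/-- The propagator is unitary, so the norm of the differentiable profile may be used in place of
that of `u`. -/
theorem Evol.mass (h : Evol τ u u1 u2) {t : ℝ} (ht : t ∈ Set.Icc 0 τ) : ‖u t‖ = ‖u 0‖ := by
  have hd : ∀ s ∈ Set.Icc 0 τ, HasDerivWithinAt (fun s => ‖gprof u s‖ ^ 2) 0 (Set.Icc 0 τ) s := by
    intro s hs
    have h1 := hasDerivWithinAt_norm_sq (h.hasDerivWithinAt_gprof hs)
    refine h1.congr_deriv ?_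
    rw [inner_neg_right, gprof, inner_mulL2_symbol, inner_fourier,
      inner_quart_eq_zero (h.wd1 s hs) (h.wd2 s hs) (h.real s hs)]
    simp
  have h0 : (0 : ℝ) ∈ Set.Icc 0 τ := ⟨le_rfl, ht.1.trans ht.2⟩
  have := Convex.norm_image_sub_le_of_norm_hasDerivWithin_le hd (C := 0) (fun x _ => by simp)
    (convex_Icc 0 τ) h0 ht
  rw [zero_mul, norm_le_zero_iff, sub_eq_zero, norm_gprof, norm_gprof] at this
  exact (pow_left_inj₀ (norm_nonneg _) (norm_nonneg _) two_ne_zero).mp this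

end

/-! ### The resolvent and its commutator with a multiplication operator -/

/-- The symbol of `(1 - e²∂ₓ²)⁻¹`. -/
def resolvent (e η : ℝ) : ℂ := ((1 + e ^ 2 * ‖freq η‖ ^ 2)⁻¹ : ℝ)

theorem resolvent_identity (e η : ℝ) :
    resolvent e η - e ^ 2 * (freq η ^ 2 * resolvent e η) = 1 := by
  have h : (freq η) ^ 2 = -((‖freq η‖ ^ 2 : ℝ) : ℂ) := by
    rw [Complex.ofReal_pow, ← Complex.conj_mul', conj_freq]; ring
  have h2 : ((1 + e ^ 2 * ‖freq η‖ ^ 2 : ℝ) : ℂ) ≠ 0 := by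
    norm_cast; positivity
  rw [h, resolvent, Complex.ofReal_inv]
  field_simp
  push_cast
  ring

theorem conj_resolvent (e η : ℝ) : conj (resolvent e η) = resolvent e η := Complex.conj_ofReal _

theorem norm_resolvent_eq (e η : ℝ) : ‖resolvent e η‖ = (1 + (e * ‖freq η‖) ^ 2)⁻¹ := by
  rw [resolvent, Complex.norm_real, Real.norm_of_nonneg (by positivity), mul_pow]

theorem norm_resolvent_le (e η : ℝ) : ‖resolvent e η‖ ≤ 1 := by
  rw [norm_resolvent_eq]
  exact inv_le_one_of_one_le₀ (by nlinarith [sq_nonneg (e * ‖freq η‖)])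

theorem continuous_resolvent (e : ℝ) : Continuous (resolvent e) := by
  unfold resolvent
  refine Complex.continuous_ofReal.comp (Continuous.inv₀ ?_ fun η => by positivity)
  exact continuous_const.add (continuous_const.mul (continuous_freq.norm.pow 2))

theorem norm_mul_resolvent_le {e : ℝ} (he : 0 ≤ e) (η : ℝ) :
    ‖e * (freq η * resolvent e η)‖ ≤ 1 := by
  rw [norm_mul, norm_mul, norm_resolvent_eq, Complex.norm_real, Real.norm_of_nonneg he,
    ← mul_assoc, ← div_eq_mul_inv, div_le_one (by positivity)]
  nlinarith [sq_nonneg (e * ‖freq η‖ - 1 / 2)]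

theorem norm_sq_mul_resolvent_le (e η : ℝ) :
    ‖e ^ 2 * (freq η ^ 2 * resolvent e η)‖ ≤ 1 := by
  rw [norm_mul, norm_mul, norm_resolvent_eq, norm_pow, norm_pow, Complex.norm_real,
    Real.norm_eq_abs, sq_abs, ← mul_assoc, ← div_eq_mul_inv, div_le_one (by positivity), mul_pow]
  linarith

theorem bddMeas_resolvent (e : ℝ) : BddMeas (resolvent e) :=
  ⟨(continuous_resolvent e).measurable, 1, norm_resolvent_le e⟩

theorem bddMeas_freq_resolvent {e : ℝ} (he : 0 < e) : BddMeas fun η => freq η * resolvent e η := by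
  refine ⟨(continuous_freq.mul (continuous_resolvent e)).measurable, e⁻¹, fun η => ?_⟩
  have := norm_mul_resolvent_le he.le η
  rw [norm_mul, Complex.norm_real, Real.norm_of_nonneg he.le] at this
  rw [← one_div, le_div_iff₀ he]
  linarith

theorem bddMeas_freq_sq_resolvent {e : ℝ} (he : 0 < e) :
    BddMeas fun η => freq η ^ 2 * resolvent e η := by
  refine ⟨((continuous_freq.pow 2).mul (continuous_resolvent e)).measurable, (e ^ 2)⁻¹,
    fun η => ?_⟩
  have := norm_sq_mul_resolvent_le e η
  rw [norm_mul, norm_pow, Complex.norm_real, Real.norm_of_nonneg he.le] at this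
  rw [← one_div, le_div_iff₀ (by positivity)]
  linarith

theorem tendsto_resolvent {l : Filter ℝ} (hl : l ≤ 𝓝 0) (η : ℝ) :
    Tendsto (fun e => resolvent e η) l (𝓝 1) := by
  have : ContinuousAt (fun e => resolvent e η) 0 := by
    unfold resolvent
    refine Complex.continuous_ofReal.continuousAt.comp (ContinuousAt.inv₀ ?_ (by positivity))
    fun_prop
  have h := this.tendsto.mono_left hl
  simpa [resolvent] using h

/-- `(1 - e²∂ₓ²)⁻¹` -/
def resol (e : ℝ) (p : L2) : L2 := fm (resolvent e) p

/-- `∂ₓ (1 - e²∂ₓ²)⁻¹` -/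
def resol1 (e : ℝ) (p : L2) : L2 := fm (fun η => freq η * resolvent e η) p

/-- `∂ₓ² (1 - e²∂ₓ²)⁻¹` -/
def resol2 (e : ℝ) (p : L2) : L2 := fm (fun η => freq η ^ 2 * resolvent e η) p

theorem WD_resol {e : ℝ} (he : 0 < e) (p : L2) : WD (resol e p) (resol1 e p) :=
  fm_WD (bddMeas_resolvent e) (bddMeas_freq_resolvent he) (fun _ => rfl) p

theorem WD_resol1 {e : ℝ} (he : 0 < e) (p : L2) : WD (resol1 e p) (resol2 e p) :=
  fm_WD (bddMeas_freq_resolvent he) (bddMeas_freq_sq_resolvent he) (fun _ => by ring) p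

theorem WD.resol1_eq {p q : L2} (h : WD p q) {e : ℝ} (he : 0 < e) : resol1 e p = resol e q :=
  h.fm_eq (bddMeas_resolvent e) (bddMeas_freq_resolvent he) (fun _ => rfl)

theorem WD.resol2_eq {p q : L2} (h : WD p q) {e : ℝ} (he : 0 < e) : resol2 e p = resol1 e q :=
  h.fm_eq (bddMeas_freq_resolvent he) (bddMeas_freq_sq_resolvent he) (fun _ => by ring)

theorem resol_sub {e : ℝ} (he : 0 < e) (p : L2) :
    resol e p = p + ((e : ℂ) ^ 2) • resol2 e p := by
  have h : mulL2 (resolvent e) (𝓕 p) =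
      𝓕 p + ((e : ℂ) ^ 2) • mulL2 (fun η => freq η ^ 2 * resolvent e η) (𝓕 p) := by
    refine Lp.ext ?_
    filter_upwards [mulL2_coe (bddMeas_resolvent e) (𝓕 p),
      mulL2_coe (bddMeas_freq_sq_resolvent he) (𝓕 p),
      Lp.coeFn_add (𝓕 p) (((e : ℂ) ^ 2) • mulL2 (fun η => freq η ^ 2 * resolvent e η) (𝓕 p)),
      Lp.coeFn_smul ((e : ℂ) ^ 2) (mulL2 (fun η => freq η ^ 2 * resolvent e η) (𝓕 p))]
      with x h1 h2 h3 h4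
    rw [h1, h3, Pi.add_apply, h4, Pi.smul_apply, h2, smul_eq_mul]
    linear_combination (𝓕 p : L2) x * resolvent_identity e x
  rw [resol, fm, h, FourierTransform.fourierInv_add, FourierTransform.fourierInv_smul, fourierInv_fourier]
  rfl

theorem inner_resol1_right {e : ℝ} (he : 0 < e) (p q : L2) :
    (inner ℂ p (resol1 e q) : ℂ) = -inner ℂ (resol1 e p) q := by
  rw [resol1, resol1, inner_fm_left (bddMeas_freq_resolvent he)]
  have : (fun x => conj (freq x * resolvent e x)) = fun x => (-1 : ℂ) * (freq x * resolvent e x) := by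
    funext x
    rw [map_mul, conj_freq, conj_resolvent]; ring
  rw [this, ← fm_fm (.const (-1)) (bddMeas_freq_resolvent he)]
  have h2 : ∀ r : L2, fm (fun _ => (-1 : ℂ)) r = -r := by
    intro r
    rw [fm]
    have : mulL2 (fun _ => (-1 : ℂ)) (𝓕 r : L2) = -𝓕 r := by
      refine Lp.ext ?_
      filter_upwards [mulL2_coe (.const (-1)) (𝓕 r : L2), Lp.coeFn_neg (𝓕 r : L2)] with x h1 h2
      rw [h1, h2, Pi.neg_apply]; ring
    rw [this, ← neg_one_smul ℂ, FourierTransform.fourierInv_smul, fourierInv_fourier, neg_one_smul]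
  rw [h2, inner_neg_right, neg_neg]

/-- The commutator of the regularized derivative with multiplication by a real function. -/
theorem re_inner_resol {e : ℝ} (he : 0 < e) {a a' : ℝ → ℂ} (ha : BddMeas a) (ha' : BddMeas a')
    (hd : ∀ x, HasDerivAt a (a' x) x) (hr : ∀ x, conj (a x) = a x) (w : L2) :
    (inner ℂ (resol e w) (resol1 e (mulL2 a w)) : ℂ).re =
      (inner ℂ (resol e (resol e w)) (mulL2 a' (resol e w)) : ℂ).re
      - 1 / 2 * (inner ℂ (resol e w) (mulL2 a' (resol e w)) : ℂ).re
      - e ^ 2 * (inner ℂ (resol1 e (resol e w)) (mulL2 a' (resol1 e w)) : ℂ).re := by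
  set z := resol e w with hz
  have i1 := inner_resol1_right he z (mulL2 a w)
  -- `w` is replaced by `z - e²z''` with `z` in `H²`. All terms are then legitimate integrations by
  -- parts, and the commutator comes out as an exact identity rather than an estimate.
  have hw : w = z - ((e : ℂ) ^ 2) • resol2 e w := by rw [hz, resol_sub he]; abel
  have hRz : resol e z = z + ((e : ℂ) ^ 2) • resol2 e z := resol_sub he z
  have hA : mulL2 a w = mulL2 a z - ((e : ℂ) ^ 2) • mulL2 a (resol2 e w) := by
    conv_lhs => rw [hw]
    rw [map_sub, map_smul]
  have w1 := (WD_resol he z).inner ((WD_resol he w).mul ha ha' hd)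
  have w2 := (WD_resol1 he z).inner ((WD_resol1 he w).mul ha ha' hd)
  have w3 := (WD_resol he w).inner ((WD_resol he w).mul ha ha' hd)
  have w4 : (inner ℂ (resol1 e w) (mulL2 a z) : ℂ)
      = conj (inner ℂ z (mulL2 a (resol1 e w)) : ℂ) := by
    rw [inner_conj_symm, inner_mulL2_left ha]
    simp_rw [hr]
  have i2 : (inner ℂ (resol e z) (mulL2 a (resol1 e w)) : ℂ)
      = inner ℂ z (mulL2 a (resol1 e w)) + e ^ 2 * inner ℂ (resol2 e z) (mulL2 a (resol1 e w)) := by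
    conv_lhs => rw [hRz]
    rw [inner_add_left, inner_smul_left]
    simp
  rw [← hz] at w1 w3
  rw [w4] at w3
  rw [hA, inner_sub_right, inner_smul_right] at i1
  rw [inner_add_right] at w1 w2 w3
  have key : (inner ℂ z (resol1 e (mulL2 a w)) : ℂ) =
      inner ℂ (resol e z) (mulL2 a' z) + inner ℂ z (mulL2 a (resol1 e w))
       - e ^ 2 * inner ℂ (resol1 e z) (mulL2 a' (resol1 e w)) := by
    rw [hA]
    linear_combination i1 - w1 + i2 + e ^ 2 * w2
  have r3 := congrArg Complex.re w3
  simp only [Complex.add_re, Complex.neg_re, Complex.conj_re] at r3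
  have re2 : ∀ c : ℂ, ((e : ℂ) ^ 2 * c).re = e ^ 2 * c.re := fun c => by
    rw [← Complex.ofReal_pow, Complex.re_ofReal_mul]
  rw [key, Complex.sub_re, Complex.add_re, re2]
  linarith

theorem norm_resol_le (e : ℝ) (p : L2) : ‖resol e p‖ ≤ ‖p‖ := by
  simpa [resol] using norm_fm_le (continuous_resolvent e).measurable (norm_resolvent_le e) p

theorem norm_resol1_le {e : ℝ} (he : 0 < e) (p : L2) : e * ‖resol1 e p‖ ≤ ‖p‖ := by
  have h := norm_fm_le (bddMeas_freq_resolvent he).meas (C := e⁻¹) (fun η => by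
    have := norm_mul_resolvent_le he.le η
    rw [norm_mul, Complex.norm_real, Real.norm_of_nonneg he.le] at this
    rw [← one_div, le_div_iff₀ he]
    linarith) p
  calc e * ‖resol1 e p‖ ≤ e * (e⁻¹ * ‖p‖) := by gcongr; exact h
    _ = ‖p‖ := by field_simp

/-- The three terms of `re_inner_resol` contribute `1`, `1/2` and `1`. In the last one the factor
`e²` is shared between two operators `e∂ₓ(1 - e²∂ₓ²)⁻¹` of norm at most `1`, so the bound is uniform
in `e`. -/
theorem abs_re_inner_resol_le {e : ℝ} (he : 0 < e) {a a' : ℝ → ℂ} (ha : BddMeas a)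
    (ha' : Measurable a') {A : ℝ} (hA : ∀ x, ‖a' x‖ ≤ A)
    (hd : ∀ x, HasDerivAt a (a' x) x) (hr : ∀ x, conj (a x) = a x) (w : L2) :
    |(inner ℂ (resol e w) (resol1 e (mulL2 a w)) : ℂ).re| ≤ 5 / 2 * A * ‖w‖ ^ 2 := by
  have hA0 : 0 ≤ A := (norm_nonneg _).trans (hA 0)
  rw [re_inner_resol he ha ⟨ha', A, hA⟩ hd hr]
  have b : ∀ p q : L2, |(inner ℂ p (mulL2 a' q) : ℂ).re| ≤ A * (‖p‖ * ‖q‖) := fun p q => by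
    refine (Complex.abs_re_le_norm _).trans ((norm_inner_le_norm _ _).trans ?_)
    refine (mul_le_mul_of_nonneg_left (norm_mulL2_le ha' hA q) (norm_nonneg _)).trans (le_of_eq ?_)
    ring
  have n1 := norm_resol_le e w
  have n2 := (norm_resol_le e (resol e w)).trans n1
  have n3 := norm_resol1_le he w
  have n4 := (norm_resol1_le he (resol e w)).trans n1
  have b1 := b (resol e (resol e w)) (resol e w)
  have b2 := b (resol e w) (resol e w)
  have b3 := b (resol1 e (resol e w)) (resol1 e w)
  have c1 : A * (‖resol e (resol e w)‖ * ‖resol e w‖) ≤ A * (‖w‖ * ‖w‖) := by gcongr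
  have c2 : A * (‖resol e w‖ * ‖resol e w‖) ≤ A * (‖w‖ * ‖w‖) := by gcongr
  have c3 : A * ((e * ‖resol1 e (resol e w)‖) * (e * ‖resol1 e w‖)) ≤ A * (‖w‖ * ‖w‖) := by
    gcongr
  have b3' := mul_le_mul_of_nonneg_left b3 (sq_nonneg e)
  rw [abs_le] at b1 b2 ⊢
  rw [← abs_of_nonneg (sq_nonneg e), ← abs_mul, abs_le, abs_of_nonneg (sq_nonneg e)] at b3'
  constructor <;> nlinarith

theorem tendsto_resol {e : ℕ → ℝ} (hlim : Tendsto e atTop (𝓝 0)) (w : L2) :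
    Tendsto (fun n => resol (e n) w) atTop (𝓝 w) := by
  have := tendsto_fm (fun n => (continuous_resolvent (e n)).measurable)
    (fun n => norm_resolvent_le (e n)) (.const 1)
    (.of_forall fun η => (tendsto_resolvent le_rfl η).comp hlim) w
  rwa [fm_one] at this

/-- The operators `e∂ₓ(1 - e²∂ₓ²)⁻¹` tend strongly to zero, so the last term of `re_inner_resol`
disappears and the other two leave `1 - 1/2`. This is the value of `⟨w, ∂ₓ(a w)⟩` by formal
integration by parts, although `w` has no derivative. -/
theorem tendsto_re_inner_resol {e : ℕ → ℝ} (he : ∀ n, 0 < e n) (hlim : Tendsto e atTop (𝓝 0))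
    {a a' : ℝ → ℂ} (ha : BddMeas a) (ha' : BddMeas a')
    (hd : ∀ x, HasDerivAt a (a' x) x) (hr : ∀ x, conj (a x) = a x) (w : L2) :
    Tendsto (fun n => (inner ℂ (resol (e n) w) (resol1 (e n) (mulL2 a w)) : ℂ).re) atTop
      (𝓝 (1 / 2 * (inner ℂ w (mulL2 a' w) : ℂ).re)) := by
  have hres : ∀ η, Tendsto (fun n => resolvent (e n) η) atTop (𝓝 1) := fun η =>
    (tendsto_resolvent le_rfl η).comp hlim
  have t1 := tendsto_resol hlim w
  have t2 : Tendsto (fun n => resol (e n) (resol (e n) w)) atTop (𝓝 w) := by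
    have := tendsto_fm (m := fun n η => resolvent (e n) η * resolvent (e n) η) (m' := fun _ => 1)
      (C := 1)
      (fun n => ((continuous_resolvent (e n)).mul (continuous_resolvent (e n))).measurable)
      (fun n η => by
        rw [norm_mul]
        exact mul_le_one₀ (norm_resolvent_le _ _) (norm_nonneg _) (norm_resolvent_le _ _))
      (.const 1) (.of_forall fun η => by simpa using (hres η).mul (hres η)) w
    rw [fm_one] at this
    refine this.congr fun n => ?_
    rw [resol, resol, fm_fm (bddMeas_resolvent _) (bddMeas_resolvent _)]
  have hz : ∀ η, Tendsto (fun n => (e n : ℂ) * (freq η * resolvent (e n) η)) atTop (𝓝 0) := by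
    intro η
    have h1 : Tendsto (fun n => (e n : ℂ)) atTop (𝓝 ((0 : ℝ) : ℂ)) :=
      (Complex.continuous_ofReal.tendsto 0).comp hlim
    simpa using h1.mul ((hres η).const_mul (freq η))
  have hc : ∀ n, Measurable fun η => (e n : ℂ) * (freq η * resolvent (e n) η) := fun n =>
    (continuous_const.mul (continuous_freq.mul (continuous_resolvent (e n)))).measurable
  have smul_fm : ∀ (c : ℂ) {m : ℝ → ℂ} (_ : BddMeas m) (p : L2), fm (fun η => c * m η) p = c • fm m p := by
    intro c m hm p
    have : mulL2 (fun η => c * m η) (𝓕 p : L2) = c • mulL2 m (𝓕 p) := by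
      refine Lp.ext ?_
      filter_upwards [mulL2_coe ((BddMeas.const c).mul hm) (𝓕 p : L2), mulL2_coe hm (𝓕 p : L2),
        Lp.coeFn_smul c (mulL2 m (𝓕 p : L2))] with x h1 h2 h3
      rw [h1, h3, Pi.smul_apply, h2, smul_eq_mul, mul_assoc]
    rw [fm, this, FourierTransform.fourierInv_smul]
    rfl
  have t3 : Tendsto (fun n => (e n : ℂ) • resol1 (e n) w) atTop (𝓝 0) := by
    have := tendsto_fm hc (fun n => norm_mul_resolvent_le (he n).le) (.const 0) (.of_forall hz) w
    rw [fm_zero] at this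
    refine this.congr fun n => ?_
    rw [smul_fm _ (bddMeas_freq_resolvent (he n))]
    rfl
  have t4 : Tendsto (fun n => (e n : ℂ) • resol1 (e n) (resol (e n) w)) atTop (𝓝 0) := by
    refine squeeze_zero_norm (a := fun n => ‖(e n : ℂ) • resol1 (e n) w‖) (fun n => ?_)
      (by simpa using t3.norm)
    rw [norm_smul, norm_smul]
    refine mul_le_mul_of_nonneg_left ?_ (norm_nonneg _)
    have : resol1 (e n) (resol (e n) w) = resol (e n) (resol1 (e n) w) := by
      rw [resol1, resol, fm_fm (bddMeas_freq_resolvent (he n)) (bddMeas_resolvent _), resol1, resol,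
        fm_fm (bddMeas_resolvent _) (bddMeas_freq_resolvent (he n))]
      congr 1
      funext x
      ring
    rw [this]
    exact norm_resol_le _ _
  have c := (mulL2 a').continuous
  have l1 := Complex.continuous_re.continuousAt.tendsto.comp (t2.inner ((c.tendsto w).comp t1) (𝕜 := ℂ))
  have l2 := Complex.continuous_re.continuousAt.tendsto.comp (t1.inner ((c.tendsto w).comp t1) (𝕜 := ℂ))
  have l3 := Complex.continuous_re.continuousAt.tendsto.comp (t4.inner ((c.tendsto 0).comp t3) (𝕜 := ℂ))
  have l := (l1.sub (l2.const_mul (1 / 2))).sub l3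
  rw [map_zero, inner_zero_left, Complex.zero_re, sub_zero] at l
  have e1 : ∀ x : ℝ, x - 1 / 2 * x = 1 / 2 * x := fun x => by ring
  rw [e1] at l
  refine l.congr fun n => ?_
  rw [re_inner_resol (he n) ha ha' hd hr]
  simp only [Function.comp_apply, map_smul, inner_smul_left, inner_smul_right]
  congr 1
  rw [Complex.conj_ofReal, ← mul_assoc, ← Complex.ofReal_mul, Complex.re_ofReal_mul, sq]

/-! ### The regularized quadratic energy and the nonlinearity -/

section

variable {τ : ℝ} {u u1 u2 : ℝ → L2}

/-- `∂ₓ(4U³U'²)`, the lower-order part of the second derivative of `U⁴U'`. -/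
def quartRem (p q r : L2) : L2 :=
  mulL2 (fun x => 12 * (cts p x ^ 2 * cts q x)) (mulL2 (cts q) q)
    + mulL2 (fun x => 4 * cts p x ^ 3) (mulL2 (cts q) r + mulL2 (cts q) r)

theorem WD.quart_eq_mulL2 {p q : L2} (h : WD p q) (w : L2) :
    FifthKdV.quart p w = mulL2 (fun x => cts p x ^ 4) w :=
  Lp.ext ((h.quart_coe w).trans (mulL2_coe (h.bddMeas_cts.pow 4) w).symm)

theorem WD.hasDerivAt_cts_pow_four {p q r : L2} (h : WD p q) (h' : WD q r) (x : ℝ) :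
    HasDerivAt (fun x => cts p x ^ 4) (4 * cts p x ^ 3 * cts q x) x := by
  exact ((h.hasDerivAt_cts h' x).pow 4).congr_deriv (by push_cast; ring)

theorem WD.bddMeas_deriv_pow_four {p q r : L2} (h : WD p q) (h' : WD q r) :
    BddMeas (fun x => 4 * cts p x ^ 3 * cts q x) :=
  ((BddMeas.const 4).mul (h.bddMeas_cts.pow 3)).mul h'.bddMeas_cts

/-- `U⁴U'` is not assumed to have two derivatives. Its derivative is split into `U⁴U''`, left to the
commutator identity, and `g = 4U³U'²`, which has one more derivative in `L²`. -/
theorem WD.quart_deriv {p q r : L2} (h : WD p q) (h' : WD q r) :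
    ∃ g, WD (FifthKdV.quart p q) (mulL2 (fun x => cts p x ^ 4) r + g) ∧ WD g (quartRem p q r) := by
  have hp := h.bddMeas_cts
  have hq := h'.bddMeas_cts
  have e : mulL2 (fun x => 4 * cts p x ^ 3 * cts q x) q
      = mulL2 (fun x => 4 * cts p x ^ 3) (mulL2 (cts q) q) :=
    (mulL2_mulL2 ((BddMeas.const 4).mul (hp.pow 3)) hq q).symm
  refine ⟨_, ?_, (h'.mul_cts h').mul ((BddMeas.const 4).mul (hp.pow 3))
    ((BddMeas.const 12).mul ((hp.pow 2).mul hq)) fun x => ?_⟩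
  · have := h'.mul (hp.pow 4) (h.bddMeas_deriv_pow_four h') (h.hasDerivAt_cts_pow_four h')
    rw [h.quart_eq_mulL2]
    rwa [e, add_comm] at this
  · refine (((h.hasDerivAt_cts h' x).pow 3).const_mul 4).congr_deriv ?_
    push_cast
    ring

/-- `∂ₓ²(1 - e²∂ₓ²)⁻¹` is bounded on `L²` and commutes with the propagator, so it can be applied to
the derivative of the profile. -/
theorem Evol.hasDerivWithinAt_norm_resol (h : Evol τ u u1 u2) {e : ℝ} (he : 0 < e) {t : ℝ}
    (ht : t ∈ Set.Icc 0 τ) :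
    HasDerivWithinAt (fun s => ‖resol e (u2 s)‖ ^ 2)
      (-2 * (inner ℂ (resol e (u2 t)) (resol2 e (quart (u t) (u1 t))) : ℂ).re)
      (Set.Icc 0 τ) t := by
  have hm := bddMeas_freq_sq_resolvent he
  set K := mulL2 fun η => freq η ^ 2 * resolvent e η with hK
  have comm : ∀ s (p : L2), K (mulL2 (symbol s) p) = mulL2 (symbol s) (K p) := by
    intro s p
    rw [hK, mulL2_mulL2 hm (bddMeas_symbol s), mulL2_mulL2 (bddMeas_symbol s) hm]
    simp_rw [mul_comm]
  have hu : ∀ s ∈ Set.Icc 0 τ, K (𝓕 (u s)) = 𝓕 (resol e (u2 s)) := by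
    intro s hs
    rw [← (h.wd2 s hs).resol1_eq he, ← (h.wd1 s hs).resol2_eq he, resol2, fourier_fm]
  have hN : ∀ s (p : L2), ‖mulL2 (symbol s) p‖ = ‖p‖ := by
    intro s p
    have := inner_mulL2_symbol s p p
    rw [inner_self_eq_norm_sq_to_K, inner_self_eq_norm_sq_to_K] at this
    norm_cast at this
    exact (pow_left_inj₀ (norm_nonneg _) (norm_nonneg _) two_ne_zero).mp this
  have h1 : HasDerivWithinAt (fun s => K (gprof u s))
      (K (-mulL2 (symbol t) (𝓕 (quart (u t) (u1 t))))) (Set.Icc 0 τ) t :=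
    (K.restrictScalars ℝ).hasFDerivAt.comp_hasDerivWithinAt t (h.hasDerivWithinAt_gprof ht)
  refine ((hasDerivWithinAt_norm_sq h1).congr_deriv ?_).congr (fun s hs => ?_) ?_
  · rw [map_neg, comm, gprof, comm, inner_neg_right, inner_mulL2_symbol, hu t ht, resol2,
      ← inner_fourier (resol e (u2 t)), fourier_fm, Complex.neg_re]
    ring
  · rw [gprof, comm, hN, hu s hs, Lp.norm_fourier_eq]
  · rw [gprof, comm, hN, hu t ht, Lp.norm_fourier_eq]

/-! ### The time derivative of the truncated potential energy -/

/-- Second-order Taylor formula for `a⁶`, as a polynomial identity with quotient of coefficient sum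
`15`. -/
theorem norm_integral_six_sub_le {p p1 q q1 : L2} (hp : WD p p1) (hq : WD q q1) {M : ℝ}
    (hpM : ∀ x, ‖cts p x‖ ≤ M) (hqM : ∀ x, ‖cts q x‖ ≤ M) :
    ‖(∫ x, quart p p x * p x) - (∫ x, quart q q x * q x) - 6 * ∫ x, quart q q x * (p - q : L2) x‖
      ≤ 15 * M ^ 4 * ‖p - q‖ ^ 2 := by
  have hM : 0 ≤ M := (norm_nonneg _).trans (hpM 0)
  rw [← integral_const_mul, ← integral_sub (integrable_mul_of_L2 _ _) (integrable_mul_of_L2 _ _),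
    ← integral_sub (f := fun x => quart p p x * p x - quart q q x * q x)
      ((integrable_mul_of_L2 _ _).sub (integrable_mul_of_L2 _ _))
      ((integrable_mul_of_L2 _ _).const_mul _), norm_sq_eq_integral, ← integral_const_mul]
  refine norm_integral_le_of_norm_le ((integrable_norm_sq (p - q)).const_mul _) ?_
  filter_upwards [hp.quart_self_coe, hq.quart_self_coe, hp.cts_ae, hq.cts_ae, Lp.coeFn_sub p q]
    with x h1 h2 h3 h4 h5
  rw [h1, h2, h5, Pi.sub_apply, h3, h4]
  set a := cts p x
  set b := cts q x
  have e : a ^ 5 * a - b ^ 5 * b - 6 * (b ^ 5 * (a - b))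
      = (a ^ 4 + 2 * a ^ 3 * b + 3 * a ^ 2 * b ^ 2 + 4 * a * b ^ 3 + 5 * b ^ 4) * (a - b) ^ 2 := by
    ring
  rw [e, norm_mul, norm_pow]
  refine mul_le_mul_of_nonneg_right ?_ (by positivity)
  have ha : ‖a‖ ≤ M := hpM x
  have hb : ‖b‖ ≤ M := hqM x
  calc _ ≤ ‖a ^ 4‖ + ‖2 * a ^ 3 * b‖ + ‖3 * a ^ 2 * b ^ 2‖ + ‖4 * a * b ^ 3‖ + ‖5 * b ^ 4‖ :=
        (norm_add_le _ _).trans (add_le_add_left ((norm_add_le _ _).trans (add_le_add_left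
          ((norm_add_le _ _).trans (add_le_add_left (norm_add_le _ _) _)) _)) _)
    _ = ‖a‖ ^ 4 + 2 * ‖a‖ ^ 3 * ‖b‖ + 3 * ‖a‖ ^ 2 * ‖b‖ ^ 2 + 4 * ‖a‖ * ‖b‖ ^ 3 + 5 * ‖b‖ ^ 4 := by
        simp only [norm_mul, norm_pow]; norm_num
    _ ≤ M ^ 4 + 2 * M ^ 3 * M + 3 * M ^ 2 * M ^ 2 + 4 * M * M ^ 3 + 5 * M ^ 4 := by gcongr
    _ = 15 * M ^ 4 := by ring

/-- `v ↦ ∫v⁶` is not differentiable on `L²`; the uniform sup bound along the curve makes the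
remainder quadratic in the `L²` distance. -/
theorem hasDerivWithinAt_integral_six {v v1 : ℝ → L2} {v' : L2} {I : Set ℝ} {t M : ℝ}
    (hv : HasDerivWithinAt v v' I t) (hwd : ∀ s ∈ I, WD (v s) (v1 s)) (ht : t ∈ I)
    (hM : ∀ s ∈ I, ∀ x, ‖cts (v s) x‖ ≤ M) :
    HasDerivWithinAt (fun s => ∫ x, quart (v s) (v s) x * v s x)
      (6 * ∫ x, quart (v t) (v t) x * v' x) I t := by
  set Q := quart (v t) (v t) with hQ
  have hL : HasDerivWithinAt (fun s => 6 * (inner ℂ (star Q) (v s) : ℂ))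
      (6 * (inner ℂ (star Q) v' : ℂ)) I t := by
    refine ((HasDerivWithinAt.inner ℂ (hasDerivWithinAt_const t I (star Q)) hv).const_mul 6).congr_deriv ?_
    simp
  have hR : HasDerivWithinAt (fun s => (∫ x, quart (v s) (v s) x * v s x)
      - 6 * (inner ℂ (star Q) (v s) : ℂ)) 0 I t := by
    rw [hasDerivWithinAt_iff_isLittleO]
    have hb : (fun s => v s - v t) =O[𝓝[I] t] fun s => s - t := hv.hasFDerivWithinAt.isBigO_sub
    have hsq := (hb.norm_left.pow 2).trans_isLittleO
      (((Asymptotics.isLittleO_pow_sub_sub t (m := 2) (by norm_num)).mono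
        nhdsWithin_le_nhds).congr_left (f₂ := fun s => (s - t) ^ 2) fun s => by simp)
    refine Asymptotics.IsBigO.trans_isLittleO (.of_bound (15 * M ^ 4) ?_) hsq
    filter_upwards [self_mem_nhdsWithin] with s hs
    refine le_trans (le_of_eq ?_) ((norm_integral_six_sub_le (hwd s hs) (hwd t ht) (hM s hs)
      (hM t ht)).trans (le_of_eq ?_))
    · rw [← hQ, ← inner_star_left Q (v s - v t), inner_sub_right]
      congr 1
      simp only [smul_zero, sub_zero]
      ring
    · rw [norm_pow, norm_norm]
  have h := hR.add hL
  rw [inner_star_left, zero_add] at h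
  exact h.congr_of_eventuallyEq (.of_forall fun s => by simp) (by simp)

theorem hasDerivAt_mulL2 {m : ℝ → ℝ → ℂ} {m' : ℝ → ℂ} {t K : ℝ} (hm : ∀ s, BddMeas (m s))
    (hm' : BddMeas m') (h : ∀ s η, ‖m s η - m t η - (s - t) * m' η‖ ≤ K * (s - t) ^ 2) :
    HasDerivAt (fun s => (mulL2 (m s)).restrictScalars ℝ) ((mulL2 m').restrictScalars ℝ) t := by
  rw [hasDerivAt_iff_isLittleO]
  refine Asymptotics.IsBigO.trans_isLittleO (.of_bound K (.of_forall fun s => ?_))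
    (Asymptotics.isLittleO_pow_sub_sub t (m := 2) (by norm_num))
  have hK : 0 ≤ K * (s - t) ^ 2 := (norm_nonneg _).trans (h s 0)
  rw [Real.norm_eq_abs, Real.norm_eq_abs, sq_abs, abs_of_nonneg (sq_nonneg _)]
  refine ContinuousLinearMap.opNorm_le_bound _ hK fun p => norm_L2_le_of_ae ?_
  simp only [sub_apply, smul_apply,
    ContinuousLinearMap.coe_restrictScalars']
  filter_upwards [mulL2_coe (hm s) p, mulL2_coe (hm t) p, mulL2_coe hm' p,
    Lp.coeFn_sub (mulL2 (m s) p - mulL2 (m t) p) ((s - t) • mulL2 m' p),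
    Lp.coeFn_sub (mulL2 (m s) p) (mulL2 (m t) p), Lp.coeFn_smul (s - t) (mulL2 m' p)]
    with x h1 h2 h3 h4 h5 h6
  rw [h4, Pi.sub_apply, h5, h6, Pi.sub_apply, Pi.smul_apply, h1, h2, h3, Complex.real_smul]
  have e : m s x * p x - m t x * p x - ((s - t : ℝ) : ℂ) * (m' x * p x)
      = (m s x - m t x - (s - t) * m' x) * p x := by push_cast; ring
  rw [e, norm_mul]
  exact mul_le_mul_of_nonneg_right (h s x) (norm_nonneg _)

/-- On frequencies at most `n` the propagator is differentiable in operator norm. It can therefore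
be undone on the profile, and the truncated solution satisfies the truncated equation strongly. -/
theorem Evol.hasDerivWithinAt_trunc (h : Evol τ u u1 u2) (n : ℕ) {t : ℝ}
    (ht : t ∈ Set.Icc 0 τ) :
    HasDerivWithinAt (fun s => trunc n 0 (u s))
      (trunc n 5 (u t) - trunc n 0 (quart (u t) (u1 t))) (Set.Icc 0 τ) t := by
  set m : ℝ → ℝ → ℂ := fun s η => cutoff n η * symbol (-s) η with hmdef
  set m' : ℝ → ℂ := fun η => (freq η ^ 5 * cutoff n η) * symbol (-t) η with hm'def
  have hm : ∀ s, BddMeas (m s) := fun s => (bddMeas_cutoff n).mul (bddMeas_symbol _)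
  have hm' : BddMeas m' := (bddMeas_freq_pow_cutoff 5 n).mul (bddMeas_symbol _)
  have hone : ∀ s η, symbol (-s) η * symbol s η = 1 := fun s η => by
    rw [← symbol_add]; simp [symbol]
  have hT : ∀ s η, ‖m s η - m t η - (s - t) * m' η‖ ≤ ((2 * Real.pi * n) ^ 5) ^ 2 * (s - t) ^ 2 := by
    intro s η
    have e : m s η - m t η - (s - t) * m' η = cutoff n η *
        (symbol (-s) η - symbol (-t) η + ((-s : ℝ) - (-t : ℝ)) * (freq η ^ 5 * symbol (-t) η)) := by
      simp only [hmdef, hm'def]; push_cast; ring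
    have hc : ‖cutoff n η‖ * ‖freq η ^ 5‖ ^ 2 = ‖freq η ^ 5 * cutoff n η‖ ^ 2 := by
      rw [norm_mul, mul_pow, mul_comm]
      congr 1
      unfold cutoff
      split_ifs <;> simp
    rw [e, norm_mul]
    refine (mul_le_mul_of_nonneg_left (norm_symbol_taylor_le (-s) (-t) η) (norm_nonneg _)).trans ?_
    rw [← mul_assoc, hc, sq_abs, show (-s - -t) ^ 2 = (s - t) ^ 2 by ring]
    gcongr
    exact norm_freq_pow_cutoff_le 5 n η
  have h1 := (hasDerivAt_mulL2 hm hm' hT).hasDerivWithinAt.clm_apply (h.hasDerivWithinAt_gprof ht)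
  let F : L2 →L[ℝ] L2 := ((Lp.fourierTransformₗᵢ ℝ ℂ).symm.toContinuousLinearEquiv :
    L2 →L[ℂ] L2).restrictScalars ℝ
  have hF : ∀ p, F p = 𝓕⁻ p := fun p => rfl
  have h2 := F.hasFDerivAt.comp_hasDerivWithinAt t h1
  refine (h2.congr_deriv ?_).congr (fun s _ => ?_) ?_
  · rw [map_add, hF, hF, sub_eq_add_neg]
    simp only [ContinuousLinearMap.coe_restrictScalars', map_neg]
    rw [gprof, mulL2_mulL2 hm' (bddMeas_symbol t), mulL2_mulL2 (hm t) (bddMeas_symbol t),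
      ← neg_one_smul ℂ, FourierTransform.fourierInv_smul, neg_one_smul, trunc, trunc, fm, fm]
    simp only [hmdef, hm'def, mul_assoc, hone, mul_one, pow_zero, one_mul]
  all_goals
    simp only [Function.comp_apply, hF, ContinuousLinearMap.coe_restrictScalars']
    rw [gprof, mulL2_mulL2 (hm _) (bddMeas_symbol _), trunc, fm]
    simp only [hmdef, mul_assoc, hone, mul_one, pow_zero, one_mul]

end

/-! ### Integration by parts for the potential energy -/

section

variable {τ : ℝ} {u u1 u2 : ℝ → L2}

theorem WD.integrable_mul_cts {p p1 q q1 : L2} (hp : WD p p1) (hq : WD q q1) {m : ℝ → ℂ}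
    (hm : BddMeas m) : Integrable fun x => m x * (cts p x * cts q x) := by
  obtain ⟨C, hC⟩ := hm.bdd
  refine Integrable.bdd_mul (c := C) ?_ hm.meas.aestronglyMeasurable (.of_forall hC)
  refine (integrable_mul_of_L2 p q).congr ?_
  filter_upwards [hp.cts_ae, hq.cts_ae] with x h1 h2
  rw [h1, h2]

/-- `U³U'U''` -/
def cubicOne (p q r : L2) : L2 :=
  mulL2 (cts p) (mulL2 (cts p) (mulL2 (cts p) (mulL2 (cts q) r)))

/-- `U²U'³` -/
def cubicTwo (p q : L2) : L2 :=
  mulL2 (cts p) (mulL2 (cts p) (mulL2 (cts q) (mulL2 (cts q) q)))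

theorem cubicOne_coe {p q r : L2} (h : WD p q) (h' : WD q r) :
    cubicOne p q r =ᵐ[volume] fun x => cts p x ^ 3 * cts q x * r x := by
  have hp := h.bddMeas_cts
  filter_upwards [mulL2_coe hp (mulL2 (cts p) (mulL2 (cts p) (mulL2 (cts q) r))),
    mulL2_coe hp (mulL2 (cts p) (mulL2 (cts q) r)), mulL2_coe hp (mulL2 (cts q) r),
    mulL2_coe h'.bddMeas_cts r] with x h1 h2 h3 h4
  rw [cubicOne, h1, h2, h3, h4]
  ring

theorem cubicTwo_coe {p q r : L2} (h : WD p q) (h' : WD q r) :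
    cubicTwo p q =ᵐ[volume] fun x => cts p x ^ 2 * cts q x ^ 2 * q x := by
  have hp := h.bddMeas_cts
  have hq := h'.bddMeas_cts
  filter_upwards [mulL2_coe hp (mulL2 (cts p) (mulL2 (cts q) (mulL2 (cts q) q))),
    mulL2_coe hp (mulL2 (cts q) (mulL2 (cts q) q)), mulL2_coe hq (mulL2 (cts q) q),
    mulL2_coe hq q] with x h1 h2 h3 h4
  rw [cubicTwo, h1, h2, h3, h4]
  ring

/-- Integration by parts in `∫ U⁵ ∂ₓ⁵U`. -/
theorem integral_quart_mul_fifth {p p1 p2 p3 p4 p5 p6 : L2} (h0 : WD p p1) (h1 : WD p1 p2)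
    (h2 : WD p2 p3) (h3 : WD p3 p4) (h4 : WD p4 p5) (h5 : WD p5 p6) :
    ∫ x, quart p p x * p5 x =
      -(50 * (∫ x, cubicOne p p1 p2 x * p2 x) + 60 * ∫ x, cubicTwo p p1 x * p2 x) := by
  have b := h0.bddMeas_cts
  have b1 := h1.bddMeas_cts
  have b2 := h2.bddMeas_cts
  have i1 := h0.integrable_mul_cts h5 (b.pow 4)
  have i2 := h2.integrable_mul_cts h2 ((b.pow 3).mul b1)
  have i3 := h1.integrable_mul_cts h2 ((b.pow 2).mul (b1.pow 2))
  -- In this explicit boundary term each summand after the first removes the highest derivative left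
  -- by the preceding ones: `U⁵U⁽⁴⁾`, then `U⁴U'U'''`, then `U⁴U''²`, then `U³U'²U''`.
  have key := integral_eq_zero_of_hasDerivAt_of_integrable
    (f := fun x => cts p x ^ 4 * (cts p x * cts p4 x)
      - 5 * (cts p x ^ 4 * (cts p1 x * cts p3 x))
      + 5 / 2 * (cts p x ^ 4 * (cts p2 x * cts p2 x))
      + 20 * ((cts p x ^ 3 * cts p2 x) * (cts p1 x * cts p1 x)))
    (f' := fun x => cts p x ^ 4 * (cts p x * cts p5 x)
      + (50 * ((cts p x ^ 3 * cts p1 x) * (cts p2 x * cts p2 x))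
      + 60 * ((cts p x ^ 2 * cts p1 x ^ 2) * (cts p1 x * cts p2 x))))
    (fun x => by
      have d0 := h0.hasDerivAt_cts h1 x
      have d1 := h1.hasDerivAt_cts h2 x
      have d2 := h2.hasDerivAt_cts h3 x
      have d3 := h3.hasDerivAt_cts h4 x
      have d4 := h4.hasDerivAt_cts h5 x
      refine (((((d0.pow 4).mul (d0.mul d4)).sub (((d0.pow 4).mul (d1.mul d3)).const_mul 5)).add
        (((d0.pow 4).mul (d2.mul d2)).const_mul (5 / 2))).add
        ((((d0.pow 3).mul d2).mul (d1.mul d1)).const_mul 20)).congr_deriv ?_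
      simp only [Pi.pow_apply, Pi.mul_apply]
      push_cast
      ring)
    (i1.add ((i2.const_mul 50).add (i3.const_mul 60)))
    ((((h0.integrable_mul_cts h4 (b.pow 4)).sub
      ((h1.integrable_mul_cts h3 (b.pow 4)).const_mul 5)).add
      ((h2.integrable_mul_cts h2 (b.pow 4)).const_mul (5 / 2))).add
      ((h1.integrable_mul_cts h1 ((b.pow 3).mul b2)).const_mul 20))
  rw [integral_add (f := fun x => cts p x ^ 4 * (cts p x * cts p5 x))
      (g := fun x => 50 * ((cts p x ^ 3 * cts p1 x) * (cts p2 x * cts p2 x))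
        + 60 * ((cts p x ^ 2 * cts p1 x ^ 2) * (cts p1 x * cts p2 x)))
      i1 ((i2.const_mul 50).add (i3.const_mul 60)), integral_add (i2.const_mul 50) (i3.const_mul 60), integral_const_mul, integral_const_mul] at key
  have e1 : ∫ x, quart p p x * p5 x = ∫ x, cts p x ^ 4 * (cts p x * cts p5 x) := by
    refine integral_congr_ae ?_
    filter_upwards [h0.quart_self_coe, h5.cts_ae] with x e1 e2
    rw [e1, e2]; ring
  have e2 : ∫ x, cubicOne p p1 p2 x * p2 x
      = ∫ x, (cts p x ^ 3 * cts p1 x) * (cts p2 x * cts p2 x) := by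
    refine integral_congr_ae ?_
    filter_upwards [cubicOne_coe h0 h1 (r := p2), h2.cts_ae] with x e1 e2
    rw [e1, e2]; ring
  have e3 : ∫ x, cubicTwo p p1 x * p2 x
      = ∫ x, (cts p x ^ 2 * cts p1 x ^ 2) * (cts p1 x * cts p2 x) := by
    refine integral_congr_ae ?_
    filter_upwards [cubicTwo_coe h0 h1, h1.cts_ae, h2.cts_ae] with x e1 e2 e3
    rw [e1, e3, e2]; ring
  rw [e1, e2, e3]
  linear_combination key

/-- `u⁵ · u⁴u_x` is the derivative of `u¹⁰/10`. -/
theorem integral_quart_quart {p q r : L2} (h : WD p q) (h' : WD q r) :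
    ∫ x, quart p p x * quart p q x = 0 := by
  have h1 := (h.quart h').integral_mul (h.quart h')
  have e1 : ∀ f : L2, ∫ x, f x * ((5 : ℂ) • quart p q : L2) x = 5 * ∫ x, f x * quart p q x := by
    intro f
    rw [← integral_const_mul]
    refine integral_congr_ae ?_
    filter_upwards [Lp.coeFn_smul (5 : ℂ) (quart p q)] with x hx
    rw [hx, Pi.smul_apply, smul_eq_mul]
    ring
  have e2 : ∫ x, ((5 : ℂ) • quart p q : L2) x * quart p p x = ∫ x, quart p p x * ((5 : ℂ) • quart p q : L2) x :=
    integral_congr_ae (.of_forall fun x => mul_comm _ _)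
  rw [e2, e1] at h1
  linear_combination (1 / 10 : ℂ) * h1

/-! ### Conservation of energy -/

/-- The truncated potential energy `∫ V⁶`, `V` the low frequency part. -/
def sextic (n : ℕ) (p : L2) : ℂ := ∫ x, quart (trunc n 0 p) (trunc n 0 p) x * trunc n 0 p x

/-- The time derivative of `sextic n u / 6`. -/
def sexticRate (n : ℕ) (p q r : L2) : ℂ :=
  -(50 * (∫ x, cubicOne (trunc n 0 p) (trunc n 0 q) (trunc n 0 r) x * trunc n 0 r x)
    + 60 * ∫ x, cubicTwo (trunc n 0 p) (trunc n 0 q) x * trunc n 0 r x)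
  - ∫ x, quart (trunc n 0 p) (trunc n 0 p) x * trunc n 0 (quart p q) x

theorem WD.trunc {p q : L2} (h : WD p q) (n : ℕ) : WD (trunc n 0 p) (trunc n 0 q) := by
  rw [← h.trunc_eq]; exact WD_trunc n 0 p

theorem Evol.hasDerivWithinAt_sextic (h : Evol τ u u1 u2) (n : ℕ) {t : ℝ}
    (ht : t ∈ Set.Icc 0 τ) :
    HasDerivWithinAt (fun s => sextic n (u s)) (6 * sexticRate n (u t) (u1 t) (u2 t))
      (Set.Icc 0 τ) t := by
  have hb : ∀ s ∈ Set.Icc 0 τ, ∀ x, ‖cts (FifthKdV.trunc n 0 (u s)) x‖ ≤ ‖u 0‖ + (2 * Real.pi * n) ^ 1 * ‖u 0‖ := by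
    intro s hs x
    refine ((WD_trunc n 0 (u s)).norm_cts_le x).trans ?_
    rw [← h.mass hs]
    exact add_le_add (norm_trunc_zero_le n _)
      (norm_fm_le (bddMeas_freq_pow_cutoff 1 n).meas (norm_freq_pow_cutoff_le 1 n) (u s))
  refine (hasDerivWithinAt_integral_six (h.hasDerivWithinAt_trunc n ht)
    (fun s _ => WD_trunc n 0 (u s)) ht hb).congr_deriv ?_
  congr 1
  have e := integral_quart_mul_fifth (WD_trunc n 0 (u t)) (WD_trunc n 1 _) (WD_trunc n 2 _)
    (WD_trunc n 3 _) (WD_trunc n 4 _) (WD_trunc n 5 _)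
  have t1 : FifthKdV.trunc n 1 (u t) = FifthKdV.trunc n 0 (u1 t) := (h.wd1 t ht).trunc_eq n 0
  have t2 : FifthKdV.trunc n 2 (u t) = FifthKdV.trunc n 0 (u2 t) := by
    rw [(h.wd1 t ht).trunc_eq n 1, (h.wd2 t ht).trunc_eq n 0]
  rw [t1, t2] at e
  rw [sexticRate, ← e, ← integral_sub (integrable_mul_of_L2 _ _) (integrable_mul_of_L2 _ _)]
  refine integral_congr_ae ?_
  filter_upwards [Lp.coeFn_sub (FifthKdV.trunc n 5 (u t))
    (FifthKdV.trunc n 0 (FifthKdV.quart (u t) (u1 t)))] with x hx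
  rw [hx, Pi.sub_apply, mul_sub]

/-- The point is uniformity in `n`: the sup norm of a truncation is controlled by untruncated `H¹`
norms. -/
theorem norm_sexticRate_le {n : ℕ} {p q r : L2} (h : WD p q) (h' : WD q r) {M : ℝ}
    (hM : ‖p‖ + ‖q‖ + ‖r‖ ≤ M) : ‖sexticRate n p q r‖ ≤ 110 * M ^ 6 + M ^ 10 := by
  have a0 := norm_trunc_zero_le n p
  have a1 := norm_trunc_zero_le n q
  have a2 := norm_trunc_zero_le n r
  have n0 := norm_nonneg p
  have n1 := norm_nonneg q
  have n2 := norm_nonneg r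
  have hM0 : 0 ≤ M := by linarith
  have m0 : ∀ (w : L2) {K : ℝ}, ‖w‖ ≤ K → ‖mulL2 (cts (trunc n 0 p)) w‖ ≤ M * K := fun w K hw =>
    ((h.trunc n).norm_mulL2_cts_le w).trans (mul_le_mul (by linarith) hw (norm_nonneg _) hM0)
  have m1 : ∀ (w : L2) {K : ℝ}, ‖w‖ ≤ K → ‖mulL2 (cts (trunc n 0 q)) w‖ ≤ M * K := fun w K hw =>
    ((h'.trunc n).norm_mulL2_cts_le w).trans (mul_le_mul (by linarith) hw (norm_nonneg _) hM0)
  have m2 : ∀ (w : L2) {K : ℝ}, ‖w‖ ≤ K → ‖mulL2 (cts p) w‖ ≤ M * K := fun w K hw =>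
    (h.norm_mulL2_cts_le w).trans (mul_le_mul (by linarith) hw (norm_nonneg _) hM0)
  have b1 := m0 _ (m0 _ (m0 _ (m1 (trunc n 0 r) (K := M) (by linarith))))
  have b2 := m0 _ (m0 _ (m1 _ (m1 (trunc n 0 q) (K := M) (by linarith))))
  have b3 := m0 _ (m0 _ (m0 _ (m0 (trunc n 0 p) (K := M) (by linarith))))
  have b4 := (norm_trunc_zero_le n (quart p q)).trans
    (m2 _ (m2 _ (m2 _ (m2 q (K := M) (by linarith)))))
  have hr : ‖trunc n 0 r‖ ≤ M := by linarith
  have c1 := (norm_integral_mul_le (cubicOne (trunc n 0 p) (trunc n 0 q) (trunc n 0 r))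
    (trunc n 0 r)).trans (mul_le_mul b1 hr (norm_nonneg _) (by positivity))
  have c2 := (norm_integral_mul_le (cubicTwo (trunc n 0 p) (trunc n 0 q))
    (trunc n 0 r)).trans (mul_le_mul b2 hr (norm_nonneg _) (by positivity))
  have c3 := (norm_integral_mul_le (quart (trunc n 0 p) (trunc n 0 p))
    (trunc n 0 (quart p q))).trans (mul_le_mul b3 b4 (norm_nonneg _) (by positivity))
  calc ‖sexticRate n p q r‖
      ≤ (50 * ‖∫ x, cubicOne (trunc n 0 p) (trunc n 0 q) (trunc n 0 r) x * trunc n 0 r x‖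
        + 60 * ‖∫ x, cubicTwo (trunc n 0 p) (trunc n 0 q) x * trunc n 0 r x‖)
        + ‖∫ x, quart (trunc n 0 p) (trunc n 0 p) x * trunc n 0 (quart p q) x‖ := by
        refine (norm_sub_le _ _).trans (add_le_add_left ?_ _)
        rw [norm_neg]
        refine (norm_add_le _ _).trans (le_of_eq ?_)
        rw [norm_mul, norm_mul]
        norm_num
    _ ≤ (50 * (M * (M * (M * (M * M))) * M) + 60 * (M * (M * (M * (M * M))) * M))
        + M * (M * (M * (M * M))) * (M * (M * (M * (M * M)))) := by
        gcongr
    _ = 110 * M ^ 6 + M ^ 10 := by ring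

theorem tendsto_cubicOne {p q r : L2} (h : WD p q) (h' : WD q r) :
    Tendsto (fun n => cubicOne (trunc n 0 p) (trunc n 0 q) (trunc n 0 r)) atTop
      (𝓝 (cubicOne p q r)) := by
  have m0 := fun {w : ℕ → L2} {v : L2} => tendsto_mulL2_cts (w := w) (v := v)
    (.of_forall fun n => h.trunc n) h (tendsto_trunc p) (tendsto_trunc q)
  have m1 := fun {w : ℕ → L2} {v : L2} => tendsto_mulL2_cts (w := w) (v := v)
    (.of_forall fun n => h'.trunc n) h' (tendsto_trunc q) (tendsto_trunc r)
  exact m0 (m0 (m0 (m1 (tendsto_trunc r))))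

theorem tendsto_cubicTwo {p q r : L2} (h : WD p q) (h' : WD q r) :
    Tendsto (fun n => cubicTwo (trunc n 0 p) (trunc n 0 q)) atTop (𝓝 (cubicTwo p q)) := by
  have m0 := fun {w : ℕ → L2} {v : L2} => tendsto_mulL2_cts (w := w) (v := v)
    (.of_forall fun n => h.trunc n) h (tendsto_trunc p) (tendsto_trunc q)
  have m1 := fun {w : ℕ → L2} {v : L2} => tendsto_mulL2_cts (w := w) (v := v)
    (.of_forall fun n => h'.trunc n) h' (tendsto_trunc q) (tendsto_trunc r)
  exact m0 (m0 (m1 (m1 (tendsto_trunc q))))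

theorem tendsto_quart_trunc {p q : L2} (h : WD p q) :
    Tendsto (fun n => quart (trunc n 0 p) (trunc n 0 p)) atTop (𝓝 (quart p p)) := by
  have m0 := fun {w : ℕ → L2} {v : L2} => tendsto_mulL2_cts (w := w) (v := v)
    (.of_forall fun n => h.trunc n) h (tendsto_trunc p) (tendsto_trunc q)
  exact m0 (m0 (m0 (m0 (tendsto_trunc p))))

/-- The purely nonlinear term pairs the fifth power of the truncation with the truncation of
`u⁴u_x`. It need not vanish for finite `n`, but it does in the limit, by `integral_quart_quart`. -/
theorem tendsto_sexticRate {p q r : L2} (h : WD p q) (h' : WD q r) :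
    Tendsto (fun n => sexticRate n p q r) atTop
      (𝓝 (-(50 * (∫ x, cubicOne p q r x * r x) + 60 * ∫ x, cubicTwo p q x * r x))) := by
  have t1 := tendsto_integral_mul (tendsto_cubicOne h h') (tendsto_trunc r)
  have t2 := tendsto_integral_mul (tendsto_cubicTwo h h') (tendsto_trunc r)
  have t3 := tendsto_integral_mul (tendsto_quart_trunc h) (tendsto_trunc (quart p q))
  rw [integral_quart_quart h h'] at t3
  simpa only [sub_zero, sexticRate] using ((t1.const_mul 50).add (t2.const_mul 60)).neg.sub t3

theorem tendsto_sextic {p q : L2} (h : WD p q) :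
    Tendsto (fun n => sextic n p) atTop (𝓝 (∫ x, quart p p x * p x)) :=
  tendsto_integral_mul (tendsto_quart_trunc h) (tendsto_trunc p)

theorem cts_star_real {p q : L2} (h : WD p q) (hp : star p = p) {x : ℝ} :
    conj (cts p x ^ 4) = cts p x ^ 4 := by
  rw [map_pow, conj_cts h hp]

theorem re_inner_resol2_quart {p q r : L2} (h : WD p q) (h' : WD q r) {e : ℝ} (he : 0 < e) :
    (inner ℂ (resol e r) (resol2 e (quart p q)) : ℂ).re =
      (inner ℂ (resol e r) (resol1 e (mulL2 (fun x => cts p x ^ 4) r)) : ℂ).re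
      + (inner ℂ (resol e r) (resol e (quartRem p q r)) : ℂ).re := by
  obtain ⟨g, hg, hg'⟩ := h.quart_deriv h'
  rw [hg.resol2_eq he, ← hg'.resol1_eq he, ← Complex.add_re, ← inner_add_right]
  congr 2
  rw [resol1, resol1, resol1, fm, fm, fm, FourierTransform.fourier_add, map_add,
    FourierTransform.fourierInv_add]

theorem norm_quartRem_le {p q r : L2} (h : WD p q) (h' : WD q r) {M : ℝ}
    (hM : ‖p‖ + ‖q‖ + ‖r‖ ≤ M) : ‖quartRem p q r‖ ≤ 20 * M ^ 5 := by
  have n0 := norm_nonneg p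
  have n1 := norm_nonneg q
  have n2 := norm_nonneg r
  have hM0 : 0 ≤ M := by linarith
  have hp : ∀ x, ‖cts p x‖ ≤ M := fun x => (h.norm_cts_le x).trans (by linarith)
  have hq : ∀ x, ‖cts q x‖ ≤ M := fun x => (h'.norm_cts_le x).trans (by linarith)
  have b1 := norm_mulL2_le ((BddMeas.const 12).mul ((h.bddMeas_cts.pow 2).mul h'.bddMeas_cts)).meas
    (C := 12 * M ^ 3) (fun x => by
      rw [norm_mul, norm_mul, norm_pow]
      calc _ ≤ ‖(12 : ℂ)‖ * (M ^ 2 * M) := by gcongr; exacts [hp x, hq x]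
        _ = 12 * M ^ 3 := by norm_num; ring) (mulL2 (cts q) q)
  have b2 := norm_mulL2_le ((BddMeas.const 4).mul (h.bddMeas_cts.pow 3)).meas
    (C := 4 * M ^ 3) (fun x => by
      rw [norm_mul, norm_pow]
      calc _ ≤ ‖(4 : ℂ)‖ * M ^ 3 := by gcongr; exact hp x
        _ = 4 * M ^ 3 := by norm_num) (mulL2 (cts q) r + mulL2 (cts q) r)
  have c1 := norm_mulL2_le h'.bddMeas_cts.meas hq q
  have c2 := norm_mulL2_le h'.bddMeas_cts.meas hq r
  have c3 := norm_add_le (mulL2 (cts q) r) (mulL2 (cts q) r)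
  calc ‖quartRem p q r‖ ≤ _ := norm_add_le _ _
    _ ≤ 12 * M ^ 3 * (M * M) + 4 * M ^ 3 * (M * M + M * M) := by
      refine add_le_add (b1.trans ?_) (b2.trans ?_)
      · gcongr
        exact c1.trans (by gcongr; linarith)
      · gcongr
        refine c3.trans (add_le_add ?_ ?_) <;> exact c2.trans (by gcongr; linarith)
    _ = 20 * M ^ 5 := by ring

/-- The time derivative of the regularized energy. -/
def energyRate (n : ℕ) (p q r : L2) : ℝ :=
  -(inner ℂ (resol (1 / (n + 1)) r) (resol2 (1 / (n + 1)) (quart p q)) : ℂ).re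
    - 1 / 5 * (sexticRate n p q r).re

/-- Dominating constant for the limit under the time integral. The commutator gives `10`, the
remainder `20` and the potential part `110/5 = 22`. -/
theorem abs_energyRate_le {n : ℕ} {p q r : L2} (h : WD p q) (h' : WD q r) (hp : star p = p)
    {M : ℝ} (hM : ‖p‖ + ‖q‖ + ‖r‖ ≤ M) : |energyRate n p q r| ≤ 52 * M ^ 6 + M ^ 10 := by
  have n0 := norm_nonneg p
  have n1 := norm_nonneg q
  have n2 := norm_nonneg r
  have hM0 : 0 ≤ M := by linarith
  have he : (0 : ℝ) < 1 / ((n : ℝ) + 1) := by positivity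
  have hU : ∀ x, ‖cts p x‖ ≤ M := fun x => (h.norm_cts_le x).trans (by linarith)
  have hV : ∀ x, ‖cts q x‖ ≤ M := fun x => (h'.norm_cts_le x).trans (by linarith)
  have a1 := abs_re_inner_resol_le he (h.bddMeas_cts.pow 4) (h.bddMeas_deriv_pow_four h').meas
    (A := 4 * M ^ 4) (fun x => by
      rw [norm_mul, norm_mul, norm_pow]
      calc _ ≤ ‖(4 : ℂ)‖ * M ^ 3 * M := by gcongr; exacts [hU x, hV x]
        _ = 4 * M ^ 4 := by norm_num; ring)
    (h.hasDerivAt_cts_pow_four h') (fun x => cts_star_real h hp) r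
  have a2 : |(inner ℂ (resol (1 / (n + 1)) r) (resol (1 / (n + 1)) (quartRem p q r)) : ℂ).re|
      ≤ M * (20 * M ^ 5) := by
    refine (Complex.abs_re_le_norm _).trans ((norm_inner_le_norm _ _).trans ?_)
    exact mul_le_mul ((norm_resol_le _ _).trans (by linarith))
      ((norm_resol_le _ _).trans (norm_quartRem_le h h' hM)) (norm_nonneg _) hM0
  have a3 := (Complex.abs_re_le_norm _).trans (norm_sexticRate_le (n := n) h h' hM)
  have a4 : 5 / 2 * (4 * M ^ 4) * ‖r‖ ^ 2 ≤ 5 / 2 * (4 * M ^ 4) * M ^ 2 := by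
    gcongr; linarith
  have hM10 : 0 ≤ M ^ 10 := by positivity
  rw [energyRate, re_inner_resol2_quart h h' he]
  rw [abs_le] at a1 a2 a3 ⊢
  constructor <;> nlinarith

theorem tendsto_energyRate {p q r : L2} (h : WD p q) (h' : WD q r) (hp : star p = p) :
    Tendsto (fun n => energyRate n p q r) atTop (𝓝 0) := by
  have he : ∀ n : ℕ, (0 : ℝ) < 1 / ((n : ℝ) + 1) := fun n => by positivity
  have hlim := tendsto_one_div_add_atTop_nhds_zero_nat (𝕜 := ℝ)
  have t1 := tendsto_re_inner_resol he hlim (h.bddMeas_cts.pow 4) (h.bddMeas_deriv_pow_four h')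
    (h.hasDerivAt_cts_pow_four h') (fun x => cts_star_real h hp) r
  have hres : ∀ w, Tendsto (fun n : ℕ => resol (1 / ((n : ℝ) + 1)) w) atTop (𝓝 w) := fun w =>
    tendsto_resol hlim w
  have t2 := Complex.continuous_re.continuousAt.tendsto.comp
    ((hres r).inner (hres (quartRem p q r)) (𝕜 := ℂ))
  have t3 := Complex.continuous_re.continuousAt.tendsto.comp (tendsto_sexticRate h h')
  have t := (t1.add t2).neg.sub (t3.const_mul (1 / 5))
  have hr : star r = r := h'.star_eq (h.star_eq hp)
  -- The formal conservation law. With `X = ∫U³U'U''²` and `Y = ∫U²U'³U''`, the quadratic part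
  -- contributes `-(2 + 8)X - 12Y` and the potential part `(50X + 60Y)/5`.
  have key : -(1 / 2 * (inner ℂ r (mulL2 (fun x => 4 * cts p x ^ 3 * cts q x) r) : ℂ).re
      + (inner ℂ r (quartRem p q r) : ℂ).re) - 1 / 5 * (-(50 * (∫ x, cubicOne p q r x * r x)
      + 60 * ∫ x, cubicTwo p q x * r x)).re = 0 := by
    have e : ∀ c : ℂ, 1 / 2 * c.re = (1 / 2 * c).re := fun c => by
      simp [Complex.mul_re]
    have e' : ∀ c : ℂ, 1 / 5 * c.re = (1 / 5 * c).re := fun c => by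
      simp [Complex.mul_re]
    rw [e, e', ← Complex.add_re, ← Complex.neg_re, ← Complex.sub_re]
    refine (congrArg Complex.re ?_).trans Complex.zero_re
    rw [inner_eq_integral_of_star hr, inner_eq_integral_of_star hr]
    have i1 := integrable_mul_of_L2 (cubicOne p q r) r
    have i2 := integrable_mul_of_L2 (cubicTwo p q) r
    have e1 : ∫ x, r x * mulL2 (fun x => 4 * cts p x ^ 3 * cts q x) r x
        = 4 * ∫ x, cubicOne p q r x * r x := by
      rw [← integral_const_mul]
      refine integral_congr_ae ?_
      filter_upwards [mulL2_coe (h.bddMeas_deriv_pow_four h') r, cubicOne_coe h h' (r := r)]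
        with x h1 h2
      rw [h1, h2]; ring
    have e2 : ∫ x, r x * quartRem p q r x
        = 12 * (∫ x, cubicTwo p q x * r x) + 8 * ∫ x, cubicOne p q r x * r x := by
      rw [← integral_const_mul, ← integral_const_mul,
        ← integral_add (i2.const_mul 12) (i1.const_mul 8)]
      refine integral_congr_ae ?_
      filter_upwards [cubicOne_coe h h' (r := r), cubicTwo_coe h h',
        Lp.coeFn_add (mulL2 (fun x => 12 * (cts p x ^ 2 * cts q x)) (mulL2 (cts q) q))
          (mulL2 (fun x => 4 * cts p x ^ 3) (mulL2 (cts q) r + mulL2 (cts q) r)),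
        mulL2_coe ((BddMeas.const 12).mul ((h.bddMeas_cts.pow 2).mul h'.bddMeas_cts))
          (mulL2 (cts q) q), mulL2_coe ((BddMeas.const 4).mul (h.bddMeas_cts.pow 3))
          (mulL2 (cts q) r + mulL2 (cts q) r), mulL2_coe h'.bddMeas_cts q,
        Lp.coeFn_add (mulL2 (cts q) r) (mulL2 (cts q) r), mulL2_coe h'.bddMeas_cts r]
        with x h1 h2 h3 h4 h5 h6 h7 h8
      rw [quartRem, h3, Pi.add_apply, h4, h5, h6, h7, Pi.add_apply, h8, h1, h2]
      ring
    rw [e1, e2]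
    ring
  rw [key] at t
  refine t.congr fun n => ?_
  rw [energyRate, re_inner_resol2_quart h h' (he n)]
  rfl

/-- The energy `½‖uₓₓ‖² - (1/30)∫u⁶`. -/
def energy (p r : L2) : ℝ := 1 / 2 * ‖r‖ ^ 2 - 1 / 30 * (∫ x, quart p p x * p x).re

/-- The regularized energies converge at each time, and the integrals of their rates tend to zero by
dominated convergence. The quadratic and potential parts are regularized differently; this is
harmless because only the limits of the rates have to cancel. -/
theorem Evol.energy (h : Evol τ u u1 u2) (hτ : 0 ≤ τ) :
    energy (u τ) (u2 τ) = energy (u 0) (u2 0) := by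
  have hr : τ ∈ Set.Icc 0 τ := ⟨hτ, le_rfl⟩
  have hl : (0 : ℝ) ∈ Set.Icc 0 τ := ⟨le_rfl, hτ⟩
  obtain ⟨M, hM⟩ := isCompact_Icc.exists_bound_of_continuousOn
    ((h.cont.norm.add h.cont1.norm).add h.cont2.norm)
  have hM' : ∀ s ∈ Set.Icc 0 τ, ‖u s‖ + ‖u1 s‖ + ‖u2 s‖ ≤ M := fun s hs =>
    (le_abs_self _).trans (hM s hs)
  set E : ℕ → ℝ → ℝ := fun n s => 1 / 2 * ‖resol (1 / (n + 1)) (u2 s)‖ ^ 2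
    - 1 / 30 * (sextic n (u s)).re with hE
  have hd : ∀ n, ∀ s ∈ Set.Icc 0 τ,
      HasDerivWithinAt (E n) (energyRate n (u s) (u1 s) (u2 s)) (Set.Icc 0 τ) s := by
    intro n s hs
    have d1 := h.hasDerivWithinAt_norm_resol (e := 1 / ((n : ℝ) + 1)) (by positivity) hs
    have d2 := Complex.reCLM.hasFDerivAt.comp_hasDerivWithinAt s (h.hasDerivWithinAt_sextic n hs)
    refine ((d1.const_mul (1 / 2)).sub (d2.const_mul (1 / 30))).congr_deriv ?_
    have : (6 * sexticRate n (u s) (u1 s) (u2 s)).re = 6 * (sexticRate n (u s) (u1 s) (u2 s)).re := by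
      simp [Complex.mul_re]
    rw [energyRate, Complex.reCLM_apply, this]
    ring
  have hlim : ∀ s ∈ Set.Icc 0 τ, Tendsto (fun n => E n s) atTop (𝓝 (FifthKdV.energy (u s) (u2 s))) := by
    intro s hs
    have l1 := ((tendsto_resol tendsto_one_div_add_atTop_nhds_zero_nat (u2 s)).norm.pow 2).const_mul (1 / 2)
    have l2 := (Complex.continuous_re.continuousAt.tendsto.comp
      (tendsto_sextic (h.wd1 s hs))).const_mul (1 / 30)
    exact l1.sub l2
  have hderiv : ∀ n, ∀ s ∈ Set.Ioo 0 τ, deriv (E n) s = energyRate n (u s) (u1 s) (u2 s) :=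
    fun n s hs => ((hd n s (Set.Ioo_subset_Icc_self hs)).hasDerivAt (Icc_mem_nhds hs.1 hs.2)).deriv
  have hbound : ∀ n, ∀ᵐ s, s ∈ Set.uIoc 0 τ → ‖deriv (E n) s‖ ≤ 52 * M ^ 6 + M ^ 10 := by
    intro n
    -- The two-sided derivative is known only in the open interval, so the endpoint `τ` is discarded
    -- as a null set.
    filter_upwards [compl_mem_ae_iff.mpr (measure_singleton τ)] with s hs hs'
    rw [Set.uIoc_of_le hτ] at hs'
    have hs2 : s ∈ Set.Ioo 0 τ := ⟨hs'.1, lt_of_le_of_ne hs'.2 hs⟩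
    have hs3 := Set.Ioo_subset_Icc_self hs2
    rw [hderiv n s hs2, Real.norm_eq_abs]
    exact abs_energyRate_le (h.wd1 s hs3) (h.wd2 s hs3) (h.real s hs3) (hM' s hs3)
  have hint : ∀ n, IntervalIntegrable (deriv (E n)) volume 0 τ := by
    intro n
    refine (intervalIntegrable_const (c := 52 * M ^ 6 + M ^ 10)).mono_fun
      (measurable_deriv _).aestronglyMeasurable ?_
    rw [EventuallyLE, ae_restrict_iff' measurableSet_uIoc]
    filter_upwards [hbound n] with s hs hs'
    exact (hs hs').trans (le_abs_self _)
  have hftc : ∀ n, ∫ s in (0 : ℝ)..τ, deriv (E n) s = E n τ - E n 0 := fun n =>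
    intervalIntegral.integral_eq_sub_of_hasDerivAt_of_le hτ
      (fun s hs => (hd n s hs).continuousWithinAt)
      (fun s hs => by
        rw [hderiv n s hs]
        exact (hd n s (Set.Ioo_subset_Icc_self hs)).hasDerivAt (Icc_mem_nhds hs.1 hs.2)) (hint n)
  have hdct : Tendsto (fun n => ∫ s in (0 : ℝ)..τ, deriv (E n) s) atTop
      (𝓝 (∫ s in (0 : ℝ)..τ, (0 : ℝ))) := by
    refine intervalIntegral.tendsto_integral_filter_of_dominated_convergence
      (fun _ => 52 * M ^ 6 + M ^ 10)
      (.of_forall fun n => (measurable_deriv _).aestronglyMeasurable)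
      (.of_forall hbound) intervalIntegrable_const ?_
    filter_upwards [compl_mem_ae_iff.mpr (measure_singleton τ)] with s hs hs'
    rw [Set.uIoc_of_le hτ] at hs'
    have hs2 : s ∈ Set.Ioo 0 τ := ⟨hs'.1, lt_of_le_of_ne hs'.2 hs⟩
    have hs3 := Set.Ioo_subset_Icc_self hs2
    exact (tendsto_energyRate (h.wd1 s hs3) (h.wd2 s hs3) (h.real s hs3)).congr
      fun n => (hderiv n s hs2).symm
  simp only [intervalIntegral.integral_zero, hftc] at hdct
  have := tendsto_nhds_unique hdct ((hlim τ hr).sub (hlim 0 hl))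
  linarith

/-! ### The a priori bound in `H²` -/

theorem WD.norm_sq_le {p q r : L2} (h : WD p q) (h' : WD q r) : ‖q‖ ^ 2 ≤ ‖p‖ * ‖r‖ := by
  have h1 := h.inner h'
  have h2 : (‖q‖ ^ 2 : ℝ) = -(Inner.inner ℂ p r : ℂ).re := by
    simp [h1, inner_self_eq_norm_sq_to_K, ← Complex.ofReal_pow]
  rw [h2]
  exact (neg_le_abs _).trans ((Complex.abs_re_le_norm _).trans (norm_inner_le_norm _ _))

/-- Gagliardo–Nirenberg: `∫u⁶ ≤ ‖u‖_∞⁴‖u‖²`, with `‖u‖_∞² ≤ ‖u‖‖u_x‖` and `‖u_x‖² ≤ ‖u‖‖u_xx‖`. -/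
theorem abs_sextic_le {p q r : L2} (h : WD p q) (h' : WD q r) :
    |(∫ x, quart p p x * p x).re| ≤ ‖p‖ ^ 5 * ‖r‖ := by
  have hb : ∀ x, ‖cts p x ^ 4‖ ≤ (‖p‖ * ‖q‖) ^ 2 := fun x => by
    rw [norm_pow, show ‖cts p x‖ ^ 4 = (‖cts p x‖ ^ 2) ^ 2 by ring]
    gcongr
    exact h.norm_cts_sq_le x
  refine (Complex.abs_re_le_norm _).trans ((norm_integral_mul_le _ _).trans ?_)
  rw [h.quart_eq_mulL2]
  refine (mul_le_mul_of_nonneg_right (norm_mulL2_le (h.bddMeas_cts.pow 4).meas hb p)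
    (norm_nonneg _)).trans ?_
  have := h.norm_sq_le h'
  calc (‖p‖ * ‖q‖) ^ 2 * ‖p‖ * ‖p‖ = ‖p‖ ^ 4 * ‖q‖ ^ 2 := by ring
    _ ≤ ‖p‖ ^ 4 * (‖p‖ * ‖r‖) := by gcongr
    _ = _ := by ring

/-- Conservation of mass and energy bound the `H²` norm. -/
theorem Evol.norm_snd_le (h : Evol τ u u1 u2) (hτ : 0 ≤ τ) {M : ℝ} (hM : ‖u 0‖ ≤ M)
    (hM2 : ‖u2 0‖ ≤ M) (hM1 : M ≤ 1) : ‖u2 τ‖ ≤ 2 * M := by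
  have hr : τ ∈ Set.Icc 0 τ := ⟨hτ, le_rfl⟩
  have hl : (0 : ℝ) ∈ Set.Icc 0 τ := ⟨le_rfl, hτ⟩
  have hE := h.energy hτ
  have b1 := abs_sextic_le (h.wd1 τ hr) (h.wd2 τ hr)
  have b2 := abs_sextic_le (h.wd1 0 hl) (h.wd2 0 hl)
  rw [h.mass hr] at b1
  have hM0 : 0 ≤ M := (norm_nonneg _).trans hM
  have h5 : ‖u 0‖ ^ 5 ≤ M := (pow_le_pow_left₀ (norm_nonneg _) hM 5).trans (by
    calc M ^ 5 ≤ M ^ 1 := pow_le_pow_of_le_one hM0 hM1 (by norm_num)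
      _ = M := pow_one M)
  have c1 := b1.trans (mul_le_mul_of_nonneg_right h5 (norm_nonneg _))
  have c2 := b2.trans (mul_le_mul h5 hM2 (norm_nonneg _) hM0)
  unfold FifthKdV.energy at hE
  rw [abs_le] at c1 c2
  have c3 := pow_le_pow_left₀ (norm_nonneg _) hM2 2
  -- With `N = ‖u2 τ‖`, conservation gives `N²/2 ≤ M²/2 + (M² + MN)/30`, which is false for `N >
  -- 2M`.
  by_contra hcon
  push Not at hcon
  nlinarith [norm_nonneg (u2 τ)]

end

section

/-! ### The phase `σ⁵ + yσ` -/

/-- The scale `b²` of the stationary points of `σ⁵ + yσ`, bounded below by `1`. -/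
def StatScale (b y : ℝ) : Prop := 1 ≤ b ∧ (b = 1 ∧ |y| ≤ 5 ∨ |y| = 5 * b ^ 8)

theorem exists_statScale (y : ℝ) : ∃ b, StatScale b y := by
  rcases le_total |y| 5 with h | h
  · exact ⟨1, le_rfl, .inl ⟨rfl, h⟩⟩
  · refine ⟨(|y| / 5) ^ (1 / 8 : ℝ), Real.one_le_rpow (by linarith) (by norm_num), .inr ?_⟩
    rw [← Real.rpow_natCast, ← Real.rpow_mul (by positivity)]
    norm_num
    ring

/-- The square of the derivative of the phase, regularized at stationary points. -/
def phaseWeight (b y σ : ℝ) : ℝ := (5 * σ ^ 4 + y) ^ 2 + b ^ 6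

variable {b y : ℝ}

theorem StatScale.abs_le (h : StatScale b y) : |y| ≤ 5 * b ^ 8 := by
  rcases h.2 with ⟨h1, h2⟩ | h2
  · rw [h1]; linarith
  · exact h2.le

theorem StatScale.weight_pos (h : StatScale b y) (σ : ℝ) : 0 < phaseWeight b y σ := by
  have := h.1
  unfold phaseWeight
  positivity

/-- When `|y| = 5b⁸`, the derivative of the phase is at least `b⁶ ||σ| - b²|`, by factoring `σ⁴ -
b⁸`. So `b²` is the location of the stationary points and `b⁻³` their width, and `b⁶` is the square
of the derivative at that distance, which explains `phaseWeight`. The factor `2` is needed for the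
range `|y| ≤ 5`. -/
theorem StatScale.near_le (h : StatScale b y) (σ : ℝ) :
    b ^ 6 * (1 + (b ^ 3 * (|σ| - b ^ 2)) ^ 2) ≤ 2 * phaseWeight b y σ := by
  have hs : 0 ≤ |σ| := abs_nonneg σ
  have h4 : σ ^ 4 = |σ| ^ 4 := (Even.pow_abs (by decide) σ).symm
  unfold phaseWeight
  rw [h4]
  set s := |σ|
  have hb := h.1
  have hb2 : 1 ≤ b ^ 2 := one_le_pow₀ hb
  rcases h.2 with ⟨h1, h2⟩ | h2
  · subst h1
    rw [_root_.abs_le] at h2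
    rcases le_total s 1 with hs1 | hs1
    · nlinarith [sq_nonneg (5 * s ^ 4 + y)]
    · have : s - 1 ≤ 5 * s ^ 4 + y := by
        have : s ≤ s ^ 4 := le_self_pow₀ hs1 (by norm_num)
        linarith
      nlinarith [pow_le_pow_left₀ (by linarith) this 2]
  · have key : (b ^ 6 * |s - b ^ 2|) ^ 2 ≤ (5 * s ^ 4 + y) ^ 2 := by
      rw [← sq_abs (5 * s ^ 4 + y)]
      refine pow_le_pow_left₀ (by positivity) ?_ 2
      have e : |s ^ 4 - b ^ 8| = |s - b ^ 2| * ((s + b ^ 2) * (s ^ 2 + b ^ 4)) := by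
        rw [← abs_of_nonneg (show 0 ≤ (s + b ^ 2) * (s ^ 2 + b ^ 4) by positivity), ← abs_mul]
        congr 1
        ring
      have h3 : 5 * |s ^ 4 - b ^ 8| ≤ |5 * s ^ 4 + y| := by
        rcases abs_cases y with ⟨hy, hy'⟩ | ⟨hy, hy'⟩
        · rw [hy] at h2
          rw [abs_of_nonneg (by positivity : 0 ≤ 5 * s ^ 4 + y), h2]
          have : |s ^ 4 - b ^ 8| ≤ s ^ 4 + b ^ 8 :=
            _root_.abs_le.mpr ⟨by nlinarith [pow_nonneg hs 4], by nlinarith [pow_pos (by linarith : 0 < b) 8]⟩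
          linarith
        · have : y = -(5 * b ^ 8) := by linarith
          rw [this, ← abs_of_pos (show (0 : ℝ) < 5 by norm_num), ← abs_mul,
            abs_of_pos (show (0 : ℝ) < 5 by norm_num)]
          exact le_of_eq (by congr 1; ring)
      refine le_trans ?_ h3
      rw [e]
      have : b ^ 6 ≤ (s + b ^ 2) * (s ^ 2 + b ^ 4) := by
        calc b ^ 6 = b ^ 2 * b ^ 4 := by ring
          _ ≤ _ := by gcongr <;> nlinarith [sq_nonneg s]
      nlinarith [mul_le_mul_of_nonneg_left this (abs_nonneg (s - b ^ 2)),
        mul_nonneg (abs_nonneg (s - b ^ 2)) (pow_nonneg (by linarith : 0 ≤ b) 6)]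
    rw [mul_pow, sq_abs] at key
    nlinarith [sq_nonneg (5 * s ^ 4 + y), pow_pos (by linarith : 0 < b) 6]

/-- Beyond `2b²` the term `σ⁴ ≥ 16b⁸` dominates `|y| ≤ 5b⁸`. -/
theorem StatScale.far_le (h : StatScale b y) {σ : ℝ} (hσ : 2 * b ^ 2 ≤ |σ|) :
    |σ| ^ 8 ≤ phaseWeight b y σ := by
  have hs : 0 ≤ |σ| := abs_nonneg σ
  have h4 : σ ^ 4 = |σ| ^ 4 := (Even.pow_abs (by decide) σ).symm
  unfold phaseWeight
  rw [h4]
  set s := |σ|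
  have hb := h.1
  have h1 : (2 * b ^ 2) ^ 4 ≤ s ^ 4 := pow_le_pow_left₀ (by positivity) hσ 4
  have hy := (_root_.abs_le.mp h.abs_le).1
  have h2 : s ^ 4 ≤ 5 * s ^ 4 + y := by
    have : (2 * b ^ 2) ^ 4 = 16 * b ^ 8 := by ring
    have : 0 ≤ s ^ 4 := by positivity
    linarith
  have h3 := pow_le_pow_left₀ (by positivity) h2 2
  nlinarith [pow_pos (by linarith : 0 < b) 6]

/-- A bump at the stationary points. -/
def statBump (b σ : ℝ) : ℝ := (1 + (b ^ 3 * (|σ| - b ^ 2)) ^ 2)⁻¹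

theorem statBump_nonneg (b σ : ℝ) : 0 ≤ statBump b σ := by unfold statBump; positivity

/-- The left side controls the error of the approximate antiderivative, `σ³` coming from the second
derivative of the phase. The bump on the right has integral of order `b⁻³`, the source of spatial
decay. -/
theorem StatScale.cube_div_le (h : StatScale b y) (σ : ℝ) :
    (|σ| ^ 3 + b ^ 6) / phaseWeight b y σ ≤ 18 * statBump b σ := by
  have hs : 0 ≤ |σ| := abs_nonneg σ
  have hW := h.weight_pos σ
  have hb := h.1
  unfold statBump
  rw [div_le_iff₀ hW, mul_assoc, mul_comm _ (phaseWeight b y σ), ← mul_assoc, ← div_eq_mul_inv,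
    le_div_iff₀ (by positivity)]
  rcases le_total |σ| (2 * b ^ 2) with hc | hc
  · have h1 := h.near_le σ
    have h2 := pow_le_pow_left₀ hs hc 3
    have h3 : |σ| ^ 3 + b ^ 6 ≤ 9 * b ^ 6 := by nlinarith
    calc _ ≤ 9 * b ^ 6 * (1 + (b ^ 3 * (|σ| - b ^ 2)) ^ 2) := by gcongr
      _ ≤ _ := by linarith
  · have h1 := h.far_le hc
    set s := |σ|
    have hb2 : 1 ≤ b ^ 2 := one_le_pow₀ hb
    have h2 := pow_le_pow_left₀ (by positivity) hc 3
    have h3 : b ^ 6 ≤ s ^ 3 := by nlinarith [pow_pos (by linarith : 0 < b) 6]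
    have h4 : (s - b ^ 2) ^ 2 ≤ s ^ 2 := by nlinarith
    have h5 : 1 ≤ s ^ 5 := one_le_pow₀ (by linarith)
    calc (s ^ 3 + b ^ 6) * (1 + (b ^ 3 * (s - b ^ 2)) ^ 2)
        = (s ^ 3 + b ^ 6) * (1 + b ^ 6 * (s - b ^ 2) ^ 2) := by ring
      _ ≤ (s ^ 3 + s ^ 3) * (s ^ 5 + s ^ 3 * s ^ 2) := by gcongr
      _ = 4 * s ^ 8 := by ring
      _ ≤ _ := by linarith

/-- For the integral representing `u_x`: an additional factor `σ` costs only the size `b²` of the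
stationary points, also in the tail. -/
theorem StatScale.mul_cube_div_le (h : StatScale b y) (σ : ℝ) :
    |σ| * (|σ| ^ 3 + b ^ 6) / phaseWeight b y σ ≤ 36 * b ^ 2 * statBump b σ := by
  have hs : 0 ≤ |σ| := abs_nonneg σ
  have hW := h.weight_pos σ
  have hb := h.1
  rcases le_total |σ| (2 * b ^ 2) with hc | hc
  · rw [mul_div_assoc]
    calc _ ≤ (2 * b ^ 2) * (18 * statBump b σ) :=
          mul_le_mul hc (h.cube_div_le σ) (by positivity) (by positivity)
      _ = _ := by ring
  · unfold statBump
    rw [div_le_iff₀ hW, mul_assoc, mul_comm _ (phaseWeight b y σ), ← mul_assoc, ← div_eq_mul_inv,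
      le_div_iff₀ (by positivity)]
    have h1 := h.far_le hc
    set s := |σ|
    have hb2 : 1 ≤ b ^ 2 := one_le_pow₀ hb
    have h2 := pow_le_pow_left₀ (by positivity) hc 3
    have h3 : b ^ 6 ≤ s ^ 3 := by nlinarith [pow_pos (by linarith : 0 < b) 6]
    have h4 : (s - b ^ 2) ^ 2 ≤ s ^ 2 := by nlinarith
    have h6 : b ^ 6 ≤ b ^ 2 * s ^ 2 := by
      calc b ^ 6 = b ^ 2 * (b ^ 2) ^ 2 := by ring
        _ ≤ _ := by gcongr; linarith
    have h5 : 1 ≤ b ^ 2 * s ^ 4 := one_le_mul_of_one_le_of_one_le hb2 (one_le_pow₀ (by linarith))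
    calc s * (s ^ 3 + b ^ 6) * (1 + (b ^ 3 * (s - b ^ 2)) ^ 2)
        = s * (s ^ 3 + b ^ 6) * (1 + b ^ 6 * (s - b ^ 2) ^ 2) := by ring
      _ ≤ s * (s ^ 3 + s ^ 3) * (b ^ 2 * s ^ 4 + b ^ 2 * s ^ 2 * s ^ 2) := by gcongr
      _ = 4 * b ^ 2 * s ^ 8 := by ring
      _ ≤ 36 * b ^ 2 * s ^ 8 := by gcongr; norm_num
      _ ≤ _ := by gcongr

/-- The integral of the right side does not depend on `b`. It handles the antiderivative itself,
which appears when the factor `σ` is differentiated. -/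
theorem StatScale.inv_sqrt_le (h : StatScale b y) (σ : ℝ) :
    (Real.sqrt (phaseWeight b y σ))⁻¹ ≤ 5 * ((b ^ 2)⁻¹ * (1 + ((b ^ 2)⁻¹ * σ) ^ 2)⁻¹) := by
  have hW := h.weight_pos σ
  have hb := h.1
  have hb2 : 1 ≤ b ^ 2 := one_le_pow₀ hb
  have hs : 0 ≤ |σ| := abs_nonneg σ
  rw [← mul_inv, ← div_eq_mul_inv, ← one_div,
    div_le_div_iff₀ (Real.sqrt_pos.mpr hW) (by positivity), one_mul, mul_pow, ← sq_abs σ]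
  have hinv : b ^ 2 * (1 + ((b ^ 2)⁻¹) ^ 2 * |σ| ^ 2) = b ^ 2 + |σ| / b ^ 2 * |σ| := by
    field_simp
  rw [hinv]
  rcases le_total |σ| (2 * b ^ 2) with hc | hc
  · have h1 : |σ| / b ^ 2 ≤ 2 := by rw [div_le_iff₀ (by positivity)]; exact hc
    have h2 : b ^ 2 ≤ Real.sqrt (phaseWeight b y σ) := by
      refine Real.le_sqrt_of_sq_le ?_
      unfold phaseWeight
      have : b ^ 4 ≤ b ^ 6 := pow_le_pow_right₀ hb (by norm_num)
      nlinarith [sq_nonneg (5 * σ ^ 4 + y)]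
    have h3 : |σ| / b ^ 2 * |σ| ≤ 2 * (2 * b ^ 2) := by gcongr
    linarith
  · have h1 : |σ| ^ 4 ≤ Real.sqrt (phaseWeight b y σ) :=
      Real.le_sqrt_of_sq_le (by rw [← pow_mul]; exact h.far_le hc)
    have h3 : |σ| / b ^ 2 ≤ |σ| := div_le_self hs hb2
    have h4 : |σ| / b ^ 2 * |σ| ≤ |σ| * |σ| := mul_le_mul_of_nonneg_right h3 hs
    have h5 : 1 ≤ |σ| := by linarith
    have h6 : |σ| ^ 2 ≤ |σ| ^ 4 := pow_le_pow_right₀ h5 (by norm_num)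
    have h7 : |σ| ^ 1 ≤ |σ| ^ 4 := pow_le_pow_right₀ h5 (by norm_num)
    nlinarith

theorem integrable_bump_shift {r A : ℝ} (hr : 0 < r) (hA : 0 < A) (c : ℝ) :
    Integrable (fun η : ℝ => (1 + (r * (A * η - c)) ^ 2)⁻¹) ∧
      ∫ η : ℝ, (1 + (r * (A * η - c)) ^ 2)⁻¹ = Real.pi / (r * A) := by
  have hrA : 0 < r * A := mul_pos hr hA
  have e : (fun η : ℝ => (1 + (r * (A * η - c)) ^ 2)⁻¹)
      = fun η => (fun z => (1 + (r * A * z) ^ 2)⁻¹) (η - c / A) := by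
    funext η
    simp only
    congr 3
    field_simp
  rw [e]
  exact ⟨(integrable_inv_one_add_sq_mul hrA).comp_sub_right _,
    (integral_sub_right_eq_self (fun z => (1 + (r * A * z) ^ 2)⁻¹) (c / A)).trans
      (integral_inv_one_add_sq_mul hrA)⟩

theorem statBump_le (b σ : ℝ) : statBump b σ ≤ (1 + (b ^ 3 * (σ - b ^ 2)) ^ 2)⁻¹
    + (1 + (b ^ 3 * (σ - -b ^ 2)) ^ 2)⁻¹ := by
  unfold statBump
  rcases abs_cases σ with ⟨h, -⟩ | ⟨h, -⟩ <;> rw [h]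
  · have : 0 ≤ (1 + (b ^ 3 * (σ - -b ^ 2)) ^ 2)⁻¹ := by positivity
    linarith
  · have e : (b ^ 3 * (-σ - b ^ 2)) ^ 2 = (b ^ 3 * (σ - -b ^ 2)) ^ 2 := by ring
    rw [e]
    have : 0 ≤ (1 + (b ^ 3 * (σ - b ^ 2)) ^ 2)⁻¹ := by positivity
    linarith

theorem continuous_statBump (b : ℝ) : Continuous (statBump b) := by
  unfold statBump
  exact Continuous.inv₀ (by fun_prop) fun σ => by positivity

theorem integrable_statBump {A : ℝ} (hb : 1 ≤ b) (hA : 0 < A) :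
    Integrable (fun η => statBump b (A * η)) ∧
      ∫ η, statBump b (A * η) ≤ 2 * Real.pi / (b ^ 3 * A) := by
  have hb3 : 0 < b ^ 3 := by positivity
  obtain ⟨i1, e1⟩ := integrable_bump_shift hb3 hA (b ^ 2)
  obtain ⟨i2, e2⟩ := integrable_bump_shift hb3 hA (-b ^ 2)
  have hi : Integrable (fun η => statBump b (A * η)) := by
    refine (i1.add i2).mono' (((continuous_statBump b).comp (continuous_const.mul
      continuous_id)).aestronglyMeasurable) (.of_forall fun η => ?_)
    rw [Real.norm_of_nonneg (statBump_nonneg _ _)]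
    exact statBump_le b _
  refine ⟨hi, (integral_mono hi (i1.add i2) fun η => statBump_le b _).trans (le_of_eq ?_)⟩
  simp only [Pi.add_apply]
  rw [integral_add i1 i2, e1, e2]
  ring

/-! ### Integration by parts against oscillating functions -/

/-- Integration by parts, without decay of the second factor. -/
theorem WD.integral_mul_of_growth {g d : L2} (h : WD g d) {Ψ Ψ' : ℝ → ℂ} (hΨ : MemLp Ψ 2)
    (hd : ∀ x, HasDerivAt Ψ (Ψ' x) x) (hm : Continuous Ψ') {C : ℝ}
    (hC : ∀ x, ‖Ψ' x‖ ≤ C * (1 + |x|)) (hi : Integrable fun x => g x * Ψ' x) :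
    ∫ x, g x * Ψ' x = -∫ x, d x * Ψ x := by
  have hC0 : 0 ≤ C := by have := (norm_nonneg _).trans (hC 0); simpa using this
  -- Lorentzian cutoffs: one factor makes a linearly growing function square integrable, and their
  -- derivatives are bounded by `1/(n+1)`.
  set q : ℕ → ℝ → ℝ := fun n x => (1 + ((n + 1 : ℝ)⁻¹ * x) ^ 2)⁻¹ with hq
  set q' : ℕ → ℝ → ℝ := fun n x => -(2 * (n + 1 : ℝ)⁻¹ * ((n + 1 : ℝ)⁻¹ * x)) * q n x ^ 2 with hq'
  have hqd : ∀ n x, HasDerivAt (q n) (q' n x) x := by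
    intro n x
    have h1 : HasDerivAt (fun x => 1 + ((n + 1 : ℝ)⁻¹ * x) ^ 2)
        (2 * (n + 1 : ℝ)⁻¹ * ((n + 1 : ℝ)⁻¹ * x)) x := by
      refine ((((hasDerivAt_id x).const_mul ((n + 1 : ℝ)⁻¹)).pow 2).const_add 1).congr_deriv ?_
      simp only [id]
      push_cast
      ring
    refine (h1.inv (by positivity)).congr_deriv ?_
    simp only [hq', hq]
    field_simp
  have hq0 : ∀ n x, 0 ≤ q n x := fun n x => by simp only [hq]; positivity
  have hq1 : ∀ n x, q n x ≤ 1 := fun n x => by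
    simp only [hq]
    exact inv_le_one_of_one_le₀ (by nlinarith [sq_nonneg ((n + 1 : ℝ)⁻¹ * x)])
  have hqc : ∀ n, Continuous (q n) := fun n =>
    continuous_iff_continuousAt.mpr fun x => (hqd n x).continuousAt
  have hq'c : ∀ n, Continuous (q' n) := fun n => by
    simp only [hq']
    have := hqc n
    fun_prop
  have hq'b : ∀ n x, |q' n x| ≤ (n + 1 : ℝ)⁻¹ := by
    intro n x
    have hn : (0 : ℝ) ≤ (n + 1 : ℝ)⁻¹ := by positivity
    have h1 : |2 * ((n + 1 : ℝ)⁻¹ * x)| * q n x ≤ 1 := by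
      simp only [hq]
      rw [← div_eq_mul_inv, div_le_one (by positivity), _root_.abs_le]
      constructor <;> nlinarith [sq_nonneg ((n + 1 : ℝ)⁻¹ * x - 1), sq_nonneg ((n + 1 : ℝ)⁻¹ * x + 1)]
    have e : q' n x = -((n + 1 : ℝ)⁻¹ * ((2 * ((n + 1 : ℝ)⁻¹ * x)) * q n x) * q n x) := by
      simp only [hq']; ring
    rw [e, abs_neg, abs_mul, abs_mul, abs_mul, abs_of_nonneg (hq0 n x), abs_of_nonneg hn]
    calc _ ≤ (n + 1 : ℝ)⁻¹ * 1 * 1 := by gcongr; exact hq1 n x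
      _ = _ := by ring
  have hqlim : ∀ x, Tendsto (fun n => q n x) atTop (𝓝 1) := by
    intro x
    have h1 : Tendsto (fun n : ℕ => (n + 1 : ℝ)⁻¹) atTop (𝓝 0) := by
      simpa using tendsto_one_div_add_atTop_nhds_zero_nat (𝕜 := ℝ)
    have h2 : Tendsto (fun n : ℕ => (1 + ((n + 1 : ℝ)⁻¹ * x) ^ 2)⁻¹) atTop
        (𝓝 (1 + (0 * x) ^ 2)⁻¹) :=
      Tendsto.inv₀ (((h1.mul_const x).pow 2).const_add 1) (by positivity)
    simpa using h2
  have hqΨ : ∀ n, MemLp (fun x => (q n x : ℂ) * Ψ x) 2 := fun n =>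
    memLp_mul_of_bound (C := 1) (Complex.continuous_ofReal.comp (hqc n)).aestronglyMeasurable
      (fun x => by rw [Complex.norm_real, Real.norm_of_nonneg (hq0 n x)]; exact hq1 n x) hΨ
  have hq'Ψ : ∀ n, MemLp (fun x => (q' n x : ℂ) * Ψ x) 2 := fun n =>
    memLp_mul_of_bound (Complex.continuous_ofReal.comp (hq'c n)).aestronglyMeasurable
      (fun x => by rw [Complex.norm_real]; exact hq'b n x) hΨ
  have hqΨ' : ∀ n, MemLp (fun x => (q n x : ℂ) * Ψ' x) 2 := by
    intro n
    have hc : Continuous fun x => (q n x : ℂ) * Ψ' x :=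
      (Complex.continuous_ofReal.comp (hqc n)).mul hm
    rw [← memLp_norm_iff hc.aestronglyMeasurable]
    rw [memLp_two_iff_integrable_sq hc.norm.aestronglyMeasurable]
    have hr : (0 : ℝ) < (n + 1 : ℝ)⁻¹ := by positivity
    refine ((integrable_inv_one_add_sq_mul hr).const_mul (C ^ 2 * (2 * (n + 1) ^ 2))).mono'
      (hc.norm.pow 2).aestronglyMeasurable (.of_forall fun x => ?_)
    rw [Real.norm_of_nonneg (by positivity), norm_mul, Complex.norm_real,
      Real.norm_of_nonneg (hq0 n x)]
    have h1 : (1 + |x|) ^ 2 * q n x ≤ 2 * (n + 1) ^ 2 := by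
      simp only [hq]
      rw [← div_eq_mul_inv, div_le_iff₀ (by positivity), mul_pow, ← sq_abs x]
      have hn : (1 : ℝ) ≤ (n + 1) ^ 2 := one_le_pow₀ (by linarith [n.cast_nonneg (α := ℝ)])
      have : ((n : ℝ) + 1) ^ 2 * (((n : ℝ) + 1)⁻¹ ^ 2 * |x| ^ 2) = |x| ^ 2 := by field_simp
      nlinarith [sq_nonneg (|x| - 1)]
    calc (q n x * ‖Ψ' x‖) ^ 2 ≤ (q n x * (C * (1 + |x|))) ^ 2 := by
          gcongr
          exact hC x
      _ = C ^ 2 * ((1 + |x|) ^ 2 * q n x) * q n x := by ring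
      _ ≤ C ^ 2 * (2 * (n + 1) ^ 2) * q n x := by gcongr
  have hibp : ∀ n, ∫ x, g x * ((q n x : ℂ) * Ψ' x + (q' n x : ℂ) * Ψ x)
      = -∫ x, d x * ((q n x : ℂ) * Ψ x) := fun n =>
    h.integral_mul_of_hasDerivAt (hqΨ n) ((hqΨ' n).add (hq'Ψ n)) fun x => by
      refine ((hqd n x).ofReal_comp.mul (hd x)).congr_deriv ?_
      ring
  have hgΨ : Integrable fun x => g x * Ψ x := (Lp.memLp g).integrable_mul hΨ
  have hdΨ : Integrable fun x => d x * Ψ x := (Lp.memLp d).integrable_mul hΨ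
  have l1 : Tendsto (fun n => ∫ x, g x * ((q n x : ℂ) * Ψ' x + (q' n x : ℂ) * Ψ x)) atTop
      (𝓝 (∫ x, g x * Ψ' x)) := by
    refine tendsto_integral_of_dominated_convergence
      (fun x => ‖g x * Ψ' x‖ + ‖g x * Ψ x‖) (fun n => ?_) (hi.norm.add hgΨ.norm)
      (fun n => .of_forall fun x => ?_) (.of_forall fun x => ?_)
    · exact (Lp.aestronglyMeasurable g).mul ((hqΨ' n).add (hq'Ψ n)).1
    · rw [mul_add]
      refine (norm_add_le _ _).trans (add_le_add ?_ ?_)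
      · rw [norm_mul, norm_mul, norm_mul, Complex.norm_real, Real.norm_of_nonneg (hq0 n x)]
        gcongr
        exact mul_le_of_le_one_left (norm_nonneg _) (hq1 n x)
      · rw [norm_mul, norm_mul, norm_mul, Complex.norm_real]
        gcongr
        exact mul_le_of_le_one_left (norm_nonneg _) ((hq'b n x).trans
          (inv_le_one_of_one_le₀ (by linarith [n.cast_nonneg (α := ℝ)])))
    · have h1 : Tendsto (fun n => (q n x : ℂ)) atTop (𝓝 ((1 : ℝ) : ℂ)) :=
        (Complex.continuous_ofReal.tendsto 1).comp (hqlim x)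
      have h2 : Tendsto (fun n => (q' n x : ℂ)) atTop (𝓝 ((0 : ℝ) : ℂ)) := by
        have h3 : Tendsto (fun n : ℕ => (n + 1 : ℝ)⁻¹) atTop (𝓝 0) := by
          simpa using tendsto_one_div_add_atTop_nhds_zero_nat (𝕜 := ℝ)
        exact (Complex.continuous_ofReal.tendsto 0).comp
          (squeeze_zero_norm (a := fun n : ℕ => (n + 1 : ℝ)⁻¹) (fun n => hq'b n x) h3)
      simpa using ((h1.mul_const (Ψ' x)).add (h2.mul_const (Ψ x))).const_mul (g x)
  have l2 : Tendsto (fun n => -∫ x, d x * ((q n x : ℂ) * Ψ x)) atTop (𝓝 (-∫ x, d x * Ψ x)) := by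
    refine (tendsto_integral_of_dominated_convergence (fun x => ‖d x * Ψ x‖) (fun n => ?_)
      hdΨ.norm (fun n => .of_forall fun x => ?_) (.of_forall fun x => ?_)).neg
    · exact (Lp.aestronglyMeasurable d).mul (hqΨ n).1
    · rw [norm_mul, norm_mul, norm_mul, Complex.norm_real, Real.norm_of_nonneg (hq0 n x)]
      gcongr
      exact mul_le_of_le_one_left (norm_nonneg _) (hq1 n x)
    · have h1 : Tendsto (fun n => (q n x : ℂ)) atTop (𝓝 ((1 : ℝ) : ℂ)) :=
        (Complex.continuous_ofReal.tendsto 1).comp (hqlim x)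
      simpa using (h1.mul_const (Ψ x)).const_mul (d x)
  refine tendsto_nhds_unique l1 (l2.congr fun n => (hibp n).symm)

end

section

variable {b y : ℝ}

/-- The oscillating factor `e^{i(σ⁵ + yσ)}`. -/
def osc (y σ : ℝ) : ℂ := Complex.exp (Complex.I * ((σ ^ 5 + y * σ : ℝ) : ℂ))

/-- An approximate antiderivative of `osc`. -/
def oscPrim (b y σ : ℝ) : ℂ :=
  -Complex.I * (((5 * σ ^ 4 + y) / phaseWeight b y σ : ℝ) : ℂ) * osc y σ

/-- The relative error of `oscPrim`. -/
def oscErr (b y σ : ℝ) : ℂ :=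
  ((b ^ 6 / phaseWeight b y σ : ℝ) : ℂ) + Complex.I *
    ((20 * σ ^ 3 * (b ^ 6 - (5 * σ ^ 4 + y) ^ 2) / phaseWeight b y σ ^ 2 : ℝ) : ℂ)

theorem norm_osc (y σ : ℝ) : ‖osc y σ‖ = 1 := by
  rw [osc, mul_comm, Complex.norm_exp_ofReal_mul_I]

theorem continuous_osc (y : ℝ) : Continuous (osc y) := by unfold osc; fun_prop

theorem continuous_phaseWeight (b y : ℝ) : Continuous (phaseWeight b y) := by
  unfold phaseWeight; fun_prop

theorem StatScale.continuous_oscPrim (h : StatScale b y) : Continuous (oscPrim b y) := by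
  unfold oscPrim
  refine (continuous_const.mul (Complex.continuous_ofReal.comp (Continuous.div (by fun_prop)
    (continuous_phaseWeight b y) fun σ => (h.weight_pos σ).ne'))).mul (continuous_osc y)

theorem StatScale.continuous_oscErr (h : StatScale b y) : Continuous (oscErr b y) := by
  unfold oscErr
  have hW := continuous_phaseWeight b y
  refine (Complex.continuous_ofReal.comp (Continuous.div (by fun_prop) hW
    fun σ => (h.weight_pos σ).ne')).add (continuous_const.mul (Complex.continuous_ofReal.comp
    (Continuous.div (by fun_prop) (hW.pow 2) fun σ => (pow_pos (h.weight_pos σ) 2).ne')))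

/-- With `θ` the phase, the usual `e^{iθ}/(iθ')` is replaced by `-iθ'e^{iθ}/(θ'² + b⁶)`, which is
regular everywhere. The error is concentrated at the stationary points, so no splitting of the
integral into regions is needed. -/
theorem StatScale.hasDerivAt_oscPrim (h : StatScale b y) (σ : ℝ) :
    HasDerivAt (oscPrim b y) (osc y σ - oscErr b y σ * osc y σ) σ := by
  have hW := (h.weight_pos σ).ne'
  have hd : HasDerivAt (fun σ : ℝ => 5 * σ ^ 4 + y) (20 * σ ^ 3) σ := by
    refine (((hasDerivAt_pow 4 σ).const_mul 5).add_const y).congr_deriv ?_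
    push_cast; ring
  have hw : HasDerivAt (phaseWeight b y) (2 * (5 * σ ^ 4 + y) * (20 * σ ^ 3)) σ := by
    refine ((hd.pow 2).add_const (b ^ 6)).congr_deriv ?_
    push_cast; ring
  have ho : HasDerivAt (osc y) (osc y σ * (Complex.I * ((5 * σ ^ 4 + y : ℝ) : ℂ))) σ := by
    have h1 : HasDerivAt (fun σ : ℝ => σ ^ 5 + y * σ) (5 * σ ^ 4 + y) σ := by
      refine ((hasDerivAt_pow 5 σ).add ((hasDerivAt_id σ).const_mul y)).congr_deriv ?_
      push_cast; ring
    exact (h1.ofReal_comp.const_mul Complex.I).cexp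
  refine ((((hd.div hw hW).ofReal_comp).const_mul (-Complex.I)).mul ho).congr_deriv ?_
  have hWc : (phaseWeight b y σ : ℂ) ≠ 0 := by exact_mod_cast hW
  have hWd : (phaseWeight b y σ : ℂ) = (5 * σ ^ 4 + y) ^ 2 + b ^ 6 := by
    unfold phaseWeight; push_cast; ring
  unfold oscErr
  simp only [Pi.div_apply]
  push_cast
  field_simp
  rw [hWd]
  ring_nf
  simp only [Complex.I_sq]
  ring

theorem StatScale.norm_oscPrim_le (h : StatScale b y) (σ : ℝ) :
    ‖oscPrim b y σ‖ ≤ (Real.sqrt (phaseWeight b y σ))⁻¹ := by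
  have hW := h.weight_pos σ
  have hb := h.1
  rw [oscPrim, norm_mul, norm_osc, mul_one, norm_mul, norm_neg, Complex.norm_I, one_mul,
    Complex.norm_real, Real.norm_eq_abs, abs_div, abs_of_pos hW, ← one_div,
    div_le_div_iff₀ hW (Real.sqrt_pos.mpr hW), one_mul]
  have : |5 * σ ^ 4 + y| ≤ Real.sqrt (phaseWeight b y σ) := by
    refine Real.abs_le_sqrt ?_
    unfold phaseWeight
    nlinarith [pow_pos (by linarith : 0 < b) 6]
  calc _ ≤ Real.sqrt (phaseWeight b y σ) * Real.sqrt (phaseWeight b y σ) := by gcongr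
    _ = _ := Real.mul_self_sqrt hW.le

theorem StatScale.norm_oscPrim_sq_le (h : StatScale b y) (σ : ℝ) :
    ‖oscPrim b y σ‖ ^ 2 ≤ (phaseWeight b y σ)⁻¹ := by
  refine (pow_le_pow_left₀ (norm_nonneg _) (h.norm_oscPrim_le σ) 2).trans (le_of_eq ?_)
  rw [inv_pow, Real.sq_sqrt (h.weight_pos σ).le]

theorem StatScale.norm_oscErr_le (h : StatScale b y) (σ : ℝ) :
    ‖oscErr b y σ‖ ≤ 20 * ((|σ| ^ 3 + b ^ 6) / phaseWeight b y σ) := by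
  have hW := h.weight_pos σ
  have hb := h.1
  have hb6 : 0 < b ^ 6 := by positivity
  have h1 : |b ^ 6 - (5 * σ ^ 4 + y) ^ 2| ≤ phaseWeight b y σ := by
    unfold phaseWeight
    rw [_root_.abs_le]
    constructor <;> nlinarith [sq_nonneg (5 * σ ^ 4 + y)]
  refine (norm_add_le _ _).trans ?_
  rw [norm_mul, Complex.norm_I, one_mul, Complex.norm_real, Complex.norm_real, Real.norm_eq_abs,
    Real.norm_eq_abs, abs_div, abs_div, abs_mul, abs_mul, abs_of_pos hW, abs_of_pos hb6,
    abs_of_pos (pow_pos hW 2), abs_pow, abs_of_pos (by norm_num : (0 : ℝ) < 20)]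
  have h2 : 20 * |σ| ^ 3 * |b ^ 6 - (5 * σ ^ 4 + y) ^ 2| / phaseWeight b y σ ^ 2
      ≤ 20 * |σ| ^ 3 / phaseWeight b y σ := by
    rw [div_le_div_iff₀ (by positivity) hW, sq (phaseWeight b y σ), ← mul_assoc]
    gcongr
  have h3 : b ^ 6 / phaseWeight b y σ ≤ 20 * b ^ 6 / phaseWeight b y σ := by
    gcongr; linarith
  calc _ ≤ 20 * b ^ 6 / phaseWeight b y σ + 20 * |σ| ^ 3 / phaseWeight b y σ := add_le_add h3 h2
    _ = _ := by ring

/-! ### Bounds for oscillatory integrals -/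

theorem norm_integral_mul_le_of_sq {d : L2} {Ψ : ℝ → ℂ} (hc : Continuous Ψ) {P : ℝ → ℝ}
    (hP : Integrable P) (hΨ : ∀ x, ‖Ψ x‖ ^ 2 ≤ P x) {K : ℝ} (hK : 0 ≤ K)
    (hPK : ∫ x, P x ≤ K ^ 2) : MemLp Ψ 2 ∧ ‖∫ x, d x * Ψ x‖ ≤ ‖d‖ * K := by
  have hi : Integrable fun x => ‖Ψ x‖ ^ 2 := by
    refine hP.mono' (hc.norm.pow 2).aestronglyMeasurable (.of_forall fun x => ?_)
    rw [Real.norm_of_nonneg (by positivity)]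
    exact hΨ x
  have hm : MemLp Ψ 2 := by
    rw [← memLp_norm_iff hc.aestronglyMeasurable,
      memLp_two_iff_integrable_sq hc.norm.aestronglyMeasurable]
    exact hi
  refine ⟨hm, ?_⟩
  have e : ∫ x, d x * Ψ x = ∫ x, d x * (hm.toLp Ψ : L2) x := by
    refine integral_congr_ae ?_
    filter_upwards [hm.coeFn_toLp] with x hx
    rw [hx]
  have hn : ‖(hm.toLp Ψ : L2)‖ ≤ K := by
    refine (sq_le_sq₀ (norm_nonneg _) hK).mp ?_
    rw [norm_sq_eq_integral]
    refine le_trans (le_of_eq (integral_congr_ae ?_)) ((integral_mono hi hP hΨ).trans hPK)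
    filter_upwards [hm.coeFn_toLp] with x hx
    rw [hx]
  rw [e]
  exact (norm_integral_mul_le _ _).trans (by gcongr)

/-- Write `F = Ψ' + R`. Integration by parts and Cauchy–Schwarz treat `Ψ'` using `d` in `L²`; the
`L^∞` bound on `g` and the `L¹` bound on `R` treat the rest. -/
theorem WD.norm_integral_mul_osc_le {g d : L2} (h : WD g d) (hg : Integrable g)
    (hg1 : Integrable fun η => |η| * ‖g η‖) {c : ℝ} (hc : ∀ᵐ η, ‖g η‖ ≤ c) {Ψ F R : ℝ → ℂ}
    (hF : Continuous F) (hR : Continuous R) (hd : ∀ η, HasDerivAt Ψ (F η - R η) η) {P B : ℝ → ℝ}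
    (hP : Integrable P) (hΨ : ∀ η, ‖Ψ η‖ ^ 2 ≤ P η) {K L C : ℝ} (hK : 0 ≤ K)
    (hPK : ∫ η, P η ≤ K ^ 2) (hB : Integrable B) (hRB : ∀ η, ‖R η‖ ≤ B η) (hBL : ∫ η, B η ≤ L)
    (hFC : ∀ η, ‖F η‖ ≤ C * (1 + |η|)) (hRC : ∀ η, ‖R η‖ ≤ C * (1 + |η|)) :
    ‖∫ η, g η * F η‖ ≤ ‖d‖ * K + c * L := by
  have hc0 : 0 ≤ c := by
    obtain ⟨η, hη⟩ := hc.exists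
    exact (norm_nonneg _).trans hη
  have hgrow : ∀ {m : ℝ → ℂ}, Continuous m → (∀ η, ‖m η‖ ≤ C * (1 + |η|)) →
      Integrable fun η => g η * m η := by
    intro m hm hmC
    refine ((hg.norm.add hg1).const_mul C).mono'
      ((Lp.aestronglyMeasurable g).mul hm.aestronglyMeasurable) (.of_forall fun η => ?_)
    rw [norm_mul]
    calc ‖g η‖ * ‖m η‖ ≤ ‖g η‖ * (C * (1 + |η|)) := by gcongr; exact hmC η
      _ = _ := by simp only [Pi.add_apply]; ring
  have hiF := hgrow hF hFC
  have hiR := hgrow hR hRC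
  have hcΨ : Continuous Ψ := continuous_iff_continuousAt.mpr fun η => (hd η).continuousAt
  obtain ⟨hm, hb⟩ := norm_integral_mul_le_of_sq (d := d) hcΨ hP hΨ hK hPK
  have hibp := h.integral_mul_of_growth hm hd (hF.sub hR) (C := C + C)
    (fun η => (norm_sub_le _ _).trans (by rw [add_mul]; exact add_le_add (hFC η) (hRC η)))
    (by simp_rw [mul_sub]; exact hiF.sub hiR)
  simp_rw [mul_sub] at hibp
  rw [integral_sub hiF hiR, sub_eq_iff_eq_add] at hibp
  rw [hibp]
  refine (norm_add_le _ _).trans (add_le_add (by rwa [norm_neg]) ?_)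
  refine (norm_integral_le_of_norm_le (hB.const_mul c) ?_).trans ?_
  · filter_upwards [hc] with η hη
    rw [norm_mul]
    exact mul_le_mul hη (hRB η) (norm_nonneg _) hc0
  · rw [integral_const_mul]
    gcongr

theorem statBump_le_one (b σ : ℝ) : statBump b σ ≤ 1 :=
  inv_le_one_of_one_le₀ (by nlinarith [sq_nonneg (b ^ 3 * (|σ| - b ^ 2))])

theorem integral_statBump_le {A α : ℝ} (hb : 1 ≤ b) (hα : 0 < α) (hA : α ^ 2 ≤ A) :
    ∫ η, statBump b (A * η) ≤ 8 / (b ^ 3 * α ^ 2) := by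
  have hA0 : 0 < A := lt_of_lt_of_le (by positivity) hA
  refine (integrable_statBump hb hA0).2.trans ?_
  have : 2 * Real.pi ≤ 8 := by linarith [Real.pi_le_four]
  gcongr

/-- The bump has integral at most `8/(b³α²)`, whence `2880 = 360 · 8` for the error. The squared
`L²` norm of the antiderivative is at most `18 · 8/(b⁶α⁶)`, whence `12`. -/
theorem StatScale.norm_integral_osc_le (hs : StatScale b y) {g d : L2} (h : WD g d)
    (hg : Integrable g) (hg1 : Integrable fun η => |η| * ‖g η‖) {c : ℝ} (hc : ∀ᵐ η, ‖g η‖ ≤ c)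
    {A α : ℝ} (hα : 0 < α) (hA : α ^ 2 ≤ A) :
    ‖∫ η, g η * osc y (A * η)‖ ≤ ‖d‖ * (12 / (b ^ 3 * α ^ 3)) + c * (2880 / (b ^ 3 * α ^ 2)) := by
  have hb := hs.1
  have hA0 : 0 < A := lt_of_lt_of_le (by positivity) hA
  have hi := (integrable_statBump hb hA0).1
  have hI := integral_statBump_le hb hα hA
  have hmul : Continuous fun η : ℝ => A * η := by fun_prop
  have hosc := (continuous_osc y).comp hmul
  have hE : ∀ σ, ‖oscErr b y σ‖ ≤ 360 * statBump b σ := fun σ =>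
    (hs.norm_oscErr_le σ).trans (by linarith [hs.cube_div_le σ])
  refine h.norm_integral_mul_osc_le hg hg1 hc (Ψ := fun η => (A : ℂ)⁻¹ * oscPrim b y (A * η))
    (F := fun η => osc y (A * η)) (R := fun η => oscErr b y (A * η) * osc y (A * η))
    (P := fun η => A⁻¹ ^ 2 * (18 * (b ^ 6)⁻¹) * statBump b (A * η))
    (B := fun η => 360 * statBump b (A * η)) (C := 360) hosc
    ((hs.continuous_oscErr.comp hmul).mul hosc) (fun η => ?_) (hi.const_mul _) (fun η => ?_)
    (by positivity) ?_ (hi.const_mul _) (fun η => ?_) ?_ (fun η => ?_) (fun η => ?_)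
  · have h1 : HasDerivAt (fun η : ℝ => A * η) A η := by
      simpa using (hasDerivAt_id η).const_mul A
    refine (((hs.hasDerivAt_oscPrim (A * η)).scomp η h1).const_mul ((A : ℂ)⁻¹)).congr_deriv ?_
    have : (A : ℂ) ≠ 0 := by exact_mod_cast hA0.ne'
    rw [Complex.real_smul]
    field_simp
  · rw [norm_mul, mul_pow, norm_inv, Complex.norm_real, Real.norm_of_nonneg hA0.le, mul_assoc]
    refine mul_le_mul_of_nonneg_left ((hs.norm_oscPrim_sq_le _).trans ?_) (by positivity)
    have h1 := hs.cube_div_le (A * η)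
    have hW := hs.weight_pos (A * η)
    have h2 : b ^ 6 / phaseWeight b y (A * η) ≤ 18 * statBump b (A * η) := by
      refine le_trans ?_ h1
      gcongr
      have : 0 ≤ |A * η| ^ 3 := by positivity
      linarith
    calc (phaseWeight b y (A * η))⁻¹ = (b ^ 6)⁻¹ * (b ^ 6 / phaseWeight b y (A * η)) := by
          field_simp
      _ ≤ (b ^ 6)⁻¹ * (18 * statBump b (A * η)) := by gcongr
      _ = _ := by ring
  · rw [integral_const_mul]
    have h1 : A⁻¹ ^ 2 ≤ (α ^ 2)⁻¹ ^ 2 := by gcongr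
    have h2 : (b ^ 3)⁻¹ ≤ 1 := inv_le_one_of_one_le₀ (one_le_pow₀ hb)
    calc A⁻¹ ^ 2 * (18 * (b ^ 6)⁻¹) * ∫ η, statBump b (A * η)
        ≤ (α ^ 2)⁻¹ ^ 2 * (18 * (b ^ 6)⁻¹) * (8 / (b ^ 3 * α ^ 2)) := by
          gcongr
          exact integral_nonneg fun η => statBump_nonneg _ _
      _ = 144 * (α ^ 6)⁻¹ * (b ^ 6)⁻¹ * (b ^ 3)⁻¹ := by field_simp; norm_num
      _ ≤ 144 * (α ^ 6)⁻¹ * (b ^ 6)⁻¹ * 1 := by gcongr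
      _ = (12 / (b ^ 3 * α ^ 3)) ^ 2 := by field_simp; norm_num
  · rw [norm_mul, norm_osc, mul_one]
    exact hE _
  · rw [integral_const_mul]
    calc _ ≤ 360 * (8 / (b ^ 3 * α ^ 2)) := by gcongr
      _ = _ := by ring
  · rw [norm_osc]
    nlinarith [abs_nonneg η]
  · rw [norm_mul, norm_osc, mul_one]
    have := statBump_le_one b (A * η)
    nlinarith [hE (A * η), abs_nonneg η]

/-- The antiderivative is now `η * oscPrim`. Its derivative produces `oscPrim` as a second error
term, integrable uniformly in `b`; the factor `σ` uses up the decay in `b`. -/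
theorem StatScale.norm_integral_mul_osc_le (hs : StatScale b y) {g d : L2} (h : WD g d)
    (hg : Integrable g) (hg1 : Integrable fun η => |η| * ‖g η‖) {c : ℝ} (hc : ∀ᵐ η, ‖g η‖ ≤ c)
    {A α : ℝ} (hα : 0 < α) (hA : α ^ 2 ≤ A) :
    ‖∫ η, g η * ((A * η : ℝ) * osc y (A * η))‖ ≤ ‖d‖ * (17 / α ^ 3) + c * (5780 / α ^ 2) := by
  have hb := hs.1
  have hA0 : 0 < A := lt_of_lt_of_le (by positivity) hA
  have hi := (integrable_statBump hb hA0).1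
  have hI := integral_statBump_le hb hα hA
  obtain ⟨hi2, hI2⟩ := integrable_bump_shift (r := (b ^ 2)⁻¹) (by positivity) hA0 0
  simp only [sub_zero] at hi2 hI2
  have hmul : Continuous fun η : ℝ => A * η := by fun_prop
  have hmulc : Continuous fun η : ℝ => ((A * η : ℝ) : ℂ) := by fun_prop
  have hosc := (continuous_osc y).comp hmul
  have hE : ∀ σ, ‖oscErr b y σ‖ ≤ 360 * statBump b σ := fun σ =>
    (hs.norm_oscErr_le σ).trans (by linarith [hs.cube_div_le σ])
  have hE' : ∀ σ, |σ| * ‖oscErr b y σ‖ ≤ 720 * b ^ 2 * statBump b σ := fun σ => by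
    have h1 := mul_le_mul_of_nonneg_left (hs.norm_oscErr_le σ) (abs_nonneg σ)
    have h2 := hs.mul_cube_div_le σ
    have e : |σ| * (20 * ((|σ| ^ 3 + b ^ 6) / phaseWeight b y σ))
        = 20 * (|σ| * (|σ| ^ 3 + b ^ 6) / phaseWeight b y σ) := by ring
    linarith
  have hpr : ∀ σ, ‖oscPrim b y σ‖ ≤ 5 * ((b ^ 2)⁻¹ * (1 + ((b ^ 2)⁻¹ * σ) ^ 2)⁻¹) := fun σ =>
    (hs.norm_oscPrim_le σ).trans (hs.inv_sqrt_le σ)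
  have hpr5 : ∀ σ, ‖oscPrim b y σ‖ ≤ 5 := fun σ => (hpr σ).trans (by
    have h1 : (b ^ 2)⁻¹ ≤ 1 := inv_le_one_of_one_le₀ (one_le_pow₀ hb)
    have h2 : (1 + ((b ^ 2)⁻¹ * σ) ^ 2)⁻¹ ≤ 1 :=
      inv_le_one_of_one_le₀ (by nlinarith [sq_nonneg ((b ^ 2)⁻¹ * σ)])
    have := mul_le_one₀ h1 (by positivity) h2
    linarith)
  have hb1 : b⁻¹ ≤ 1 := inv_le_one_of_one_le₀ hb
  refine h.norm_integral_mul_osc_le hg hg1 hc (Ψ := fun η => (η : ℂ) * oscPrim b y (A * η))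
    (F := fun η => ((A * η : ℝ) : ℂ) * osc y (A * η))
    (R := fun η => ((A * η : ℝ) : ℂ) * (oscErr b y (A * η) * osc y (A * η)) - oscPrim b y (A * η))
    (P := fun η => A⁻¹ ^ 2 * (36 * b ^ 2) * statBump b (A * η))
    (B := fun η => 720 * b ^ 2 * statBump b (A * η)
      + 5 * (b ^ 2)⁻¹ * (1 + ((b ^ 2)⁻¹ * (A * η)) ^ 2)⁻¹) (C := 360 * A + 5)
    (hmulc.mul hosc)
    ((hmulc.mul ((hs.continuous_oscErr.comp hmul).mul hosc)).sub (hs.continuous_oscPrim.comp hmul))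
    (fun η => ?_) (hi.const_mul _) (fun η => ?_)
    (by positivity) ?_ ((hi.const_mul _).add (hi2.const_mul _)) (fun η => ?_) ?_ (fun η => ?_)
    (fun η => ?_)
  · have h1 : HasDerivAt (fun η : ℝ => A * η) A η := by
      simpa using (hasDerivAt_id η).const_mul A
    refine ((hasDerivAt_id η).ofReal_comp.mul
      ((hs.hasDerivAt_oscPrim (A * η)).scomp η h1)).congr_deriv ?_
    simp only [id, Function.comp_apply, Complex.real_smul]
    push_cast
    ring
  · rw [norm_mul, mul_pow, Complex.norm_real, Real.norm_eq_abs]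
    have hW := hs.weight_pos (A * η)
    have h1 := hs.mul_cube_div_le (A * η)
    have h2 : |A * η| ^ 2 / phaseWeight b y (A * η) ≤ 36 * b ^ 2 * statBump b (A * η) := by
      refine le_trans ?_ h1
      gcongr
      have h3 : 0 ≤ |A * η| := abs_nonneg _
      have h4 : 1 ≤ b ^ 6 := one_le_pow₀ hb
      have h5 : |A * η| ≤ |A * η| ^ 3 + 1 := by nlinarith [sq_nonneg (|A * η| - 1), pow_nonneg h3 3]
      nlinarith
    have h3 : |A * η| = A * |η| := by rw [abs_mul, abs_of_pos hA0]
    calc |η| ^ 2 * ‖oscPrim b y (A * η)‖ ^ 2 ≤ |η| ^ 2 * (phaseWeight b y (A * η))⁻¹ := by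
          gcongr; exact hs.norm_oscPrim_sq_le _
      _ = A⁻¹ ^ 2 * (|A * η| ^ 2 / phaseWeight b y (A * η)) := by rw [h3]; field_simp
      _ ≤ A⁻¹ ^ 2 * (36 * b ^ 2 * statBump b (A * η)) := by gcongr
      _ = _ := by ring
  · rw [integral_const_mul]
    have h1 : A⁻¹ ^ 2 ≤ (α ^ 2)⁻¹ ^ 2 := by gcongr
    calc A⁻¹ ^ 2 * (36 * b ^ 2) * ∫ η, statBump b (A * η)
        ≤ (α ^ 2)⁻¹ ^ 2 * (36 * b ^ 2) * (8 / (b ^ 3 * α ^ 2)) := by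
          gcongr
          exact integral_nonneg fun η => statBump_nonneg _ _
      _ = 288 * (α ^ 6)⁻¹ * b⁻¹ := by field_simp; norm_num
      _ ≤ 288 * (α ^ 6)⁻¹ * 1 := by gcongr
      _ ≤ 289 * (α ^ 6)⁻¹ := by
        have : 0 ≤ (α ^ 6)⁻¹ := by positivity
        linarith
      _ = (17 / α ^ 3) ^ 2 := by field_simp; norm_num
  · refine (norm_sub_le _ _).trans (add_le_add ?_ ?_)
    · rw [norm_mul, norm_mul, norm_osc, mul_one, Complex.norm_real, Real.norm_eq_abs]
      exact hE' _
    · exact (hpr _).trans (le_of_eq (by ring))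
  · rw [integral_add (hi.const_mul _) (hi2.const_mul _), integral_const_mul, integral_const_mul,
      hI2]
    have h1 : Real.pi / ((b ^ 2)⁻¹ * A) ≤ 4 / ((b ^ 2)⁻¹ * α ^ 2) := by
      gcongr; exact Real.pi_le_four
    calc _ ≤ 720 * b ^ 2 * (8 / (b ^ 3 * α ^ 2))
          + 5 * (b ^ 2)⁻¹ * (4 / ((b ^ 2)⁻¹ * α ^ 2)) := by gcongr
      _ = 5760 * (α ^ 2)⁻¹ * b⁻¹ + 20 * (α ^ 2)⁻¹ := by field_simp; ring
      _ ≤ 5760 * (α ^ 2)⁻¹ * 1 + 20 * (α ^ 2)⁻¹ := by gcongr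
      _ = _ := by ring
  · rw [norm_mul, norm_osc, mul_one, Complex.norm_real, Real.norm_eq_abs, abs_mul, abs_of_pos hA0]
    have := mul_nonneg hA0.le (abs_nonneg η)
    nlinarith [abs_nonneg η]
  · refine (norm_sub_le _ _).trans ?_
    rw [norm_mul, norm_mul, norm_osc, mul_one, Complex.norm_real, Real.norm_eq_abs, abs_mul,
      abs_of_pos hA0]
    have h1 : ‖oscErr b y (A * η)‖ ≤ 360 :=
      (hE _).trans (by linarith [statBump_le_one b (A * η)])
    have h2 : A * |η| * ‖oscErr b y (A * η)‖ ≤ A * |η| * 360 := by gcongr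
    have := mul_nonneg hA0.le (abs_nonneg η)
    nlinarith [hpr5 (A * η), abs_nonneg η]

end

section

variable {b y : ℝ}

/-! ### Spatial weights as frequency derivatives -/

theorem fourier_deriv_schwartz (φ : 𝓢(ℝ, ℂ)) (x : ℝ) :
    (𝓕 (SchwartzMap.derivCLM ℝ ℂ φ) : 𝓢(ℝ, ℂ)) x = freq x * (𝓕 φ : 𝓢(ℝ, ℂ)) x := by
  have h := Real.fourier_deriv φ.integrable φ.differentiable (SchwartzMap.derivCLM ℝ ℂ φ).integrable
  have h1 : ((𝓕 φ : 𝓢(ℝ, ℂ)) : ℝ → ℂ) = 𝓕 (φ : ℝ → ℂ) := SchwartzMap.fourier_coe φ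
  have h2 : ((𝓕 (SchwartzMap.derivCLM ℝ ℂ φ) : 𝓢(ℝ, ℂ)) : ℝ → ℂ) = 𝓕 (deriv φ) :=
    SchwartzMap.fourier_coe _
  rw [h2, h, h1]
  simp only [smul_eq_mul, freq]

/-- Multiplication by `-2πix` becomes differentiation in frequency. -/
theorem WD_fourier {p q : L2} (h : q =ᵐ[volume] fun x => -freq x * p x) :
    WD (𝓕 p) (𝓕 q) := by
  refine WD.of_integral_deriv fun φ => ?_
  have e : ∫ x, (𝓕 p : L2) x * deriv φ x
      = ∫ x, (𝓕 p : L2) x * SchwartzMap.derivCLM ℝ ℂ φ x := rfl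
  rw [e, integral_fourier_mul, integral_fourier_mul, ← integral_neg]
  refine integral_congr_ae ?_
  filter_upwards [h] with x hx
  rw [hx, fourier_deriv_schwartz]
  ring

/-! ### Dispersive decay -/

theorem symbol_neg_mul (t η : ℝ) : symbol (-t) η * symbol t η = 1 := by
  rw [← symbol_add]; simp [symbol]

/-- With `α = t^{1/10}` as unit all powers of time are integral: frequencies are rescaled by
`t^{1/5} = α²`, and the phase becomes `σ⁵ + yσ` with `y = x/t^{1/5}`. -/
theorem exp_mul_symbol {α : ℝ} (hα : 0 < α) (x η : ℝ) :
    Complex.exp (((2 * Real.pi * (η * x) : ℝ) : ℂ) * Complex.I) * symbol (-(α ^ 10)) η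
      = osc (x / α ^ 2) (2 * Real.pi * α ^ 2 * η) := by
  rw [symbol, osc, ← Complex.exp_add]
  congr 1
  have : (2 * Real.pi * α ^ 2 * η) ^ 5 + x / α ^ 2 * (2 * Real.pi * α ^ 2 * η)
      = α ^ 10 * (2 * Real.pi * η) ^ 5 + 2 * Real.pi * (η * x) := by
    field_simp
  rw [this]
  push_cast
  ring

theorem fourierInv_eq_integral_osc {p g : L2} {α : ℝ} (hα : 0 < α)
    (hg : g = mulL2 (symbol (α ^ 10)) (𝓕 p)) (x : ℝ) (m : ℝ → ℂ) :
    (𝓕⁻ (fun η => m η * (𝓕 p : L2) η) : ℝ → ℂ) x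
      = ∫ η, g η * (m η * osc (x / α ^ 2) (2 * Real.pi * α ^ 2 * η)) := by
  rw [Real.fourierInv_eq']
  refine integral_congr_ae ?_
  filter_upwards [mulL2_coe (bddMeas_symbol (α ^ 10)) (𝓕 p)] with η hη
  rw [hg, hη, ← exp_mul_symbol hα, smul_eq_mul]
  have e : (inner ℝ η x : ℝ) = η * x := by simp [mul_comm]
  rw [e]
  linear_combination (-Complex.exp (((2 * Real.pi * (η * x) : ℝ) : ℂ) * Complex.I) * m η
    * (𝓕 p : L2) η) * symbol_neg_mul (α ^ 10) η

/-- The assumption `‖d‖ ≤ Dα` is the a priori growth `t^{1/10}` of `‖x f‖`. It exactly balances the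
extra `α⁻¹` of the `L²` term in the oscillatory estimate, so both terms decay like `t^{-1/5}`, and
like `t^{-2/5}` for the derivative. -/
theorem norm_cts_le_of_profile {p q r g d : L2} (h : WD p q) (h' : WD q r) {α : ℝ} (hα : 1 ≤ α)
    (hg : g = mulL2 (symbol (α ^ 10)) (𝓕 p)) (hd : WD g d) {c D : ℝ} (hc : ∀ᵐ η, ‖g η‖ ≤ c)
    (hD : ‖d‖ ≤ D * α) {x : ℝ} (hs : StatScale b (x / α ^ 2)) :
    ‖cts p x‖ ≤ (12 * D + 2880 * c) / (b ^ 3 * α ^ 2) ∧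
      ‖cts q x‖ ≤ (17 * D + 5780 * c) / α ^ 4 := by
  have hα0 : 0 < α := by linarith
  have hb := hs.1
  have hA : α ^ 2 ≤ 2 * Real.pi * α ^ 2 := by
    have := Real.pi_gt_three
    nlinarith [pow_pos hα0 2]
  have hng : ∀ᵐ η, ‖g η‖ = ‖(𝓕 p : L2) η‖ := by
    filter_upwards [mulL2_coe (bddMeas_symbol (α ^ 10)) (𝓕 p)] with η hη
    rw [hg, hη, norm_mul, norm_symbol, one_mul]
  have hgi : Integrable g := h.integrable_fourier.congr' (Lp.aestronglyMeasurable g) (by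
    filter_upwards [hng] with η hη
    exact hη.symm)
  have hgi1 : Integrable fun η => |η| * ‖g η‖ := by
    have h1 : Integrable fun η => ‖(𝓕 q : L2) η‖ * (2 * Real.pi)⁻¹ :=
      h'.integrable_fourier.norm.mul_const _
    refine h1.congr ?_
    filter_upwards [hng, h] with η h2 h3
    rw [h3, h2, norm_mul, norm_freq]
    field_simp
  constructor
  · have e : cts p x = ∫ η, g η * osc (x / α ^ 2) (2 * Real.pi * α ^ 2 * η) := by
      have := fourierInv_eq_integral_osc hα0 hg x (fun _ => 1)
      simp only [one_mul] at this
      exact this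
    rw [e]
    refine (hs.norm_integral_osc_le hd hgi hgi1 hc hα0 hA).trans ?_
    calc _ ≤ D * α * (12 / (b ^ 3 * α ^ 3)) + c * (2880 / (b ^ 3 * α ^ 2)) := by gcongr
      _ = _ := by field_simp
  · have e : cts q x = (Complex.I / (α ^ 2 : ℝ)) * ∫ η, g η * ((2 * Real.pi * α ^ 2 * η : ℝ)
        * osc (x / α ^ 2) (2 * Real.pi * α ^ 2 * η)) := by
      have e1 : cts q x = (𝓕⁻ (fun η => freq η * (𝓕 p : L2) η) : ℝ → ℂ) x := by
        rw [cts, Real.fourierInv_eq', Real.fourierInv_eq']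
        refine integral_congr_ae ?_
        filter_upwards [h] with η hη
        rw [hη]
      rw [e1, fourierInv_eq_integral_osc hα0 hg x freq, ← integral_const_mul]
      refine integral_congr_ae (.of_forall fun η => ?_)
      have : (α : ℂ) ≠ 0 := by exact_mod_cast hα0.ne'
      simp only [freq]
      push_cast
      field_simp
    rw [e, norm_mul, norm_div, Complex.norm_I, Complex.norm_real, Real.norm_of_nonneg (by positivity)]
    have := hs.norm_integral_mul_osc_le hd hgi hgi1 hc hα0 hA
    calc _ ≤ 1 / α ^ 2 * (D * α * (17 / α ^ 3) + c * (5780 / α ^ 2)) := by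
          gcongr
          refine this.trans ?_
          gcongr
      _ = _ := by field_simp

/-- The tenth power of the decay bound contains `b⁻³⁰`. Since `b⁸ ≥ |y|/5`, already `b⁻¹⁶` is
integrable in `y`, and the change of variables from `y` to `x` costs `α²` under the square root. -/
theorem norm_quart_le_of_decay {p q : L2} (h : WD p q) {α K : ℝ} (hα : 1 ≤ α)
    (hK : ∀ x b, StatScale b (x / α ^ 2) → ‖cts p x‖ ≤ K / (b ^ 3 * α ^ 2)) :
    α ^ 10 * ‖quart p p‖ ≤ 9 * K ^ 5 * α := by
  have hα0 : 0 < α := by linarith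
  have hK0 : 0 ≤ K := by
    obtain ⟨b, hb⟩ := exists_statScale (0 / α ^ 2)
    have h1 := (norm_nonneg _).trans (hK 0 b hb)
    have h2 : 0 < b ^ 3 * α ^ 2 := by have := hb.1; positivity
    exact (div_nonneg_iff.mp h1).elim (fun h => h.1) fun h => absurd h.2 (not_le.mpr h2)
  have hpt : ∀ x, ‖cts p x‖ ^ 10
      ≤ K ^ 10 / α ^ 20 * (2 * (1 + ((5 * α ^ 2)⁻¹ * x) ^ 2)⁻¹) := by
    intro x
    obtain ⟨b, hb⟩ := exists_statScale (x / α ^ 2)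
    have hb1 := hb.1
    have h1 : ((5 * α ^ 2)⁻¹ * x) ^ 2 ≤ (b ^ 8) ^ 2 := by
      refine sq_le_sq' ?_ ?_
      all_goals
        have := hb.abs_le
        rw [_root_.abs_le] at this
        have e : (5 * α ^ 2)⁻¹ * x = x / α ^ 2 / 5 := by field_simp
        rw [e]
        linarith
    have h2 : (1 : ℝ) ≤ b ^ 16 := one_le_pow₀ hb1
    have h3 : b ^ 16 ≤ b ^ 30 := pow_le_pow_right₀ hb1 (by norm_num)
    have h4 : (b ^ 30)⁻¹ ≤ 2 * (1 + ((5 * α ^ 2)⁻¹ * x) ^ 2)⁻¹ := by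
      rw [← div_eq_mul_inv, ← one_div, div_le_div_iff₀ (by positivity) (by positivity)]
      nlinarith
    calc ‖cts p x‖ ^ 10 ≤ (K / (b ^ 3 * α ^ 2)) ^ 10 := by gcongr; exact hK x b hb
      _ = K ^ 10 / α ^ 20 * (b ^ 30)⁻¹ := by field_simp
      _ ≤ _ := by gcongr
  have hr : 0 < (5 * α ^ 2)⁻¹ := by positivity
  have hi := integrable_inv_one_add_sq_mul hr
  have hsq : ‖quart p p‖ ^ 2 ≤ K ^ 10 / α ^ 20 * (2 * (Real.pi / (5 * α ^ 2)⁻¹)) := by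
    rw [norm_sq_eq_integral, ← integral_inv_one_add_sq_mul hr, ← integral_const_mul,
      ← integral_const_mul]
    refine integral_mono_ae (integrable_norm_sq _) ((hi.const_mul _).const_mul _) ?_
    filter_upwards [h.quart_self_coe] with x hx
    rw [hx, norm_pow, ← pow_mul]
    exact hpt x
  refine (sq_le_sq₀ (by positivity) (by positivity)).mp ?_
  calc (α ^ 10 * ‖quart p p‖) ^ 2 = α ^ 20 * ‖quart p p‖ ^ 2 := by ring
    _ ≤ α ^ 20 * (K ^ 10 / α ^ 20 * (2 * (Real.pi / (5 * α ^ 2)⁻¹))) := by gcongr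
    _ = 10 * Real.pi * K ^ 10 * α ^ 2 := by field_simp; ring
    _ ≤ 10 * 4 * K ^ 10 * α ^ 2 := by gcongr; exact Real.pi_le_four
    _ ≤ (9 * K ^ 5 * α) ^ 2 := by nlinarith [mul_nonneg (pow_nonneg hK0 10) (sq_nonneg α)]

end

/-! ### Dilations -/

open Classical in
/-- The dilation `p ↦ p(c ·)` on `L²`. -/
def dil (c : ℝ) : L2 →L[ℂ] L2 :=
  if hc : c ≠ 0 then
    LinearMap.mkContinuous
      { toFun := fun g => (memLp_comp_mul hc (Lp.memLp g)).toLp _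
        map_add' := fun f g => by
          refine Lp.ext ?_
          filter_upwards [MemLp.coeFn_toLp (memLp_comp_mul hc (Lp.memLp (f + g))),
            MemLp.coeFn_toLp (memLp_comp_mul hc (Lp.memLp f)),
            MemLp.coeFn_toLp (memLp_comp_mul hc (Lp.memLp g)), ae_comp_mul (Lp.coeFn_add f g) hc,
            Lp.coeFn_add ((memLp_comp_mul hc (Lp.memLp f)).toLp _)
              ((memLp_comp_mul hc (Lp.memLp g)).toLp _)] with x h1 h2 h3 h4 h5
          rw [h1, h5, Pi.add_apply, h2, h3, h4, Pi.add_apply]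
        map_smul' := fun a g => by
          refine Lp.ext ?_
          filter_upwards [MemLp.coeFn_toLp (memLp_comp_mul hc (Lp.memLp (a • g))),
            MemLp.coeFn_toLp (memLp_comp_mul hc (Lp.memLp g)), ae_comp_mul (Lp.coeFn_smul a g) hc,
            Lp.coeFn_smul a ((memLp_comp_mul hc (Lp.memLp g)).toLp _)] with x h1 h2 h3 h4
          simp only [RingHom.id_apply]
          rw [h1, h4, Pi.smul_apply, h2, h3, Pi.smul_apply] }
      (ENNReal.ofReal |c⁻¹| ^ (1 / (2 : ℝ≥0∞)).toReal).toReal fun g => by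
        simp only [LinearMap.coe_mk, AddHom.coe_mk]
        rw [Lp.norm_toLp, eLpNorm_comp_mul hc, ENNReal.toReal_mul, Lp.norm_def]
  else 0

theorem dil_coe {c : ℝ} (hc : c ≠ 0) (g : L2) : dil c g =ᵐ[volume] fun x => g (c * x) := by
  rw [dil, dif_pos hc]
  exact MemLp.coeFn_toLp (memLp_comp_mul hc (Lp.memLp g))

/-- Dilation of Schwartz functions. -/
def schwartzDil (c : ℝˣ) : 𝓢(ℝ, ℂ) →L[ℝ] 𝓢(ℝ, ℂ) :=
  SchwartzMap.compCLMOfContinuousLinearEquiv ℝ (ContinuousLinearEquiv.unitsEquivAut ℝ c)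

theorem schwartzDil_apply (c : ℝˣ) (χ : 𝓢(ℝ, ℂ)) (x : ℝ) : schwartzDil c χ x = χ (x * c) := rfl

theorem fourier_schwartzDil (c : ℝˣ) (χ : 𝓢(ℝ, ℂ)) (x : ℝ) :
    (𝓕 (schwartzDil c χ) : 𝓢(ℝ, ℂ)) x
      = ((|(c : ℝ)⁻¹| : ℝ) : ℂ) * (𝓕 χ : 𝓢(ℝ, ℂ)) ((c : ℝ)⁻¹ * x) := by
  have h1 : ((𝓕 χ : 𝓢(ℝ, ℂ)) : ℝ → ℂ) = 𝓕 (χ : ℝ → ℂ) := SchwartzMap.fourier_coe χ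
  have h2 : ((𝓕 (schwartzDil c χ) : 𝓢(ℝ, ℂ)) : ℝ → ℂ) = 𝓕 (schwartzDil c χ : ℝ → ℂ) :=
    SchwartzMap.fourier_coe _
  rw [h1, h2, Real.fourier_real_eq, Real.fourier_real_eq, ← Complex.real_smul,
    ← Measure.integral_comp_mul_left]
  refine integral_congr_ae (.of_forall fun v => ?_)
  have hc : (c : ℝ) ≠ 0 := c.ne_zero
  simp only [schwartzDil_apply]
  have e : (c : ℝ) * v * ((c : ℝ)⁻¹ * x) = v * x := by field_simp
  rw [e, mul_comm v (c : ℝ)]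

theorem fourier_dil {c : ℝ} (hc : 0 < c) (p : L2) :
    (𝓕 (dil c p) : L2) = (c : ℂ)⁻¹ • dil c⁻¹ (𝓕 p) := by
  have hc0 := hc.ne'
  refine L2_ext_schwartz fun χ => ?_
  have e1 : ∫ x, (𝓕 (dil c p) : L2) x * χ x
      = (c : ℂ)⁻¹ * ∫ x, p x * (𝓕 χ : 𝓢(ℝ, ℂ)) (c⁻¹ * x) := by
    rw [integral_fourier_mul]
    have h := Measure.integral_comp_mul_left (fun x => p x * (𝓕 χ : 𝓢(ℝ, ℂ)) (c⁻¹ * x)) c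
    rw [abs_of_pos (inv_pos.mpr hc), Complex.real_smul, Complex.ofReal_inv] at h
    rw [← h]
    refine integral_congr_ae ?_
    filter_upwards [dil_coe hc0 p] with x hx
    rw [hx, inv_mul_cancel_left₀ hc0]
  have e2 : ∫ x, ((c : ℂ)⁻¹ • dil c⁻¹ (𝓕 p) : L2) x * χ x
      = ∫ x, (𝓕 p : L2) x * schwartzDil (Units.mk0 c hc0) χ x := by
    have h := Measure.integral_comp_mul_left
      (fun x => (𝓕 p : L2) x * schwartzDil (Units.mk0 c hc0) χ x) c⁻¹
    rw [inv_inv, abs_of_pos hc, Complex.real_smul] at h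
    have hcc : (c : ℂ) ≠ 0 := by exact_mod_cast hc0
    rw [← mul_right_inj' hcc, ← h, ← integral_const_mul]
    refine integral_congr_ae ?_
    filter_upwards [dil_coe (inv_ne_zero hc0) (𝓕 p),
      Lp.coeFn_smul (c : ℂ)⁻¹ (dil c⁻¹ (𝓕 p))] with x hx h2
    rw [h2, Pi.smul_apply, hx, schwartzDil_apply, smul_eq_mul, Units.val_mk0, mul_comm c⁻¹ x,
      inv_mul_cancel_right₀ hc0]
    field_simp
  rw [e1, e2, integral_fourier_mul, ← integral_const_mul]
  refine integral_congr_ae (.of_forall fun x => ?_)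
  simp only [fourier_schwartzDil, Units.val_mk0, abs_of_pos (inv_pos.mpr hc)]
  push_cast
  ring

theorem freq_mul (c η : ℝ) : freq (c * η) = c * freq η := by
  simp only [freq]; push_cast; ring

theorem WD.dil {p q : L2} (h : WD p q) {c : ℝ} (hc : 0 < c) :
    WD (dil c p) ((c : ℂ) • FifthKdV.dil c q) := by
  have hc0 := hc.ne'
  have hcc : (c : ℂ) ≠ 0 := by exact_mod_cast hc0
  unfold WD
  rw [FourierTransform.fourier_smul, fourier_dil hc, fourier_dil hc, smul_inv_smul₀ hcc]
  filter_upwards [dil_coe (inv_ne_zero hc0) (𝓕 p), dil_coe (inv_ne_zero hc0) (𝓕 q),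
    Lp.coeFn_smul (c : ℂ)⁻¹ (FifthKdV.dil c⁻¹ (𝓕 p)), ae_comp_mul h (inv_ne_zero hc0)]
    with η h1 h2 h3 h4
  rw [h3, Pi.smul_apply, h1, h2, h4, freq_mul, smul_eq_mul]
  push_cast
  ring

theorem WD.cts_dil {p q : L2} (h : WD p q) {c : ℝ} (hc : 0 < c) :
    cts (FifthKdV.dil c p) = fun x => cts p (c * x) := by
  refine (h.dil hc).cts_eq_of_ae (h.continuous_cts.comp (continuous_const.mul continuous_id)) ?_
  filter_upwards [dil_coe hc.ne' p, ae_comp_mul h.cts_ae hc.ne'] with x h1 h2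
  rw [h1, h2]

theorem WD.cts_smul {p q : L2} (h : WD p q) (c : ℂ) : cts (c • p) = fun x => c * cts p x := by
  refine (h.smul c).cts_eq_of_ae (continuous_const.mul h.continuous_cts) ?_
  filter_upwards [Lp.coeFn_smul c p, h.cts_ae] with x h1 h2
  rw [h1, Pi.smul_apply, h2, smul_eq_mul]

/-! ### The primitive of a scaling difference -/

theorem sq_intervalIntegral_le {f : ℝ → ℝ} (hf : Continuous f) {a b : ℝ} (hab : a < b) :
    (∫ θ in a..b, f θ) ^ 2 ≤ (b - a) * ∫ θ in a..b, f θ ^ 2 := by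
  set I := ∫ θ in a..b, f θ
  have hba : 0 < b - a := sub_pos.mpr hab
  set m := I / (b - a) with hm
  have h0 : 0 ≤ ∫ θ in a..b, (f θ - m) ^ 2 :=
    intervalIntegral.integral_nonneg hab.le fun θ _ => sq_nonneg _
  have e : ∫ θ in a..b, (f θ - m) ^ 2 = (∫ θ in a..b, f θ ^ 2) - 2 * m * I + (b - a) * m ^ 2 := by
    have e1 : ∀ θ, (f θ - m) ^ 2 = f θ ^ 2 - 2 * m * f θ + m ^ 2 := fun θ => by ring
    simp_rw [e1]
    rw [intervalIntegral.integral_add ((Continuous.intervalIntegrable (by fun_prop) _ _))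
      intervalIntegrable_const, intervalIntegral.integral_sub
      (Continuous.intervalIntegrable (by fun_prop) _ _)
      (Continuous.intervalIntegrable (by fun_prop) _ _), intervalIntegral.integral_const_mul,
      intervalIntegral.integral_const, smul_eq_mul]
  rw [e] at h0
  have hI : I = m * (b - a) := by rw [hm]; field_simp
  rw [hI] at h0 ⊢
  nlinarith

/-- The primitive is `∫ p` from `x` to `cx`, that is `-x∫ p(xθ) dθ` over `θ` in `[c, 1]`.
Cauchy–Schwarz in `θ` and dilation invariance bound it by `‖x p‖`, with a factor `1 - c` from the
length of the interval. -/
theorem exists_scaling_primitive {p q w : L2} (h : WD p q)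
    (hw : w =ᵐ[volume] fun x => (x : ℂ) * p x) {c : ℝ} (hc : 0 < c) (hc1 : c < 1) :
    ∃ D : L2, WD D ((c : ℂ) • dil c p - p) ∧ ‖D‖ ≤ (1 - c) * (c ^ 2)⁻¹ * ‖w‖ := by
  have hP := h.continuous_cts
  set P := cts p with hPdef
  set F : ℝ → ℂ := fun x => ∫ z in x..(c * x), P z with hF
  have hsub : 0 < 1 - c := sub_pos.mpr hc1
  have hd : ∀ x, HasDerivAt F (c * P (c * x) - P x) x := by
    intro x
    have hG : ∀ x, HasDerivAt (fun x => ∫ z in (0 : ℝ)..x, P z) (P x) x := fun x =>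
      intervalIntegral.integral_hasDerivAt_right (hP.intervalIntegrable _ _)
        (hP.stronglyMeasurableAtFilter _ _) hP.continuousAt
    have h1 : HasDerivAt (fun x : ℝ => c * x) c x := by
      simpa using (hasDerivAt_id x).const_mul c
    have h2 := ((hG (c * x)).scomp x h1).sub (hG x)
    rw [Complex.real_smul] at h2
    refine h2.congr_of_eventuallyEq (.of_forall fun x => ?_)
    simp only [hF, Pi.sub_apply, Function.comp_apply]
    rw [intervalIntegral.integral_interval_sub_left (hP.intervalIntegrable _ _)
      (hP.intervalIntegrable _ _)]
  have hFc : Continuous F := continuous_iff_continuousAt.mpr fun x => (hd x).continuousAt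
  set H : ℝ × ℝ → ℝ := fun z => z.1 ^ 2 * ‖P (z.2 * z.1)‖ ^ 2 with hH
  have hHc : Continuous H := by fun_prop
  have hFle : ∀ x, ‖F x‖ ^ 2 ≤ (1 - c) * ∫ θ in c..1, H (x, θ) := by
    intro x
    have e : F x = -(x • ∫ θ in c..1, P (x * θ)) := by
      rw [intervalIntegral.smul_integral_comp_mul_left, intervalIntegral.integral_symm, neg_neg,
        mul_one, mul_comm x c]
    have h1 : ‖∫ θ in c..1, P (x * θ)‖ ≤ ∫ θ in c..1, ‖P (x * θ)‖ :=
      intervalIntegral.norm_integral_le_integral_norm hc1.le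
    have h2 := sq_intervalIntegral_le (f := fun θ => ‖P (x * θ)‖) (by fun_prop) hc1
    rw [e, norm_neg, norm_smul, mul_pow, Real.norm_eq_abs, sq_abs]
    simp only [hH]
    rw [intervalIntegral.integral_const_mul]
    simp_rw [mul_comm _ x]
    calc x ^ 2 * ‖∫ θ in c..1, P (x * θ)‖ ^ 2
        ≤ x ^ 2 * ((1 - c) * ∫ θ in c..1, ‖P (x * θ)‖ ^ 2) := by
          gcongr
          exact (pow_le_pow_left₀ (norm_nonneg _) h1 2).trans h2
      _ = _ := by ring
  have hwi : Integrable fun x => x ^ 2 * ‖P x‖ ^ 2 := by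
    refine (integrable_norm_sq w).congr ?_
    filter_upwards [hw, h.cts_ae] with x h1 h2
    rw [h1, h2, norm_mul, mul_pow, Complex.norm_real, Real.norm_eq_abs, sq_abs]
  have hwn : ∫ x, x ^ 2 * ‖P x‖ ^ 2 = ‖w‖ ^ 2 := by
    rw [norm_sq_eq_integral]
    refine integral_congr_ae ?_
    filter_upwards [hw, h.cts_ae] with x h1 h2
    rw [h1, h2, norm_mul, mul_pow, Complex.norm_real, Real.norm_eq_abs, sq_abs]
  have hslice : ∀ θ, θ ∈ Set.Ioc c 1 → Integrable (fun x => H (x, θ)) ∧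
      ∫ x, H (x, θ) ≤ (c ^ 3)⁻¹ * ‖w‖ ^ 2 := by
    intro θ hθ
    have hθ0 : 0 < θ := hc.trans hθ.1
    have e : (fun x => H (x, θ)) = fun x => (θ ^ 2)⁻¹ * ((θ * x) ^ 2 * ‖P (θ * x)‖ ^ 2) := by
      funext x
      simp only [hH]
      field_simp
    rw [e]
    refine ⟨(hwi.comp_mul_left' hθ0.ne').const_mul _, ?_⟩
    rw [integral_const_mul, Measure.integral_comp_mul_left (fun x => x ^ 2 * ‖P x‖ ^ 2) θ, hwn,
      abs_of_pos (inv_pos.mpr hθ0), smul_eq_mul, ← mul_assoc]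
    gcongr
    rw [← mul_inv, show θ ^ 2 * θ = θ ^ 3 by ring]
    have := hθ.1.le
    gcongr
  have hprod : Integrable H (volume.prod (volume.restrict (Set.Ioc c 1))) := by
    rw [integrable_prod_iff' hHc.aestronglyMeasurable]
    refine ⟨(ae_restrict_iff' measurableSet_Ioc).mpr (.of_forall fun θ hθ => (hslice θ hθ).1), ?_⟩
    have hfin : IsFiniteMeasure (volume.restrict (Set.Ioc c 1)) := inferInstance
    refine (integrable_const ((c ^ 3)⁻¹ * ‖w‖ ^ 2)).mono' ?_ ?_
    · exact (hHc.norm.aestronglyMeasurable (μ := (volume.prod (volume.restrict (Set.Ioc c 1))))).prod_swap.integral_prod_right'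
    · rw [ae_restrict_iff' measurableSet_Ioc]
      refine .of_forall fun θ hθ => ?_
      have e : ∀ x, ‖H (x, θ)‖ = H (x, θ) := fun x => Real.norm_of_nonneg (by simp only [hH]; positivity)
      simp_rw [e]
      rw [Real.norm_of_nonneg (integral_nonneg fun x => by simp only [hH]; positivity)]
      exact (hslice θ hθ).2
  have hI : Integrable fun x => ∫ θ in c..1, H (x, θ) := by
    simp_rw [intervalIntegral.integral_of_le hc1.le]
    exact hprod.integral_prod_left
  have hIn : ∫ x, ∫ θ in c..1, H (x, θ) ≤ (1 - c) * ((c ^ 3)⁻¹ * ‖w‖ ^ 2) := by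
    simp_rw [intervalIntegral.integral_of_le hc1.le]
    rw [integral_integral_swap (f := fun x θ => H (x, θ)) hprod]
    refine (integral_mono_ae hprod.integral_prod_right (integrable_const _)
      ((ae_restrict_iff' measurableSet_Ioc).mpr (.of_forall fun θ hθ => (hslice θ hθ).2))).trans
      (le_of_eq ?_)
    rw [integral_const, smul_eq_mul]
    simp [hc1.le]
  have hF2 : Integrable fun x => ‖F x‖ ^ 2 := by
    refine (hI.const_mul (1 - c)).mono' (hFc.norm.pow 2).aestronglyMeasurable
      (.of_forall fun x => ?_)
    rw [Real.norm_of_nonneg (by positivity)]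
    exact hFle x
  have hm : MemLp F 2 := by
    rw [← memLp_norm_iff hFc.aestronglyMeasurable,
      memLp_two_iff_integrable_sq hFc.norm.aestronglyMeasurable]
    exact hF2
  refine ⟨hm.toLp F, ?_, ?_⟩
  · refine WD.of_hasDerivAt hm.coeFn_toLp ?_ hd
    filter_upwards [Lp.coeFn_sub ((c : ℂ) • dil c p) p, Lp.coeFn_smul (c : ℂ) (dil c p),
      dil_coe hc.ne' p, h.cts_ae, ae_comp_mul h.cts_ae hc.ne'] with x h1 h2 h3 h4 h5
    rw [h1, Pi.sub_apply, h2, Pi.smul_apply, h3, h5, h4, smul_eq_mul]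
  · refine (sq_le_sq₀ (norm_nonneg _) (by positivity)).mp ?_
    have e : ‖(hm.toLp F : L2)‖ ^ 2 = ∫ x, ‖F x‖ ^ 2 := by
      rw [norm_sq_eq_integral]
      refine integral_congr_ae ?_
      filter_upwards [hm.coeFn_toLp] with x hx
      rw [hx]
    rw [e]
    have hc34 : (c ^ 3)⁻¹ ≤ (c ^ 4)⁻¹ := by
      gcongr ?_⁻¹
      exact pow_le_pow_of_le_one hc.le hc1.le (by norm_num)
    calc ∫ x, ‖F x‖ ^ 2 ≤ ∫ x, (1 - c) * ∫ θ in c..1, H (x, θ) :=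
          integral_mono hF2 (hI.const_mul _) hFle
      _ = (1 - c) * ∫ x, ∫ θ in c..1, H (x, θ) := integral_const_mul _ _
      _ ≤ (1 - c) * ((1 - c) * ((c ^ 3)⁻¹ * ‖w‖ ^ 2)) := by gcongr
      _ ≤ (1 - c) * ((1 - c) * ((c ^ 4)⁻¹ * ‖w‖ ^ 2)) := by gcongr
      _ = _ := by field_simp

section

variable {τ : ℝ} {u u1 u2 : ℝ → L2}

/-! ### The primitive of the nonlinear part of the profile -/

theorem hasDerivWithinAt_integral_mul_schwartz {g : ℝ → L2} {N : L2} {I : Set ℝ} {t : ℝ}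
    (h : HasDerivWithinAt g N I t) (χ : 𝓢(ℝ, ℂ)) :
    HasDerivWithinAt (fun s => ∫ x, g s x * χ x) (∫ x, N x * χ x) I t := by
  have e : ∀ p : L2, ∫ x, p x * χ x = (inner ℂ (star (χ.toLp 2 : L2)) p : ℂ) := by
    intro p
    rw [inner_star_left, ← integral_mul_toLp]
    exact integral_congr_ae (.of_forall fun x => mul_comm _ _)
  simp_rw [e]
  refine (HasDerivWithinAt.inner ℂ (hasDerivWithinAt_const t I (star (χ.toLp 2 : L2)))
    h).congr_deriv ?_
  simp

theorem fourier_sub_L2 (p q : L2) : (𝓕 (p - q) : L2) = 𝓕 p - 𝓕 q :=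
  (Lp.fourierTransformₗᵢ ℝ ℂ).map_sub p q

/-- The nonlinearity in the profile equation, without the derivative. -/
def fluxRate (u : ℝ → L2) (t : ℝ) : L2 :=
  (-(1 / 5) : ℂ) • mulL2 (symbol t) (𝓕 (quart (u t) (u t)))

theorem gprof_zero (u : ℝ → L2) : gprof u 0 = 𝓕 (u 0) := by
  have : symbol 0 = fun _ => 1 := by funext η; simp [symbol]
  rw [gprof, this, mulL2_one]

/-- The nonlinearity is an exact derivative, so the profile equation can be integrated in time
before applying `∂ₓ`. Dividing the nonlinear part of the profile by the frequency thus stays in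
`L²`. -/
theorem Evol.exists_primitive (h : Evol τ u u1 u2) (hτ : 0 ≤ τ) :
    ∃ k : ℝ → L2, k 0 = 0 ∧
      (∀ t ∈ Set.Icc 0 τ, HasDerivWithinAt k (fluxRate u t) (Set.Icc 0 τ) t) ∧
      ∀ t ∈ Set.Icc 0 τ, gprof u t =ᵐ[volume] fun η => (𝓕 (u 0) : L2) η + freq η * k t η := by
  have hN : ContinuousOn (fluxRate u) (Set.Icc 0 τ) :=
    (continuousOn_mulL2_symbol (continuousOn_fourier (h.continuousOn_quart h.cont))).const_smul
      (-(1 / 5) : ℂ)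
  set N := Set.IccExtend hτ ((Set.Icc 0 τ).domRestrict (fluxRate u)) with hNdef
  have hNc : Continuous N := (continuousOn_iff_continuous_domRestrict.mp hN).Icc_extend'
  have hNe : ∀ t ∈ Set.Icc 0 τ, N t = fluxRate u t := fun t ht => Set.IccExtend_of_mem hτ _ ht
  have hk : ∀ t ∈ Set.Icc 0 τ, HasDerivWithinAt (fun t => ∫ s in (0 : ℝ)..t, N s) (fluxRate u t)
      (Set.Icc 0 τ) t := by
    intro t ht
    rw [← hNe t ht]
    exact (intervalIntegral.integral_hasDerivAt_right (hNc.intervalIntegrable _ _)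
      (hNc.stronglyMeasurableAtFilter _ _) hNc.continuousAt).hasDerivWithinAt
  refine ⟨fun t => ∫ s in (0 : ℝ)..t, N s, intervalIntegral.integral_same, hk, fun t ht => ?_⟩
  set k := fun t => ∫ s in (0 : ℝ)..t, N s with hkdef
  have h0 : (0 : ℝ) ∈ Set.Icc 0 τ := ⟨le_rfl, hτ⟩
  have key : ∀ χ : 𝓢(ℝ, ℂ), ∫ η, (gprof u t - 𝓕 (u 0) : L2) η * χ η
      = ∫ η, (freq η * k t η) * χ η := by
    intro χ
    have hd : ∀ s ∈ Set.Icc 0 τ, HasDerivWithinAt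
        (fun s => (∫ η, gprof u s η * χ η) - ∫ η, k s η * freqMul χ η) 0 (Set.Icc 0 τ) s := by
      intro s hs
      refine ((h.gprof_weak χ hs).sub
        (hasDerivWithinAt_integral_mul_schwartz (hk s hs) (freqMul χ))).congr_deriv ?_
      rw [sub_eq_zero, ← integral_const_mul]
      refine integral_congr_ae ?_
      filter_upwards [Lp.coeFn_smul (-(1 / 5) : ℂ)
        (mulL2 (symbol s) (𝓕 (quart (u s) (u s))))] with η hη
      rw [fluxRate, hη, Pi.smul_apply, smul_eq_mul, freqMul_apply]
      ring
    have h1 := Convex.norm_image_sub_le_of_norm_hasDerivWithin_le hd (C := 0) (fun x _ => by simp)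
      (convex_Icc 0 τ) h0 ht
    have hk0 : ∫ η, k 0 η * freqMul χ η = 0 := by
      have : k 0 = 0 := intervalIntegral.integral_same
      rw [this]
      refine (integral_congr_ae (g := fun _ => (0 : ℂ)) ?_).trans (by simp)
      filter_upwards [Lp.coeFn_zero ℂ 2 (volume : Measure ℝ)] with x hx
      rw [hx]; simp
    rw [zero_mul, norm_le_zero_iff, sub_eq_zero, hk0, sub_zero, gprof_zero, sub_eq_iff_eq_add] at h1
    have e1 : ∫ η, (gprof u t - 𝓕 (u 0) : L2) η * χ η
        = (∫ η, gprof u t η * χ η) - ∫ η, (𝓕 (u 0) : L2) η * χ η := by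
      rw [← integral_sub (integrable_mul_schwartz _ _) (integrable_mul_schwartz _ _)]
      refine integral_congr_ae ?_
      filter_upwards [Lp.coeFn_sub (gprof u t) (𝓕 (u 0) : L2)] with η hη
      rw [hη, Pi.sub_apply, sub_mul]
    rw [e1, h1, add_sub_cancel_left]
    refine integral_congr_ae (.of_forall fun η => ?_)
    simp only [freqMul_apply]
    ring
  have := ae_eq_of_forall_schwartz (locallyIntegrable_L2 _)
    (locallyIntegrable_cont_mul continuous_freq (k t)) key
  filter_upwards [this, Lp.coeFn_sub (gprof u t) (𝓕 (u 0) : L2)] with η h1 h2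
  rw [← h1, h2, Pi.sub_apply]
  ring

/-! ### The energy estimate for scaling differences -/

theorem WD.re_inner_mulL2 {p q : L2} (h : WD p q) {a a' : ℝ → ℂ} (ha : BddMeas a)
    (ha' : BddMeas a') (hd : ∀ x, HasDerivAt a (a' x) x) (hr : ∀ x, conj (a x) = a x) :
    2 * (Inner.inner ℂ p (mulL2 a q) : ℂ).re = -(Inner.inner ℂ p (mulL2 a' p) : ℂ).re := by
  have h1 := h.inner (h.mul ha ha' hd)
  have h2 : (Inner.inner ℂ q (mulL2 a p) : ℂ) = conj (Inner.inner ℂ p (mulL2 a q) : ℂ) := by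
    rw [inner_conj_symm, inner_mulL2_left ha]
    simp_rw [hr]
  rw [h2, inner_add_right] at h1
  have h3 := congrArg Complex.re h1
  simp only [Complex.add_re, Complex.neg_re, Complex.conj_re] at h3
  linarith

/-- `p⁵ - r⁵ = q D'` with `q` a polynomial in `p` and `r`, and `⟨D, q D'⟩ = -½⟨D, q' D⟩`: no
derivative falls on `D`. The coefficients of `q'` sum to `20`. -/
theorem abs_re_inner_quart_sub_le {D p p1 p2 r r1 r2 : L2} (hp : WD p p1) (hp1 : WD p1 p2)
    (hr : WD r r1) (hr1 : WD r1 r2) (hD : WD D (p - r)) (hpr : ∀ x, conj (cts p x) = cts p x)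
    (hrr : ∀ x, conj (cts r x) = cts r x) {b0 b1 : ℝ} (p0 : ∀ x, ‖cts p x‖ ≤ b0)
    (r0 : ∀ x, ‖cts r x‖ ≤ b0) (p1b : ∀ x, ‖cts p1 x‖ ≤ b1) (r1b : ∀ x, ‖cts r1 x‖ ≤ b1) :
    |(inner ℂ D (quart p p - quart r r) : ℂ).re| ≤ 10 * b0 ^ 3 * b1 * ‖D‖ ^ 2 := by
  have bp := hp.bddMeas_cts
  have bp1 := hp1.bddMeas_cts
  have br := hr.bddMeas_cts
  have br1 := hr1.bddMeas_cts
  have hb0 : 0 ≤ b0 := (norm_nonneg _).trans (p0 0)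
  have hb1 : 0 ≤ b1 := (norm_nonneg _).trans (p1b 0)
  set P := cts p with hP
  set R := cts r with hR
  set P' := cts p1 with hP'
  set R' := cts r1 with hR'
  have dP : ∀ x, HasDerivAt P (P' x) x := hp.hasDerivAt_cts hp1
  have dR : ∀ x, HasDerivAt R (R' x) x := hr.hasDerivAt_cts hr1
  set q : ℝ → ℂ := fun x => P x ^ 4 + P x ^ 3 * R x + P x ^ 2 * R x ^ 2 + P x * R x ^ 3 + R x ^ 4
    with hq
  set q' : ℝ → ℂ := fun x =>
    (4 * P x ^ 3 + 3 * P x ^ 2 * R x + 2 * P x * R x ^ 2 + R x ^ 3) * P' x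
      + (P x ^ 3 + 2 * P x ^ 2 * R x + 3 * P x * R x ^ 2 + 4 * R x ^ 3) * R' x with hq'
  have bq : BddMeas q := (((((bp.pow 4)).add ((bp.pow 3).mul br)).add
    ((bp.pow 2).mul (br.pow 2))).add (bp.mul (br.pow 3))).add (br.pow 4)
  have mq' : Measurable q' := by
    have m1 := bp.meas
    have m2 := br.meas
    have m3 := bp1.meas
    have m4 := br1.meas
    fun_prop
  have hqb : ∀ x, ‖q' x‖ ≤ 20 * b0 ^ 3 * b1 := by
    intro x
    have n1 := p0 x
    have n2 := r0 x
    have n3 := p1b x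
    have n4 := r1b x
    calc ‖q' x‖ ≤ (4 * ‖P x‖ ^ 3 + 3 * ‖P x‖ ^ 2 * ‖R x‖ + 2 * ‖P x‖ * ‖R x‖ ^ 2 + ‖R x‖ ^ 3) * ‖P' x‖
          + (‖P x‖ ^ 3 + 2 * ‖P x‖ ^ 2 * ‖R x‖ + 3 * ‖P x‖ * ‖R x‖ ^ 2 + 4 * ‖R x‖ ^ 3) * ‖R' x‖ := by
          simp only [hq']
          refine (norm_add_le _ _).trans ?_
          rw [norm_mul, norm_mul]
          gcongr
          · refine (norm_add_le _ _).trans (add_le_add ((norm_add_le _ _).trans (add_le_add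
              ((norm_add_le _ _).trans (add_le_add ?_ ?_)) ?_)) ?_) <;> simp
          · refine (norm_add_le _ _).trans (add_le_add ((norm_add_le _ _).trans (add_le_add
              ((norm_add_le _ _).trans (add_le_add ?_ ?_)) ?_)) ?_) <;> simp
      _ ≤ (4 * b0 ^ 3 + 3 * b0 ^ 2 * b0 + 2 * b0 * b0 ^ 2 + b0 ^ 3) * b1
          + (b0 ^ 3 + 2 * b0 ^ 2 * b0 + 3 * b0 * b0 ^ 2 + 4 * b0 ^ 3) * b1 := by gcongr
      _ = _ := by ring
  have hqd : ∀ x, HasDerivAt q (q' x) x := by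
    intro x
    refine ((((((dP x).pow 4)).add (((dP x).pow 3).mul (dR x))).add
      (((dP x).pow 2).mul ((dR x).pow 2))).add ((dP x).mul ((dR x).pow 3))).add
      ((dR x).pow 4) |>.congr_deriv ?_
    simp only [hq', Pi.pow_apply]
    push_cast
    ring
  have hqr : ∀ x, conj (q x) = q x := by
    intro x
    simp only [hq, map_add, map_mul, map_pow, hpr, hrr]
  have e : quart p p - quart r r = mulL2 q (p - r) := by
    refine Lp.ext ?_
    filter_upwards [Lp.coeFn_sub (quart p p) (quart r r), hp.quart_self_coe, hr.quart_self_coe,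
      mulL2_coe bq (p - r), Lp.coeFn_sub p r, hp.cts_ae, hr.cts_ae] with x h1 h2 h3 h4 h5 h6 h7
    rw [h1, Pi.sub_apply, h2, h3, h4, h5, Pi.sub_apply, h6, h7]
    simp only [hq]
    ring
  have h1 := hD.re_inner_mulL2 bq ⟨mq', _, hqb⟩ hqd hqr
  have h2 : |(inner ℂ D (mulL2 q' D) : ℂ).re| ≤ 20 * b0 ^ 3 * b1 * ‖D‖ ^ 2 := by
    refine (Complex.abs_re_le_norm _).trans ((norm_inner_le_norm _ _).trans ?_)
    refine (mul_le_mul_of_nonneg_left (norm_mulL2_le mq' hqb D) (norm_nonneg _)).trans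
      (le_of_eq ?_)
    ring
  rw [e]
  rw [abs_le] at h2 ⊢
  constructor <;> linarith

/-- Grönwall, with integrating factor `(1 + t)^(-K)`. -/
theorem le_rpow_of_deriv_le {f f' : ℝ → ℝ} {K : ℝ} (hτ : 0 ≤ τ)
    (hd : ∀ t ∈ Set.Icc 0 τ, HasDerivWithinAt f (f' t) (Set.Icc 0 τ) t)
    (hle : ∀ t ∈ Set.Icc 0 τ, f' t ≤ K / (1 + t) * f t) : f τ ≤ f 0 * (1 + τ) ^ K := by
  have hp : ∀ t ∈ Set.Icc 0 τ, 0 < 1 + t := fun t ht => by linarith [ht.1]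
  set F : ℝ → ℝ := fun t => (1 + t) ^ (-K) * f t with hF
  have hFd : ∀ t ∈ Set.Icc 0 τ, HasDerivWithinAt F
      (1 * -K * (1 + t) ^ (-K - 1) * f t + (1 + t) ^ (-K) * f' t) (Set.Icc 0 τ) t := by
    intro t ht
    exact ((((hasDerivAt_id t).const_add 1).rpow_const
      (.inl (hp t ht).ne')).hasDerivWithinAt).mul (hd t ht)
  have hanti : AntitoneOn F (Set.Icc 0 τ) := by
    refine antitoneOn_of_hasDerivWithinAt_nonpos (convex_Icc 0 τ)
      (fun t ht => (hFd t ht).continuousWithinAt)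
      (fun t ht => (hFd t (interior_subset ht)).mono interior_subset) fun t ht => ?_
    have ht' := interior_subset ht
    have h1 := hle t ht'
    have h2 : 0 < (1 + t) ^ (-K) := Real.rpow_pos_of_pos (hp t ht') _
    rw [Real.rpow_sub_one (hp t ht').ne']
    have h3 := mul_le_mul_of_nonneg_left h1 h2.le
    have e : 1 * -K * ((1 + t) ^ (-K) / (1 + t)) * f t
        = -((1 + t) ^ (-K) * (K / (1 + t) * f t)) := by ring
    rw [e]
    linarith
  have h1 := hanti ⟨le_rfl, hτ⟩ ⟨hτ, le_rfl⟩ hτ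
  simp only [hF, add_zero, Real.one_rpow, one_mul] at h1
  have h2 : 0 < (1 + τ) ^ K := Real.rpow_pos_of_pos (by linarith) _
  have h3 := mul_le_mul_of_nonneg_right h1 h2.le
  have e : (1 + τ) ^ (-K) * f τ * (1 + τ) ^ K = f τ := by
    rw [Real.rpow_neg (by linarith)]
    field_simp
  rwa [e] at h3

theorem symbol_scale {c : ℝ} (hc : 0 < c) (t η : ℝ) : symbol (c ^ 5 * t) (c⁻¹ * η) = symbol t η := by
  unfold symbol
  have : c ^ 5 * t * (2 * Real.pi * (c⁻¹ * η)) ^ 5 = t * (2 * Real.pi * η) ^ 5 := by field_simp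
  rw [this]

theorem WD.quart_scale {p q : L2} (h : WD p q) {c : ℝ} (hc : 0 < c) :
    FifthKdV.quart ((c : ℂ) • FifthKdV.dil c p) ((c : ℂ) • FifthKdV.dil c p)
      = (c : ℂ) ^ 5 • FifthKdV.dil c (FifthKdV.quart p p) := by
  refine Lp.ext ?_
  have hd := (h.dil hc)
  filter_upwards [(hd.smul (c : ℂ)).quart_self_coe, ae_comp_mul h.quart_self_coe hc.ne',
    dil_coe hc.ne' (FifthKdV.quart p p),
    Lp.coeFn_smul ((c : ℂ) ^ 5) (FifthKdV.dil c (FifthKdV.quart p p))] with x h1 h2 h3 h4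
  rw [h1, h4, Pi.smul_apply, h3, h2, hd.cts_smul, h.cts_dil hc, smul_eq_mul, mul_pow]

theorem norm_mulL2_symbol (t : ℝ) (p : L2) : ‖mulL2 (symbol t) p‖ = ‖p‖ := by
  have := inner_mulL2_symbol t p p
  rw [inner_self_eq_norm_sq_to_K, inner_self_eq_norm_sq_to_K] at this
  norm_cast at this
  exact (pow_left_inj₀ (norm_nonneg _) (norm_nonneg _) two_ne_zero).mp this

/-- Energy estimate for the primitive of `u_c - u`, where `u_c = c u(c⁵t, cx)` solves the same
equation. The initial value is controlled by `exists_scaling_primitive`, and the rate of growth by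
the decay assumption. -/
theorem Evol.norm_scaling_difference_le (h : Evol τ u u1 u2) (hτ : 0 ≤ τ) {w : L2}
    (hw : w =ᵐ[volume] fun x => (x : ℂ) * u 0 x) {B : ℝ} (hB0 : 0 ≤ B) (hB : 20 * B ^ 4 ≤ 1)
    (hdec : ∀ s ∈ Set.Icc 0 τ, ∀ β : ℝ, 0 < β → β ^ 5 = 1 + s →
      ∀ x, ‖cts (u s) x‖ ≤ B / β ∧ ‖cts (u1 s) x‖ ≤ B / β ^ 2)
    {k : ℝ → L2} (hk0 : k 0 = 0)
    (hkd : ∀ t ∈ Set.Icc 0 τ, HasDerivWithinAt k (fluxRate u t) (Set.Icc 0 τ) t)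
    (hk : ∀ t ∈ Set.Icc 0 τ,
      gprof u t =ᵐ[volume] fun η => (𝓕 (u 0) : L2) η + freq η * k t η)
    {c : ℝ} (hc : 0 < c) (hc1 : c < 1) :
    ‖(c : ℂ)⁻¹ • dil c⁻¹ (k (c ^ 5 * τ)) - k τ‖
      ≤ (1 - c) * (c ^ 2)⁻¹ * (‖w‖ * (1 + (1 + τ) ^ (1 / 10 : ℝ))) := by
  have hl : (0 : ℝ) ∈ Set.Icc 0 τ := ⟨le_rfl, hτ⟩
  have hr : τ ∈ Set.Icc 0 τ := ⟨hτ, le_rfl⟩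
  have hc0 := hc.ne'
  have hcc : (c : ℂ) ≠ 0 := by exact_mod_cast hc0
  have hc5 : c ^ 5 ≤ 1 := pow_le_one₀ hc.le hc1.le
  have hcm : Set.MapsTo (fun t => c ^ 5 * t) (Set.Icc 0 τ) (Set.Icc 0 τ) := fun t ht =>
    ⟨by have := ht.1; positivity, (mul_le_of_le_one_left ht.1 hc5).trans ht.2⟩
  obtain ⟨D0, hD0, hD0n⟩ := exists_scaling_primitive (h.wd1 0 hl) hw hc hc1
  -- The transformed primitive of `u_c - u`, in profile form. The factor `c⁻¹` turns `freq η` into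
  -- `freq (c⁻¹ η)`, so `freq * H` is the difference of the two profiles.
  set H : ℝ → L2 := fun t => 𝓕 D0 + (c : ℂ)⁻¹ • dil c⁻¹ (k (c ^ 5 * t)) - k t with hH
  have hkey : ∀ t ∈ Set.Icc 0 τ,
      ∀ᵐ η, freq η * H t η = gprof u (c ^ 5 * t) (c⁻¹ * η) - gprof u t η := by
    intro t ht
    have e0 : (𝓕 ((c : ℂ) • dil c (u 0) - u 0) : L2) = dil c⁻¹ (𝓕 (u 0)) - 𝓕 (u 0) := by
      rw [fourier_sub_L2, FourierTransform.fourier_smul, fourier_dil hc,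
        smul_inv_smul₀ hcc]
    unfold WD at hD0
    rw [e0] at hD0
    filter_upwards [hD0, Lp.coeFn_sub (dil c⁻¹ (𝓕 (u 0))) (𝓕 (u 0) : L2),
      dil_coe (inv_ne_zero hc0) (𝓕 (u 0)), hk t ht,
      ae_comp_mul (hk _ (hcm ht)) (inv_ne_zero hc0),
      Lp.coeFn_sub (𝓕 D0 + (c : ℂ)⁻¹ • dil c⁻¹ (k (c ^ 5 * t)) : L2) (k t),
      Lp.coeFn_add (𝓕 D0 : L2) ((c : ℂ)⁻¹ • dil c⁻¹ (k (c ^ 5 * t)) : L2),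
      Lp.coeFn_smul (c : ℂ)⁻¹ (dil c⁻¹ (k (c ^ 5 * t))),
      dil_coe (inv_ne_zero hc0) (k (c ^ 5 * t))] with η e1 e2 e3 e4 e5 e6 e7 e8 e9
    rw [e2, Pi.sub_apply, e3] at e1
    rw [e4, e5]
    simp only [hH]
    rw [e6, Pi.sub_apply, e7, Pi.add_apply, e8, Pi.smul_apply, e9, smul_eq_mul, freq_mul]
    push_cast
    linear_combination -e1
  set uc : ℝ → L2 := fun t => (c : ℂ) • dil c (u (c ^ 5 * t)) with huc
  set D : ℝ → L2 := fun t => 𝓕⁻ (mulL2 (symbol (-t)) (H t)) with hDdef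
  have hHD : ∀ t, H t = mulL2 (symbol t) (𝓕 (D t)) := by
    intro t
    simp only [hDdef]
    rw [fourier_fourierInv, mulL2_mulL2 (bddMeas_symbol _) (bddMeas_symbol _)]
    simp_rw [mul_comm (symbol t _), symbol_neg_mul]
    rw [mulL2_one]
  have hDn : ∀ t, ‖D t‖ = ‖H t‖ := fun t => by
    rw [hHD t, norm_mulL2_symbol, Lp.norm_fourier_eq]
  have hDWD : ∀ t ∈ Set.Icc 0 τ, WD (D t) (uc t - u t) := by
    intro t ht
    have e0 : (𝓕 (uc t - u t) : L2) = dil c⁻¹ (𝓕 (u (c ^ 5 * t))) - 𝓕 (u t) := by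
      rw [fourier_sub_L2, huc, FourierTransform.fourier_smul, fourier_dil hc,
        smul_inv_smul₀ hcc]
    have e1 : (𝓕 (D t) : L2) = mulL2 (symbol (-t)) (H t) := fourier_fourierInv _
    unfold WD
    rw [e0, e1]
    filter_upwards [Lp.coeFn_sub (dil c⁻¹ (𝓕 (u (c ^ 5 * t)))) (𝓕 (u t) : L2),
      dil_coe (inv_ne_zero hc0) (𝓕 (u (c ^ 5 * t))), hkey t ht,
      mulL2_coe (bddMeas_symbol (-t)) (H t), mulL2_coe (bddMeas_symbol t) (𝓕 (u t)),
      ae_comp_mul (mulL2_coe (bddMeas_symbol (c ^ 5 * t)) (𝓕 (u (c ^ 5 * t))))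
        (inv_ne_zero hc0)] with η h1 h2 h3 h4 h5 h6
    rw [gprof, gprof, h5, h6, symbol_scale hc] at h3
    rw [h1, Pi.sub_apply, h2, h4]
    linear_combination (-symbol (-t) η) * h3 - ((𝓕 (u (c ^ 5 * t)) : L2) (c⁻¹ * η)
      - (𝓕 (u t) : L2) η) * symbol_neg_mul t η
  have hHd : ∀ t ∈ Set.Icc 0 τ, HasDerivWithinAt H
      ((-(1 / 5) : ℂ) • mulL2 (symbol t) (𝓕 (quart (uc t) (uc t) - quart (u t) (u t))))
      (Set.Icc 0 τ) t := by
    intro t ht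
    have d1 : HasDerivWithinAt (fun t : ℝ => c ^ 5 * t) (c ^ 5) (Set.Icc 0 τ) t := by
      simpa using ((hasDerivAt_id t).const_mul (c ^ 5)).hasDerivWithinAt
    have d2 := (hkd _ (hcm ht)).scomp t d1 hcm
    have d3 : HasDerivWithinAt (fun t => (c : ℂ)⁻¹ • dil c⁻¹ (k (c ^ 5 * t)))
        ((c : ℂ)⁻¹ • dil c⁻¹ (c ^ 5 • fluxRate u (c ^ 5 * t))) (Set.Icc 0 τ) t :=
      (((c : ℂ)⁻¹ • dil c⁻¹).restrictScalars ℝ).hasFDerivAt.comp_hasDerivWithinAt t d2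
    refine ((d3.const_add (𝓕 D0)).sub (hkd t ht)).congr_deriv ?_
    have ht' := hcm ht
    have e1 : (𝓕 (quart (uc t) (uc t) - quart (u t) (u t)) : L2)
        = (c : ℂ) ^ 5 • (c : ℂ)⁻¹ • dil c⁻¹ (𝓕 (quart (u (c ^ 5 * t)) (u (c ^ 5 * t))))
          - 𝓕 (quart (u t) (u t)) := by
      rw [fourier_sub_L2, huc, (h.wd1 _ ht').quart_scale hc,
        FourierTransform.fourier_smul, fourier_dil hc]
    have e2 : dil c⁻¹ (mulL2 (symbol (c ^ 5 * t)) (𝓕 (quart (u (c ^ 5 * t)) (u (c ^ 5 * t)))))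
        = mulL2 (symbol t) (dil c⁻¹ (𝓕 (quart (u (c ^ 5 * t)) (u (c ^ 5 * t))))) := by
      set Q : L2 := 𝓕 (quart (u (c ^ 5 * t)) (u (c ^ 5 * t)))
      refine Lp.ext ?_
      filter_upwards [dil_coe (inv_ne_zero hc0) (mulL2 (symbol (c ^ 5 * t)) Q),
        ae_comp_mul (mulL2_coe (bddMeas_symbol (c ^ 5 * t)) Q) (inv_ne_zero hc0),
        mulL2_coe (bddMeas_symbol t) (dil c⁻¹ Q), dil_coe (inv_ne_zero hc0) Q] with η h1 h2 h3 h4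
      rw [h1, h2, h3, h4, symbol_scale hc]
    have e3 : ∀ p : L2, (c ^ 5 : ℝ) • p = ((c : ℂ) ^ 5) • p := fun p => by
      rw [← Complex.ofReal_pow]
      rfl
    rw [e1, fluxRate, fluxRate, e3, map_sub, map_smul, map_smul, map_smul, map_smul, smul_sub]
    congr 1
    rw [e2, smul_smul, smul_smul, smul_smul, smul_smul]
    congr 1
    ring
  have hnd : ∀ t ∈ Set.Icc 0 τ, HasDerivWithinAt (fun s => ‖H s‖ ^ 2)
      (-(2 / 5) * (inner ℂ (D t) (quart (uc t) (uc t) - quart (u t) (u t)) : ℂ).re)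
      (Set.Icc 0 τ) t := by
    intro t ht
    refine (hasDerivWithinAt_norm_sq (hHd t ht)).congr_deriv ?_
    conv_lhs => rw [hHD t]
    rw [inner_smul_right, inner_mulL2_symbol, inner_fourier,
      show (-(1 / 5) : ℂ) = ((-(1 / 5) : ℝ) : ℂ) by push_cast; ring, Complex.re_ofReal_mul]
    ring
  have hle : ∀ t ∈ Set.Icc 0 τ,
      -(2 / 5) * (inner ℂ (D t) (quart (uc t) (uc t) - quart (u t) (u t)) : ℂ).re
        ≤ 1 / 5 / (1 + t) * ‖H t‖ ^ 2 := by
    intro t ht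
    have ht' := hcm ht
    have ht0 : 0 < 1 + t := by linarith [ht.1]
    have exβ : ∀ z : ℝ, 0 < z → ∃ β : ℝ, 0 < β ∧ β ^ 5 = z := fun z hz =>
      ⟨z ^ (1 / 5 : ℝ), Real.rpow_pos_of_pos hz _, by
        rw [← Real.rpow_natCast, ← Real.rpow_mul hz.le]; norm_num⟩
    obtain ⟨β, hβ0, hβ⟩ := exβ (1 + t) ht0
    obtain ⟨γ, hγ0, hγ⟩ := exβ (1 + c ^ 5 * t) (by have := ht.1; positivity)
    -- Makes the decay assumption scale invariant: with `c/γ ≤ 1/β`, the bounds at time `c⁵t` give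
    -- those of `u_c` at time `t`.
    have hγβ : c * β ≤ γ := by
      refine (pow_le_pow_iff_left₀ (by positivity) hγ0.le (n := 5) (by norm_num)).mp ?_
      rw [mul_pow, hβ, hγ]
      linarith
    have hcγ : c / γ ≤ 1 / β := by
      rw [div_le_div_iff₀ hγ0 hβ0]; linarith
    have hw1 := (h.wd1 _ ht').dil hc
    have hw2 := ((h.wd2 _ ht').dil hc).smul (c : ℂ)
    have dt := hdec t ht β hβ0 hβ
    have ds := hdec _ ht' γ hγ0 hγ
    have nc : ‖(c : ℂ)‖ = c := by rw [Complex.norm_real, Real.norm_of_nonneg hc.le]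
    have hest := abs_re_inner_quart_sub_le (hw1.smul (c : ℂ)) (hw2.smul (c : ℂ))
      (h.wd1 t ht) (h.wd2 t ht) (hDWD t ht) (b0 := B / β) (b1 := B / β ^ 2)
      (fun x => by
        rw [hw1.cts_smul, (h.wd1 _ ht').cts_dil hc, map_mul, Complex.conj_ofReal,
          conj_cts (h.wd1 _ ht') (h.real _ ht')])
      (conj_cts (h.wd1 t ht) (h.real t ht))
      (fun x => by
        rw [hw1.cts_smul, (h.wd1 _ ht').cts_dil hc, norm_mul, nc]
        calc _ ≤ c * (B / γ) := by gcongr; exact (ds _).1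
          _ = B * (c / γ) := by ring
          _ ≤ B * (1 / β) := by gcongr
          _ = _ := by ring)
      (fun x => (dt x).1)
      (fun x => by
        rw [hw2.cts_smul, ((h.wd2 _ ht').dil hc).cts_smul, (h.wd2 _ ht').cts_dil hc, norm_mul,
          norm_mul, nc]
        calc _ ≤ c * (c * (B / γ ^ 2)) := by gcongr; exact (ds _).2
          _ = B * (c / γ) ^ 2 := by ring
          _ ≤ B * (1 / β) ^ 2 := by gcongr
          _ = _ := by ring)
      (fun x => (dt x).2)
    rw [hDn] at hest
    have e : 10 * (B / β) ^ 3 * (B / β ^ 2) = 10 * B ^ 4 / (1 + t) := by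
      rw [← hβ]; field_simp
    rw [e] at hest
    have h1 := (abs_le.mp hest).1
    -- Here `20B⁴ ≤ 1` enters. It gives `‖H‖²` the growth exponent `1/5`, hence `‖H‖` the exponent
    -- `1/10`.
    have h2 : 10 * B ^ 4 / (1 + t) * ‖H t‖ ^ 2 ≤ (1 / 2) / (1 + t) * ‖H t‖ ^ 2 := by
      gcongr; linarith
    have e2 : 1 / 5 / (1 + t) * ‖H t‖ ^ 2 = 2 / 5 * ((1 / 2) / (1 + t) * ‖H t‖ ^ 2) := by ring
    rw [e2]
    linarith
  have hfin := le_rpow_of_deriv_le hτ hnd hle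
  have hH0 : H 0 = 𝓕 D0 := by simp [hH, hk0]
  rw [hH0, Lp.norm_fourier_eq] at hfin
  have hp : 0 < (1 + τ) := by linarith
  have hHτ : ‖H τ‖ ≤ (1 - c) * (c ^ 2)⁻¹ * ‖w‖ * (1 + τ) ^ (1 / 10 : ℝ) := by
    refine (sq_le_sq₀ (norm_nonneg _) (by positivity)).mp (hfin.trans ?_)
    rw [mul_pow, ← Real.rpow_natCast ((1 + τ) ^ (1 / 10 : ℝ)), ← Real.rpow_mul hp.le]
    norm_num
    gcongr
  have e : (c : ℂ)⁻¹ • dil c⁻¹ (k (c ^ 5 * τ)) - k τ = H τ - 𝓕 D0 := by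
    simp only [hH]
    abel
  rw [e]
  refine (norm_sub_le _ _).trans ?_
  rw [Lp.norm_fourier_eq]
  linarith

end

/-! ### Infinitesimal dilations -/

theorem norm_dil_le {c : ℝ} (hc : 0 < c) (hc1 : c ≤ 1) (p : L2) : ‖dil c p‖ ≤ c⁻¹ * ‖p‖ := by
  have h1 : 1 ≤ c⁻¹ := (one_le_inv₀ hc).mpr hc1
  rw [← ENNReal.ofReal_le_ofReal_iff (by positivity), norm_eq_of_ae (dil_coe hc.ne' p),
    eLpNorm_comp_mul hc.ne', ENNReal.ofReal_mul (by positivity), norm_eq_of_ae (ae_eq_refl p),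
    abs_of_pos (by positivity)]
  gcongr
  refine (ENNReal.rpow_le_rpow_of_exponent_le (y := (1 / (2 : ℝ≥0∞)).toReal) (z := 1)
    (by simpa using h1) (by norm_num)).trans_eq (ENNReal.rpow_one _)

theorem integral_dil_mul {c : ℝ} (hc : 0 < c) (p : L2) (φ : 𝓢(ℝ, ℂ)) :
    ∫ η, ((c : ℂ)⁻¹ • dil c⁻¹ p : L2) η * φ η = ∫ η, p η * φ (c * η) := by
  have e : ∫ η, ((c : ℂ)⁻¹ • dil c⁻¹ p : L2) η * φ η
      = ∫ η, (fun z => (c : ℂ)⁻¹ * (p z * φ (c * z))) (c⁻¹ * η) := by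
    refine integral_congr_ae ?_
    filter_upwards [Lp.coeFn_smul (c : ℂ)⁻¹ (dil c⁻¹ p), dil_coe (inv_ne_zero hc.ne') p]
      with η h1 h2
    rw [h1, Pi.smul_apply, h2, smul_eq_mul, mul_assoc, mul_inv_cancel_left₀ hc.ne']
  rw [e, Measure.integral_comp_mul_left (fun z => (c : ℂ)⁻¹ * (p z * φ (c * z))),
    integral_const_mul, inv_inv, abs_of_pos hc, Complex.real_smul, ← mul_assoc,
    mul_inv_cancel₀ (by exact_mod_cast hc.ne'), one_mul]

theorem schwartz_mul_deriv_le (φ : 𝓢(ℝ, ℂ)) :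
    ∃ C, 0 ≤ C ∧ ∀ y : ℝ, ‖(y : ℂ) * deriv φ y‖ ≤ C * (1 + y ^ 2)⁻¹ := by
  obtain ⟨C1, h1, H1⟩ := (SchwartzMap.derivCLM ℝ ℂ φ).decay 1 0
  obtain ⟨C3, h3, H3⟩ := (SchwartzMap.derivCLM ℝ ℂ φ).decay 3 0
  refine ⟨C1 + C3, by positivity, fun y => ?_⟩
  have a1 := H1 y
  have a3 := H3 y
  rw [norm_iteratedFDeriv_zero, SchwartzMap.derivCLM_apply, Real.norm_eq_abs] at a1 a3
  rw [norm_mul, Complex.norm_real, Real.norm_eq_abs, ← div_eq_mul_inv, le_div_iff₀ (by positivity),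
    ← sq_abs]
  nlinarith

/-- Differentiability in the dilation parameter is placed on the test function, since `p` is only in
`L²`. -/
theorem hasDerivAt_integral_mul_comp_mul (p : L2) (φ : 𝓢(ℝ, ℂ)) :
    HasDerivAt (fun c : ℝ => ∫ η, p η * φ (c * η)) (∫ η, p η * (η * deriv φ η)) 1 := by
  obtain ⟨C, hC, hb⟩ := schwartz_mul_deriv_le φ
  have hs : Set.Ioo (1 / 2 : ℝ) 2 ∈ 𝓝 (1 : ℝ) := Ioo_mem_nhds (by norm_num) (by norm_num)
  have hdc : Continuous (deriv φ) := (SchwartzMap.derivCLM ℝ ℂ φ).continuous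
  have := (hasDerivAt_integral_of_dominated_loc_of_deriv_le (μ := volume) (𝕜 := ℝ)
    (F := fun (c : ℝ) (η : ℝ) => p η * φ (c * η))
    (F' := fun (c : ℝ) (η : ℝ) => p η * (η * deriv φ (c * η))) (x₀ := 1)
    (bound := fun η => 8 * C * (‖p η‖ ^ 2 + (1 + η ^ 2)⁻¹)) hs ?_ ?_ ?_ ?_ ?_ ?_).2
  · simpa using this
  · exact .of_forall fun c => (Lp.aestronglyMeasurable p).mul
      (φ.continuous.comp (by fun_prop)).aestronglyMeasurable
  · simpa using integrable_mul_schwartz p φ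
  · exact (Lp.aestronglyMeasurable p).mul (by fun_prop : Continuous fun η : ℝ =>
      (η : ℂ) * deriv φ (1 * η)).aestronglyMeasurable
  · refine .of_forall fun η c hc => ?_
    have hc0 : 0 < c := by linarith [hc.1]
    have h1 : ‖(η : ℂ) * deriv φ (c * η)‖ ≤ 8 * C * (1 + η ^ 2)⁻¹ := by
      have e : (η : ℂ) * deriv φ (c * η) = (c : ℂ)⁻¹ * (((c * η : ℝ) : ℂ) * deriv φ (c * η)) := by
        have : (c : ℂ) ≠ 0 := by exact_mod_cast hc0.ne'
        push_cast
        field_simp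
      have h2 : c⁻¹ ≤ 2 := by
        rw [inv_le_comm₀ hc0 (by norm_num)]; linarith [hc.1]
      have h3 : (1 + (c * η) ^ 2)⁻¹ ≤ 4 * (1 + η ^ 2)⁻¹ := by
        rw [← div_eq_mul_inv, inv_eq_one_div, div_le_div_iff₀ (by positivity) (by positivity)]
        have : 1 / 4 ≤ c ^ 2 := by nlinarith [hc.1]
        nlinarith [sq_nonneg η]
      rw [e, norm_mul, norm_inv, Complex.norm_real, Real.norm_of_nonneg hc0.le]
      calc _ ≤ 2 * (C * (4 * (1 + η ^ 2)⁻¹)) := by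
            gcongr
            exact (hb _).trans (by gcongr)
        _ = _ := by ring
    have h4 : (1 + η ^ 2)⁻¹ ≤ 1 := inv_le_one_of_one_le₀ (by nlinarith [sq_nonneg η])
    have h5 : 0 ≤ (1 + η ^ 2)⁻¹ := by positivity
    rw [norm_mul]
    calc _ ≤ ‖p η‖ * (8 * C * (1 + η ^ 2)⁻¹) := by gcongr
      _ = 8 * C * (‖p η‖ * (1 + η ^ 2)⁻¹) := by ring
      _ ≤ _ := by
        gcongr
        nlinarith [sq_nonneg (‖p η‖ - (1 + η ^ 2)⁻¹), sq_nonneg (‖p η‖ + (1 + η ^ 2)⁻¹)]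
  · exact ((integrable_norm_sq p).add integrable_inv_one_add_sq).const_mul _
  · refine .of_forall fun η c _ => ?_
    have h1 : HasDerivAt (fun c : ℝ => φ (c * η)) (η • deriv φ (c * η)) c := by
      have h2 : HasDerivAt (fun c : ℝ => c * η) η c := by simpa using (hasDerivAt_id c).mul_const η
      exact (φ.differentiableAt.hasDerivAt).scomp c h2
    exact (h1.const_mul _).congr_deriv (by rw [Complex.real_smul])

theorem norm_toLp_le_of_norm_le {φ ψ : 𝓢(ℝ, ℂ)} (h : ∀ x, ‖φ x‖ ≤ ‖ψ x‖) :
    ‖(φ.toLp 2 : L2)‖ ≤ ‖(ψ.toLp 2 : L2)‖ := by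
  refine Lp.norm_le_norm_of_ae_le ?_
  filter_upwards [φ.coeFn_toLp 2, ψ.coeFn_toLp 2] with x h1 h2
  rw [h1, h2]
  exact h x

theorem integral_sub_mul_schwartz (p q : L2) (χ : 𝓢(ℝ, ℂ)) :
    ∫ η, (p - q : L2) η * (χ.toLp 2 : L2) η = (∫ η, p η * χ η) - ∫ η, q η * χ η := by
  rw [integral_mul_toLp, ← integral_sub (integrable_mul_schwartz p χ)
    (integrable_mul_schwartz q χ)]
  refine integral_congr_ae ?_
  filter_upwards [Lp.coeFn_sub p q] with η hη
  rw [hη, Pi.sub_apply, sub_mul]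

theorem exists_schwartz_dil {c : ℝ} (hc : 0 < c) (hc1 : c ≤ 1) (φ : 𝓢(ℝ, ℂ)) :
    ∃ ψ : 𝓢(ℝ, ℂ), (∀ x, ψ x = φ (c * x)) ∧
      ‖(ψ.toLp 2 : L2)‖ ≤ c⁻¹ * ‖(φ.toLp 2 : L2)‖ := by
  have h : ∀ x, schwartzDil (Units.mk0 c hc.ne') φ x = φ (c * x) := fun x => by
    rw [schwartzDil_apply, Units.val_mk0, mul_comm]
  refine ⟨_, h, (le_of_eq (norm_L2_eq_of_ae ?_)).trans (norm_dil_le hc hc1 _)⟩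
  have hae : (φ.toLp 2 : L2) =ᵐ[volume] φ := φ.coeFn_toLp 2
  filter_upwards [(schwartzDil (Units.mk0 c hc.ne') φ).coeFn_toLp 2,
    dil_coe hc.ne' (φ.toLp 2 : L2), ae_comp_mul hae hc.ne'] with x h1 h2 h3
  rw [h1, h2, h3, h]

theorem norm_integral_mul_dil_sub_le {c δ : ℝ} (hc : 0 < c) (hc1 : c ≤ 1) {p q : L2}
    (hδ : ‖(c : ℂ)⁻¹ • dil c⁻¹ q - p‖ ≤ δ) (φ : 𝓢(ℝ, ℂ)) :
    ‖(∫ η, p η * φ (c * η)) - ∫ η, p η * φ η‖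
      ≤ δ * ‖(φ.toLp 2 : L2)‖ + ‖q - p‖ * (c⁻¹ * ‖(φ.toLp 2 : L2)‖) := by
  obtain ⟨ψ, hψ, hψn⟩ := exists_schwartz_dil hc hc1 φ
  have e : (∫ η, p η * φ (c * η)) - ∫ η, p η * φ η
      = (∫ η, ((c : ℂ)⁻¹ • dil c⁻¹ q - p : L2) η * (φ.toLp 2 : L2) η)
        - ∫ η, (q - p : L2) η * (ψ.toLp 2 : L2) η := by
    rw [integral_sub_mul_schwartz, integral_sub_mul_schwartz, integral_dil_mul hc]
    simp only [hψ]
    ring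
  rw [e]
  refine (norm_sub_le _ _).trans (add_le_add ((norm_integral_mul_le _ _).trans ?_)
    ((norm_integral_mul_le _ _).trans ?_))
  · exact mul_le_mul_of_nonneg_right hδ (norm_nonneg _)
  · exact mul_le_mul_of_nonneg_left hψn (norm_nonneg _)

/-- Divide the hypothesis by `1 - c` and let `c → 1` against `φ`. The quotient splits into the
dilation of the fixed `k τ`, whose limit is the left side, and the time difference, whose limit
`5τN` comes from `c⁵`. -/
theorem norm_integral_mul_deriv_le_of_scaling {k : ℝ → L2} {N : L2} {τ M : ℝ} (hτ : 0 ≤ τ)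
    (hk : HasDerivWithinAt k N (Set.Icc 0 τ) τ)
    (hM : ∀ c : ℝ, 0 < c → c < 1 →
      ‖(c : ℂ)⁻¹ • dil c⁻¹ (k (c ^ 5 * τ)) - k τ‖ ≤ (1 - c) * (c ^ 2)⁻¹ * M) (φ : 𝓢(ℝ, ℂ)) :
    ‖∫ η, k τ η * (η * deriv φ η)‖ ≤ (M + 5 * τ * ‖N‖) * ‖(φ.toLp 2 : L2)‖ := by
  set S : Set ℝ := Set.Ioo 0 1
  have hS : (1 : ℝ) ∉ S := by simp [S]
  have hneb : (𝓝[S] (1 : ℝ)).NeBot := right_nhdsWithin_Ioo_neBot one_pos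
  have hA := (hasDerivWithinAt_iff_tendsto_slope' hS).mp
    (hasDerivAt_integral_mul_comp_mul (k τ) φ).hasDerivWithinAt
  have hK : HasDerivWithinAt (fun c : ℝ => k (c ^ 5 * τ)) ((5 * τ) • N) S 1 := by
    have h1 : HasDerivWithinAt (fun c : ℝ => c ^ 5 * τ) (5 * τ) S 1 := by
      simpa using (((hasDerivAt_id (1 : ℝ)).pow 5).mul_const τ).hasDerivWithinAt
    refine HasDerivWithinAt.scomp_of_eq (y := τ) 1 hk h1 (fun c hc => ?_) (by simp)
    exact ⟨by have := hc.1; positivity,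
      mul_le_of_le_one_left hτ (pow_le_one₀ hc.1.le hc.2.le)⟩
  have hK' := (hasDerivWithinAt_iff_tendsto_slope' hS).mp hK
  have hid : Tendsto (fun c : ℝ => c) (𝓝[S] 1) (𝓝 1) := tendsto_id.mono_left nhdsWithin_le_nhds
  have hR : Tendsto (fun c : ℝ => (c ^ 2)⁻¹ * M * ‖(φ.toLp 2 : L2)‖
      + ‖slope (fun c : ℝ => k (c ^ 5 * τ)) 1 c‖ * (c⁻¹ * ‖(φ.toLp 2 : L2)‖)) (𝓝[S] 1)
      (𝓝 ((1 ^ 2)⁻¹ * M * ‖(φ.toLp 2 : L2)‖ + ‖(5 * τ) • N‖ * (1⁻¹ * ‖(φ.toLp 2 : L2)‖))) :=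
    ((((hid.pow 2).inv₀ (by norm_num)).mul_const _).mul_const _).add
      (hK'.norm.mul ((hid.inv₀ (by norm_num)).mul_const _))
  have hle := le_of_tendsto_of_tendsto hA.norm hR ?_
  · rw [norm_smul, Real.norm_of_nonneg (by positivity)] at hle
    refine hle.trans (le_of_eq ?_)
    ring
  filter_upwards [self_mem_nhdsWithin] with c hc
  have hc0 : 0 < c := hc.1
  have h1c : 0 < 1 - c := sub_pos.mpr hc.2
  have hmain := norm_integral_mul_dil_sub_le hc0 hc.2.le (hM c hc0 hc.2) φ
  rw [slope_def_module, slope_def_module, norm_smul, norm_smul, norm_inv, Real.norm_eq_abs,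
    abs_sub_comm, abs_of_pos h1c]
  simp only [one_mul, one_pow]
  refine (mul_le_mul_of_nonneg_left hmain (by positivity)).trans (le_of_eq ?_)
  rw [mul_add]
  congr 1
  · field_simp
  · ring

/-! ### The weighted norm of the profile -/

theorem temperate_resolvent (e : ℝ) : Function.HasTemperateGrowth (resolvent e) := by
  have h1 : Function.HasTemperateGrowth fun x : ℝ => ((1 + ‖x‖ ^ 2) ^ (-1 : ℝ) : ℝ) :=
    Function.hasTemperateGrowth_one_add_norm_sq_rpow ℝ (-1)
  have h2 : Function.HasTemperateGrowth fun η : ℝ => e * (2 * Real.pi) * η := by fun_prop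
  have h3 : Function.HasTemperateGrowth fun x : ℝ => (x : ℂ) := by fun_prop
  have h := h3.comp (h1.comp h2)
  convert h using 1
  funext η
  simp only [resolvent, norm_freq, Function.comp, Real.rpow_neg_one, Real.norm_eq_abs, sq_abs,
    mul_pow]
  ring_nf

/-- The hypothesis bounds the frequency derivative of `𝓕 f` by duality. The resolvent symbol, here a
weight in `x`, first makes multiplication by `freq` bounded; removing it is Fatou's lemma. -/
theorem weightedNorm_le_of_weak {f : L2} {W : ℝ} (hW : 0 ≤ W)
    (h : ∀ φ : 𝓢(ℝ, ℂ), ‖∫ η, (𝓕 f : L2) η * deriv φ η‖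
      ≤ 2 * Real.pi * W * ‖(φ.toLp 2 : L2)‖) :
    weightedNorm f ≤ ENNReal.ofReal W := by
  have hnorm : ∀ e : ℝ, 0 < e →
      ‖mulL2 (fun η => freq η * resolvent e η) f‖ ≤ 2 * Real.pi * W := by
    intro e he
    refine norm_le_of_schwartz (by positivity) fun χ => ?_
    set ρ : 𝓢(ℝ, ℂ) := SchwartzMap.smulLeftCLM ℂ (resolvent e) χ with hρ
    have hρa : ∀ x, ρ x = resolvent e x * χ x := fun x => by
      rw [hρ, SchwartzMap.smulLeftCLM_apply_apply (temperate_resolvent e), smul_eq_mul]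
    have h1 := h (𝓕⁻ ρ)
    have h2 : ∫ η, (𝓕 f : L2) η * deriv (𝓕⁻ ρ : 𝓢(ℝ, ℂ)) η
        = ∫ x, mulL2 (fun η => freq η * resolvent e η) f x * χ x := by
      have e1 := integral_fourier_mul f (SchwartzMap.derivCLM ℝ ℂ (𝓕⁻ ρ))
      simp only [SchwartzMap.derivCLM_apply, fourier_deriv_schwartz] at e1
      rw [e1, FourierTransform.fourier_fourierInv_eq]
      refine integral_congr_ae ?_
      filter_upwards [mulL2_coe (bddMeas_freq_resolvent he) f] with x hx
      rw [hx, hρa]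
      ring
    have h3 : ‖((𝓕⁻ ρ : 𝓢(ℝ, ℂ)).toLp 2 : L2)‖ = ‖(ρ.toLp 2 : L2)‖ := by
      rw [← SchwartzMap.toLp_fourierInv_eq, norm_fourierInv_L2]
    rw [← h2]
    refine h1.trans ?_
    rw [h3]
    refine mul_le_mul_of_nonneg_left (norm_toLp_le_of_norm_le fun x => ?_) (by positivity)
    rw [hρa, norm_mul]
    exact mul_le_of_le_one_left (norm_nonneg _) (norm_resolvent_le e x)
  have hFatou : eLpNorm (fun x => freq x * f x) 2 volume ≤ ENNReal.ofReal (2 * Real.pi * W) := by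
    have hpos : ∀ n : ℕ, (0 : ℝ) < 1 / ((n : ℝ) + 1) := fun n => by positivity
    refine (Lp.eLpNorm_lim_le_liminf_eLpNorm (f := fun n : ℕ => ⇑(mulL2 (fun η => freq η *
      resolvent (1 / ((n : ℝ) + 1)) η) f)) (fun n => Lp.aestronglyMeasurable _) _ ?_).trans ?_
    · have hall := ae_all_iff.mpr fun n : ℕ => mulL2_coe (bddMeas_freq_resolvent (hpos n)) f
      filter_upwards [hall] with x hx
      simp only [hx]
      have := tendsto_resolvent (l := 𝓝 0) le_rfl x
      have h2 := ((this.comp tendsto_one_div_add_atTop_nhds_zero_nat).const_mul (freq x)).mul_const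
        (f x)
      simpa using h2
    · refine liminf_le_of_le ⟨0, by simp⟩ fun b hb => ?_
      obtain ⟨n, hn⟩ := hb.exists
      refine hn.trans ?_
      rw [← norm_eq_of_ae (ae_eq_refl _)]
      exact ENNReal.ofReal_le_ofReal (hnorm _ (hpos n))
  have e : (fun x => freq x * f x) = (2 * Real.pi * Complex.I) • fun x : ℝ => (x : ℂ) * f x := by
    funext x
    simp only [Pi.smul_apply, smul_eq_mul, freq]
    ring
  rw [e, eLpNorm_const_smul, ENNReal.ofReal_mul (by positivity), ← ofReal_norm] at hFatou
  have e2 : ‖(2 * Real.pi * Complex.I : ℂ)‖ = 2 * Real.pi := by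
    simp [abs_of_pos Real.pi_pos]
  rw [e2] at hFatou
  refine (ENNReal.mul_le_mul_iff_right ?_ ENNReal.ofReal_ne_top).mp hFatou
  simp [Real.pi_pos]

section

variable {τ : ℝ} {u u1 u2 : ℝ → L2}

theorem exists_mul_coord {p : L2} {W : ℝ} (hW : 0 ≤ W)
    (h : weightedNorm p ≤ ENNReal.ofReal W) :
    ∃ w : L2, w =ᵐ[volume] (fun x => (x : ℂ) * p x) ∧ ‖w‖ ≤ W := by
  have hm : MemLp (fun x : ℝ => (x : ℂ) * p x) 2 volume :=
    ⟨Complex.continuous_ofReal.aestronglyMeasurable.mul (Lp.aestronglyMeasurable p),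
      h.trans_lt ENNReal.ofReal_lt_top⟩
  refine ⟨hm.toLp _, hm.coeFn_toLp, ?_⟩
  rw [Lp.norm_toLp]
  exact ENNReal.toReal_le_of_le_ofReal hW h

theorem exists_neg_freq_mul {p : L2} {W : ℝ} (hW : 0 ≤ W)
    (h : weightedNorm p ≤ ENNReal.ofReal W) :
    ∃ y : L2, y =ᵐ[volume] (fun x => -freq x * p x) ∧ ‖y‖ ≤ 2 * Real.pi * W := by
  obtain ⟨w, hw, hwn⟩ := exists_mul_coord hW h
  refine ⟨(-(2 * Real.pi * Complex.I) : ℂ) • w, ?_, ?_⟩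
  · filter_upwards [hw, Lp.coeFn_smul (-(2 * Real.pi * Complex.I) : ℂ) w] with x h1 h2
    rw [h2, Pi.smul_apply, h1, smul_eq_mul, freq]
    ring
  · have e : ‖(-(2 * Real.pi * Complex.I) : ℂ)‖ = 2 * Real.pi := by
      simp [abs_of_pos Real.pi_pos]
    rw [norm_smul, e]
    gcongr

/-- The transform of the profile is `𝓕 (u 0) + 2πiη k`. The frequency derivative of the first term
is the weight on the initial datum; that of `ηk` is the scaling bound plus `5τ‖∂ₜk‖ = τ‖u⁵‖`. -/
theorem Evol.weightedNorm_profile_le (h : Evol τ u u1 u2) (hτ : 0 ≤ τ) {W : ℝ} (hW : 0 ≤ W)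
    (hw : weightedNorm (u 0) ≤ ENNReal.ofReal W) {B : ℝ} (hB0 : 0 ≤ B) (hB : 20 * B ^ 4 ≤ 1)
    (hdec : ∀ s ∈ Set.Icc 0 τ, ∀ β : ℝ, 0 < β → β ^ 5 = 1 + s →
      ∀ x, ‖cts (u s) x‖ ≤ B / β ∧ ‖cts (u1 s) x‖ ≤ B / β ^ 2)
    {Q : ℝ} (hQ : τ * ‖quart (u τ) (u τ)‖ ≤ Q) :
    weightedNorm (profile u τ)
      ≤ ENNReal.ofReal (W * (2 + (1 + τ) ^ (1 / 10 : ℝ)) + Q) := by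
  have hr : τ ∈ Set.Icc 0 τ := ⟨hτ, le_rfl⟩
  obtain ⟨w, hw', hwn⟩ := exists_mul_coord hW hw
  obtain ⟨y, hy, hyn⟩ := exists_neg_freq_mul hW hw
  obtain ⟨k, hk0, hkd, hk⟩ := h.exists_primitive hτ
  have hp : 0 ≤ (1 + τ) ^ (1 / 10 : ℝ) := by positivity
  have hQ0 : 0 ≤ Q := (by positivity : 0 ≤ τ * ‖quart (u τ) (u τ)‖).trans hQ
  refine weightedNorm_le_of_weak (by positivity) fun φ => ?_
  rw [fourier_profile]
  have hflux : ‖fluxRate u τ‖ = 1 / 5 * ‖quart (u τ) (u τ)‖ := by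
    rw [fluxRate, norm_smul, norm_mulL2_symbol, Lp.norm_fourier_eq]
    norm_num
  have h1 := norm_integral_mul_deriv_le_of_scaling hτ (hkd τ hr)
    (fun c hc hc1 => h.norm_scaling_difference_le hτ hw' hB0 hB hdec hk0 hkd hk hc hc1) φ
  have h2 := (WD_fourier hy).integral_deriv φ
  have h3 : ∫ η, gprof u τ η * deriv φ η
      = -(∫ η, (𝓕 y : L2) η * φ η) + (2 * Real.pi * Complex.I) * ∫ η, k τ η * (η * deriv φ η) := by
    have hi1 : Integrable fun η => (𝓕 (u 0) : L2) η * deriv φ η :=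
      integrable_mul_schwartz _ (SchwartzMap.derivCLM ℝ ℂ φ)
    have hi2 : Integrable fun η => k τ η * freqMul (SchwartzMap.derivCLM ℝ ℂ φ) η :=
      integrable_mul_schwartz _ _
    have e2 : (2 * Real.pi * Complex.I) * ∫ η, k τ η * (η * deriv φ η)
        = ∫ η, k τ η * freqMul (SchwartzMap.derivCLM ℝ ℂ φ) η := by
      rw [← integral_const_mul]
      refine integral_congr_ae (.of_forall fun η => ?_)
      simp only [freqMul_apply, SchwartzMap.derivCLM_apply, freq]
      ring
    rw [← h2, e2, ← integral_add hi1 hi2]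
    refine integral_congr_ae ?_
    filter_upwards [hk τ hr] with η hη
    rw [hη, freqMul_apply, SchwartzMap.derivCLM_apply]
    ring
  have h4 : ‖∫ η, (𝓕 y : L2) η * φ η‖ ≤ 2 * Real.pi * W * ‖(φ.toLp 2 : L2)‖ := by
    rw [← integral_mul_toLp]
    refine (norm_integral_mul_le _ _).trans ?_
    rw [Lp.norm_fourier_eq]
    exact mul_le_mul_of_nonneg_right hyn (norm_nonneg _)
  have e : ‖(2 * Real.pi * Complex.I : ℂ)‖ = 2 * Real.pi := by
    simp [abs_of_pos Real.pi_pos]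
  have hN : 0 ≤ ‖(φ.toLp 2 : L2)‖ := norm_nonneg _
  generalize ‖(φ.toLp 2 : L2)‖ = N at *
  rw [h3]
  refine (norm_add_le _ _).trans ?_
  rw [norm_neg, norm_mul, e]
  have h5 : ‖w‖ * (1 + (1 + τ) ^ (1 / 10 : ℝ)) + 5 * τ * ‖fluxRate u τ‖
      ≤ W * (1 + (1 + τ) ^ (1 / 10 : ℝ)) + Q := by
    rw [hflux]
    have := mul_le_mul_of_nonneg_right hwn (by positivity : 0 ≤ 1 + (1 + τ) ^ (1 / 10 : ℝ))
    linarith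
  calc _ ≤ 2 * Real.pi * W * N
        + 2 * Real.pi * ((W * (1 + (1 + τ) ^ (1 / 10 : ℝ)) + Q) * N) := by
        refine add_le_add h4 (mul_le_mul_of_nonneg_left (h1.trans ?_) (by positivity))
        exact mul_le_mul_of_nonneg_right h5 hN
    _ = _ := by ring

/-! ### Consequences of the a priori bound -/

/-- At time `α¹⁰` the weight `t^{-1/10}` is `α⁻¹`; the `3` bounds `√(2π)`, from the normalization of
the transform. -/
theorem profile_bounds_of_xNorm {T : EReal} {ε : ℝ} (hε : 0 ≤ ε)
    (hX : xNorm T u ≤ ENNReal.ofReal ε) {α : ℝ} (hα : 1 ≤ α) (ht : α ^ 10 ∈ lifespan T) :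
    weightedNorm (profile u (α ^ 10)) ≤ ENNReal.ofReal (ε * α) ∧
      ∀ᵐ η, ‖gprof u (α ^ 10) η‖ ≤ 3 * ε := by
  have hα0 : 0 < α := by linarith
  have hle := (le_iSup₂ (f := fun (t : ℝ) (_ : t ∈ {t : ℝ | t ∈ lifespan T ∧ 1 ≤ t}) =>
    h2Norm (u t) + ENNReal.ofReal (t ^ (-(1 / 10) : ℝ)) * weightedNorm (profile u t)
      + hatSupNorm (profile u t)) (α ^ 10) ⟨ht, one_le_pow₀ hα⟩).trans hX
  have e : (α ^ 10) ^ (-(1 / 10) : ℝ) = α⁻¹ := by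
    rw [← Real.rpow_natCast, ← Real.rpow_mul hα0.le, ← Real.rpow_neg_one]
    norm_num
  rw [e] at hle
  constructor
  · have h1 : ENNReal.ofReal α⁻¹ * weightedNorm (profile u (α ^ 10)) ≤ ENNReal.ofReal ε :=
      (le_add_self.trans le_self_add).trans hle
    calc weightedNorm (profile u (α ^ 10))
        = ENNReal.ofReal α * (ENNReal.ofReal α⁻¹ * weightedNorm (profile u (α ^ 10))) := by
          rw [← mul_assoc, ← ENNReal.ofReal_mul hα0.le, mul_inv_cancel₀ hα0.ne',
            ENNReal.ofReal_one, one_mul]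
      _ ≤ ENNReal.ofReal α * ENNReal.ofReal ε := by gcongr
      _ = _ := by rw [← ENNReal.ofReal_mul hα0.le, mul_comm]
  · have h1 : hatSupNorm (profile u (α ^ 10)) ≤ ENNReal.ofReal ε := le_add_self.trans hle
    have h2 := eLpNorm_hat (fun _ => 1) (profile u (α ^ 10)) ∞
    simp only [one_mul, ENNReal.div_top, ENNReal.toReal_zero, ENNReal.rpow_zero] at h2
    rw [hatSupNorm, h2, fourier_profile] at h1
    have h2π : 0 < Real.sqrt (2 * Real.pi) := Real.sqrt_pos.mpr (by positivity)
    have h3 : eLpNorm (gprof u (α ^ 10)) ∞ volume ≤ ENNReal.ofReal (3 * ε) := by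
      calc eLpNorm (gprof u (α ^ 10)) ∞ volume
          = ENNReal.ofReal (Real.sqrt (2 * Real.pi)) * (ENNReal.ofReal (Real.sqrt (2 * Real.pi))⁻¹
              * eLpNorm (gprof u (α ^ 10)) ∞ volume) := by
            rw [← mul_assoc, ← ENNReal.ofReal_mul h2π.le, mul_inv_cancel₀ h2π.ne',
              ENNReal.ofReal_one, one_mul]
        _ ≤ ENNReal.ofReal (Real.sqrt (2 * Real.pi)) * ENNReal.ofReal ε := by gcongr
        _ = ENNReal.ofReal (Real.sqrt (2 * Real.pi) * ε) := by rw [ENNReal.ofReal_mul h2π.le]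
        _ ≤ _ := by
          gcongr
          rw [Real.sqrt_le_left (by norm_num)]
          nlinarith [Real.pi_lt_d2]
    rw [eLpNorm_exponent_top] at h3
    filter_upwards [ae_le_eLpNormEssSup (f := gprof u (α ^ 10)) (μ := volume)] with η hη
    have h4 := hη.trans h3
    rwa [← ofReal_norm, ENNReal.ofReal_le_ofReal_iff (by positivity)] at h4

/-- Here `2π ≤ 7` turns the weighted bound into `D = 7ε`, and `c = 3ε`. Both `12 · 7 + 2880 · 3` and
`17 · 7 + 5780 · 3` are below `20000`. -/
theorem Evol.decay (h : Evol τ u u1 u2) {T : EReal} {ε : ℝ} (hε : 0 ≤ ε)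
    (hX : xNorm T u ≤ ENNReal.ofReal ε) {α : ℝ} (hα : 1 ≤ α) (ht : α ^ 10 ∈ lifespan T)
    (htτ : α ^ 10 ∈ Set.Icc 0 τ) {x b : ℝ} (hs : StatScale b (x / α ^ 2)) :
    ‖cts (u (α ^ 10)) x‖ ≤ 20000 * ε / (b ^ 3 * α ^ 2) ∧
      ‖cts (u1 (α ^ 10)) x‖ ≤ 20000 * ε / α ^ 4 := by
  have hα0 : 0 < α := by linarith
  have hb : 1 ≤ b := hs.1
  obtain ⟨h1, h2⟩ := profile_bounds_of_xNorm hε hX hα ht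
  obtain ⟨y, hy, hyn⟩ := exists_neg_freq_mul (by positivity) h1
  have hd := WD_fourier hy
  rw [fourier_profile] at hd
  have hD : ‖(𝓕 y : L2)‖ ≤ (7 * ε) * α := by
    rw [Lp.norm_fourier_eq]
    refine hyn.trans ?_
    rw [← mul_assoc]
    gcongr
    linarith [Real.pi_lt_d2]
  obtain ⟨a1, a2⟩ := norm_cts_le_of_profile (h.wd1 _ htτ) (h.wd2 _ htτ) hα rfl hd h2 hD hs
  refine ⟨a1.trans ?_, a2.trans ?_⟩
  · gcongr
    linarith
  · gcongr
    linarith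

end

/-! ### Assembling the bounds -/

section

variable {τ : ℝ} {u u1 u2 : ℝ → L2}

/-- The `H²` norm stays comparable to its initial size. -/
theorem Evol.norms_le (h : Evol τ u u1 u2) {ε : ℝ} (hε : ε ≤ 1) (h0 : ‖u 0‖ ≤ ε)
    (h2 : ‖u2 0‖ ≤ ε) {t : ℝ} (ht : t ∈ Set.Icc 0 τ) :
    ‖u t‖ ≤ ε ∧ ‖u1 t‖ ≤ 2 * ε ∧ ‖u2 t‖ ≤ 2 * ε := by
  have hsub : Set.Icc 0 t ⊆ Set.Icc 0 τ := Set.Icc_subset_Icc le_rfl ht.2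
  have ht' : Evol t u u1 u2 :=
    { wd1 := fun s hs => h.wd1 s (hsub hs)
      wd2 := fun s hs => h.wd2 s (hsub hs)
      cont := h.cont.mono hsub
      cont1 := h.cont1.mono hsub
      cont2 := h.cont2.mono hsub
      real := fun s hs => h.real s (hsub hs)
      eqn := fun χ s hs => (h.eqn χ s (hsub hs)).mono hsub }
  have a0 : ‖u t‖ ≤ ε := by rwa [h.mass ht]
  have a2 := ht'.norm_snd_le ht.1 h0 h2 hε
  have hε0 : 0 ≤ ε := (norm_nonneg _).trans h0
  refine ⟨a0, ?_, a2⟩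
  have a1 := (h.wd1 t ht).norm_sq_le (h.wd2 t ht)
  have : ‖u t‖ * ‖u2 t‖ ≤ ε * (2 * ε) := by gcongr
  nlinarith [norm_nonneg (u1 t)]

theorem norm_quart_self_le {p q : L2} (h : WD p q) {M : ℝ} (hM : ∀ x, ‖cts p x‖ ≤ M) :
    ‖quart p p‖ ≤ M ^ 4 * ‖p‖ := by
  refine norm_L2_le_of_ae ?_
  filter_upwards [h.quart_coe p] with x hx
  rw [hx, norm_mul, norm_pow]
  gcongr
  exact hM x

theorem exists_tenth_root {t : ℝ} (ht : 1 ≤ t) :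
    ∃ α : ℝ, 1 ≤ α ∧ α ^ 10 = t ∧ α = t ^ (1 / 10 : ℝ) := by
  have h0 : 0 ≤ t := by linarith
  refine ⟨t ^ (1 / 10 : ℝ), Real.one_le_rpow ht (by norm_num), ?_, rfl⟩
  rw [← Real.rpow_natCast, ← Real.rpow_mul h0]
  norm_num

/-- The a priori bound says nothing before time `1`, where Sobolev embedding and the `H²` bound
suffice. After time `1`, `1 + s ≤ 32s` gives `β ≤ 2s^{1/5}`, and passing from `s` to `1 + s` costs
at most a factor `4`. -/
theorem Evol.cts_le (h : Evol τ u u1 u2) {T : EReal} {ε ε' : ℝ} (hε : ε ≤ 1) (hεε : ε ≤ ε')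
    (h0 : ‖u 0‖ ≤ ε) (h2 : ‖u2 0‖ ≤ ε) (hX : xNorm T u ≤ ENNReal.ofReal ε')
    (hτT : τ ∈ lifespan T) {s : ℝ} (hs : s ∈ Set.Icc 0 τ) {β : ℝ} (hβ : 0 < β)
    (hβs : β ^ 5 = 1 + s) (x : ℝ) :
    ‖cts (u s) x‖ ≤ 80000 * ε' / β ∧ ‖cts (u1 s) x‖ ≤ 80000 * ε' / β ^ 2 := by
  have hε0 : 0 ≤ ε := (norm_nonneg _).trans h0
  obtain ⟨a0, a1, a2⟩ := h.norms_le hε h0 h2 hs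
  rcases le_or_gt s 1 with hs1 | hs1
  · have hβ2 : β ≤ 2 := by
      refine (pow_le_pow_iff_left₀ hβ.le (by norm_num) (n := 5) (by norm_num)).mp ?_
      rw [hβs]; linarith
    have b0 := (h.wd1 s hs).norm_cts_le x
    have b1 := (h.wd2 s hs).norm_cts_le x
    constructor
    · rw [le_div_iff₀ hβ]
      nlinarith [norm_nonneg (cts (u s) x)]
    · rw [le_div_iff₀ (by positivity)]
      have : β ^ 2 ≤ 4 := by nlinarith
      nlinarith [norm_nonneg (cts (u1 s) x)]
  · obtain ⟨α, hα, hαs, -⟩ := exists_tenth_root hs1.le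
    have hα0 : 0 < α := by linarith
    obtain ⟨b, hb⟩ := exists_statScale (x / α ^ 2)
    have hb1 : 1 ≤ b := hb.1
    have hsT : α ^ 10 ∈ lifespan T := by
      rw [hαs]
      exact ⟨hs.1, lt_of_le_of_lt (EReal.coe_le_coe_iff.mpr hs.2) hτT.2⟩
    have hd := h.decay (hε0.trans hεε) hX hα hsT (by rwa [hαs]) hb
    rw [hαs] at hd
    have hβα : β ≤ 2 * α ^ 2 := by
      refine (pow_le_pow_iff_left₀ hβ.le (by positivity) (n := 5) (by norm_num)).mp ?_
      rw [hβs, mul_pow, ← pow_mul, hαs]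
      linarith
    have hε' : 0 ≤ ε' := hε0.trans hεε
    refine ⟨hd.1.trans ?_, hd.2.trans ?_⟩
    · have hb3 : 1 ≤ b ^ 3 := one_le_pow₀ hb1
      have : 0 < α ^ 2 := by positivity
      rw [div_le_div_iff₀ (by positivity) hβ]
      have h1 : β ≤ 2 * (b ^ 3 * α ^ 2) := by nlinarith
      nlinarith
    · rw [div_le_div_iff₀ (by positivity) (by positivity)]
      have h1 : β ^ 2 ≤ 4 * α ^ 4 := by
        calc β ^ 2 ≤ (2 * α ^ 2) ^ 2 := by gcongr
          _ = _ := by ring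
      nlinarith

/-- Same division at time `1`: the sup bound before it, the spatially decaying dispersive bound
after it. -/
theorem Evol.mul_norm_quart_le (h : Evol τ u u1 u2) {T : EReal} {ε ε' : ℝ} (hε : ε ≤ 1)
    (hεε : ε ≤ ε') (h0 : ‖u 0‖ ≤ ε) (h2 : ‖u2 0‖ ≤ ε) (hX : xNorm T u ≤ ENNReal.ofReal ε')
    (hτT : τ ∈ lifespan T) :
    τ * ‖quart (u τ) (u τ)‖ ≤ 9 * (20000 * ε') ^ 5 * (1 + τ) ^ (1 / 10 : ℝ) := by
  have hτ : 0 ≤ τ := hτT.1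
  have hr : τ ∈ Set.Icc 0 τ := ⟨hτ, le_rfl⟩
  have hε0 : 0 ≤ ε := (norm_nonneg _).trans h0
  have hε' : 0 ≤ ε' := hε0.trans hεε
  obtain ⟨a0, a1, a2⟩ := h.norms_le hε h0 h2 hr
  rcases le_or_gt τ 1 with h1 | h1
  · have hq := norm_quart_self_le (h.wd1 τ hr) (M := 3 * ε) fun x => by
      have := (h.wd1 τ hr).norm_cts_le x
      linarith
    have h3 : (1 : ℝ) ≤ (1 + τ) ^ (1 / 10 : ℝ) := Real.one_le_rpow (by linarith) (by norm_num)
    calc τ * ‖quart (u τ) (u τ)‖ ≤ 1 * ((3 * ε') ^ 4 * ε') := by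
          gcongr
          exact hq.trans (by gcongr; exact a0.trans hεε)
      _ ≤ 9 * (20000 * ε') ^ 5 * 1 := by
          have := pow_nonneg hε' 5
          nlinarith
      _ ≤ _ := by gcongr
  · obtain ⟨α, hα, hατ, hαe⟩ := exists_tenth_root h1.le
    have hd := norm_quart_le_of_decay (h.wd1 τ hr) hα (K := 20000 * ε') fun x b hb => by
      have := (h.decay hε' hX hα (by rwa [hατ]) (by rwa [hατ]) hb).1
      rwa [hατ] at this
    rw [hατ] at hd
    refine hd.trans ?_
    gcongr
    rw [hαe]
    gcongr
    linarith

theorem one_add_rpow_le_bracket {τ : ℝ} (hτ : 0 ≤ τ) :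
    (1 + τ) ^ (1 / 10 : ℝ) ≤ 2 * Real.sqrt (1 + τ ^ 2) ^ (1 / 10 : ℝ) := by
  have h1 : 1 + τ ≤ 2 * Real.sqrt (1 + τ ^ 2) := by
    have h2 : τ ≤ Real.sqrt (1 + τ ^ 2) := Real.le_sqrt_of_sq_le (by linarith)
    have h3 : 1 ≤ Real.sqrt (1 + τ ^ 2) := Real.one_le_sqrt.mpr (by nlinarith)
    linarith
  calc (1 + τ) ^ (1 / 10 : ℝ) ≤ (2 * Real.sqrt (1 + τ ^ 2)) ^ (1 / 10 : ℝ) := by gcongr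
    _ = 2 ^ (1 / 10 : ℝ) * Real.sqrt (1 + τ ^ 2) ^ (1 / 10 : ℝ) :=
      Real.mul_rpow (by norm_num) (Real.sqrt_nonneg _)
    _ ≤ 2 ^ (1 : ℝ) * Real.sqrt (1 + τ ^ 2) ^ (1 / 10 : ℝ) := by
      gcongr
      · norm_num
      · norm_num
    _ = _ := by rw [Real.rpow_one]

theorem IsSolution.bounds {T : EReal} {u₀ : L2} (h : IsSolution T u₀ u) {ε ε' : ℝ}
    (hε0 : 0 ≤ ε) (hε : ε ≤ 1) (hεε : ε ≤ ε') (hε' : 240000 * ε' ≤ 1)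
    (hu₀ : h2Norm u₀ + weightedNorm u₀ ≤ ENNReal.ofReal ε)
    (hX : xNorm T u ≤ ENNReal.ofReal ε') {t : ℝ} (ht : t ∈ lifespan T) :
    h2Norm (u t) ≤ ENNReal.ofReal (3 * ε) ∧
      weightedNorm (profile u t) ≤ ENNReal.ofReal (ε * (2 + (1 + t) ^ (1 / 10 : ℝ))
        + 9 * (20000 * ε') ^ 5 * (1 + t) ^ (1 / 10 : ℝ)) := by
  have hE := evol_of_isSolution h ht
  have hr : t ∈ Set.Icc 0 t := ⟨ht.1, le_rfl⟩
  have hh : h2Norm (u 0) ≤ ENNReal.ofReal ε := by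
    rw [h.initial]; exact le_self_add.trans hu₀
  have hw : weightedNorm (u 0) ≤ ENNReal.ofReal ε := by
    rw [h.initial]; exact le_add_self.trans hu₀
  obtain ⟨p1, p2, w1, w2, n0, -, n2⟩ := exists_derivs (hh.trans_lt ENNReal.ofReal_lt_top)
  have hreal := ENNReal.toReal_le_of_le_ofReal hε0 hh
  have n2' : ‖wderiv (wderiv (u 0))‖ ≤ ε := by
    rw [w1.wderiv_eq, w2.wderiv_eq]; exact n2.trans hreal
  have n0' := n0.trans hreal
  have hε'0 := hε0.trans hεε
  constructor
  · obtain ⟨a0, -, a2⟩ := hE.norms_le hε n0' n2' hr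
    rw [h2Norm_of_WD (hE.wd1 t hr) (hE.wd2 t hr)]
    refine ENNReal.ofReal_le_ofReal ((norm_sub_le _ _).trans ?_)
    linarith
  · refine hE.weightedNorm_profile_le ht.1 hε0 hw (B := 80000 * ε') (by positivity) ?_
      (fun s hs β hβ hβs x => hE.cts_le hε hεε n0' n2' hX ht hs hβ hβs x)
      (hE.mul_norm_quart_le hε hεε n0' n2' hX ht)
    -- The smallness `240000ε' ≤ 1` is what keeps the growth exponent at `1/10`.
    calc 20 * (80000 * ε') ^ 4 ≤ 20 * (1 / 3) ^ 4 := by gcongr; linarith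
      _ ≤ 1 := by norm_num

end

end FifthKdV

end

/-! ### Choice of the constants -/

theorem proposition1 :
    ∃ C : ℝ, 0 < C ∧ ∃ εbar : ℝ, 0 < εbar ∧
      ∀ ε₀ ε₁ : ℝ, 0 ≤ ε₀ → ε₀ ≤ εbar → ε₁ = ε₀ ^ (1 / 5 : ℝ) →
      ∀ (T : EReal), 0 < T →
      ∀ (u₀ : FifthKdV.L2) (u : ℝ → FifthKdV.L2),
        FifthKdV.h2Norm u₀ + FifthKdV.weightedNorm u₀ ≤ ENNReal.ofReal ε₀ →
        FifthKdV.IsSolution T u₀ u →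
        FifthKdV.xNorm T u ≤ ENNReal.ofReal ε₁ →
        ∀ t ∈ FifthKdV.lifespan T,
          FifthKdV.h2Norm (u t) ≤ ENNReal.ofReal (C * ε₀) ∧
          FifthKdV.weightedNorm (FifthKdV.profile u t) ≤
            ENNReal.ofReal (C * (ε₀ + ε₁ ^ 5) * (Real.sqrt (1 + t ^ 2)) ^ (1 / 10 : ℝ)) := by
  -- The threshold is the fifth power of the smallness required of `ε₁`. In `C`, the `4` comes from
  -- the initial weight and `18` is `9` times the factor `2` between `(1 + t)^{1/10}` and
  -- `⟨t⟩^{1/10}`; since `ε₁⁵ = ε₀`, everything is first bounded by a multiple of `ε₀`.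
  refine ⟨4 + 18 * 20000 ^ 5, by norm_num, (1 / 240000) ^ 5, by norm_num, ?_⟩
  intro ε₀ ε₁ h0 hbar h1 T _ u₀ u hu₀ hsol hX t ht
  have e5 : ε₁ ^ 5 = ε₀ := by
    rw [h1, ← Real.rpow_natCast, ← Real.rpow_mul h0]
    norm_num
  have h10 : 0 ≤ ε₁ := by rw [h1]; positivity
  have hε₁ : ε₁ ≤ 1 / 240000 := by
    refine (pow_le_pow_iff_left₀ h10 (by norm_num) (n := 5) (by norm_num)).mp ?_
    rwa [e5]
  have hle : ε₀ ≤ ε₁ := by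
    rw [← e5]
    exact pow_le_of_le_one h10 (by linarith) (by norm_num)
  obtain ⟨a, b⟩ := hsol.bounds h0 (by linarith) hle (by linarith) hu₀ hX ht
  refine ⟨a.trans (ENNReal.ofReal_le_ofReal ?_), b.trans (ENNReal.ofReal_le_ofReal ?_)⟩
  · gcongr
    norm_num
  · have hs : 1 ≤ Real.sqrt (1 + t ^ 2) ^ (1 / 10 : ℝ) :=
      Real.one_le_rpow (Real.one_le_sqrt.mpr (by nlinarith)) (by norm_num)
    have hb := FifthKdV.one_add_rpow_le_bracket ht.1
    set S := Real.sqrt (1 + t ^ 2) ^ (1 / 10 : ℝ)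
    rw [mul_pow, e5]
    calc ε₀ * (2 + (1 + t) ^ (1 / 10 : ℝ)) + 9 * (20000 ^ 5 * ε₀) * (1 + t) ^ (1 / 10 : ℝ)
        ≤ ε₀ * (2 * S + 2 * S) + 9 * (20000 ^ 5 * ε₀) * (2 * S) := by
          gcongr
          linarith
      _ = (4 + 18 * 20000 ^ 5) * ε₀ * S := by ring
      _ ≤ _ := by
          gcongr
          linarith
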